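/- Theorem 3.2. All locally compact groups are Hausdorff, unitary representations are strongly continuous and act on complex Hilbert spaces. Let $G$ be a non-compact locally compact group with Kazhdan's property (T): there are a compact set $Q\subseteq G$ and $\varepsilon>0$ such that every unitary representation $\pi$ of $G$ that has a vector $\xi\neq 0$ with $\|\pi(s)\xi-\xi\|<\varepsilon\|\xi\|$ for all $s\in Q$ has a nonzero $G$-invariant vector. Suppose that the almost periodic (Bohr) compactification $G^{\mathrm{AP}}$ of $G$, i.e. the closure of the image of $G$ in the product of the unitary groups $U(n)$ over all continuous homomorphisms $G\to U(n)$, $n\in\mathbb N$, is finite. Then the Fourier–Stieltjes algebra $B(G)$ is not operator Connes-amenable. Here $B(G)$ is the algebra, under pointwise operations, of all coefficient functions $\pi_{\xi,\eta}(s)=\langle\pi(s)\xi,\eta\rangle$ of unitary representations $\pi$ of $G$. It is identified with the dual of the full group C*-algebra $C^*(G)$ through $\langle a,\pi_{\xi,\eta}\rangle=\langle\pi(a)\xi,\eta\rangle$, and it carries the resulting weak*-topology and dual operator space structure $M_n(B(G))=CB(C^*(G),M_n)$. A normal dual operator $B(G)$-bimodule is a $B(G)$-bimodule $E=(E_*)^*$,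 with $E_*$ a (complete) operator space and $E$ carrying the dual operator space structure, such that the module actions $B(G)\times E\to E$ and $E\times B(G)\to E$ are (jointly) completely bounded and separately weak*-continuous in each variable. The algebra $B(G)$ is operator Connes-amenable if for every normal dual operator $B(G)$-bimodule $E$ and every weak*-continuous, completely bounded derivation $D\colon B(G)\to E$ there is $x\in E$ with $D(u)=u\cdot x-x\cdot u$ for all $u\in B(G)$. -/

import Mathlib

open MeasureTheory
open scoped ENNReal NNReal TensorProduct CompactlySupported Matrix.Norms.L2Operator

noncomputable section

universe u

/-! ### Operator spaces -/

/-- A choice of a size `‖x‖ ∈ [0, ∞]` for every square matrix `x` over `V`. -/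
class MatrixNorms (V : Type*) where
  matNorm : ∀ {ι : Type} [Fintype ι] [DecidableEq ι], Matrix ι ι V → ℝ≥0∞


/-- The product `α x β` of a matrix `x` over a complex vector space with scalar matrices. -/
def scalarMulMul {V : Type*} [AddCommGroup V] [Module ℂ V] {ι κ : Type} [Fintype κ]
    (α : Matrix ι κ ℂ) (x : Matrix κ κ V) (β : Matrix κ ι ℂ) : Matrix ι ι V :=
  Matrix.of fun i j => ∑ k, ∑ l, (α i k * β l j) • x k l

/-- An (abstract) operator space: a normed space with norms on all the spaces of square
matrices over it, subject to Ruan's axioms. Scalar matrices carry the operator norm between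
Euclidean spaces. (Homogeneity, definiteness and finiteness of the matrix norms, and their
invariance under relabelling of the index set, follow from these axioms.) -/
class OperatorSpace (V : Type*) [NormedAddCommGroup V] [NormedSpace ℂ V]
    extends MatrixNorms V where
  matNorm_single : ∀ v : V, matNorm (Matrix.of fun _ _ : Fin 1 => v) = ‖v‖ₑ
  matNorm_add_le : ∀ {ι : Type} [Fintype ι] [DecidableEq ι] (x y : Matrix ι ι V),
    matNorm (x + y) ≤ matNorm x + matNorm y
  matNorm_scalarMulMul_le : ∀ {ι κ : Type} [Fintype ι] [DecidableEq ι] [Fintype κ] [DecidableEq κ]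
    (α : Matrix ι κ ℂ) (x : Matrix κ κ V) (β : Matrix κ ι ℂ),
    matNorm (scalarMulMul α x β) ≤ ‖α‖ₑ * matNorm x * ‖β‖ₑ
  matNorm_fromBlocks : ∀ {ι κ : Type} [Fintype ι] [DecidableEq ι] [Fintype κ] [DecidableEq κ]
    (x : Matrix ι ι V) (y : Matrix κ κ V),
    matNorm (Matrix.fromBlocks x 0 0 y) = max (matNorm x) (matNorm y)

/-- The dual operator space structure `M_ι(F^*) = CB(F, M_ι)`: the norm of `[u i j]` is the
supremum of the operator norms of the scalar matrices `[u i j (a k l)]`, indexed by pairs, over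
all `m` and all `a ∈ M_m(F)` of norm at most `1`. -/
instance StrongDual.instMatrixNorms (F : Type*) [NormedAddCommGroup F] [NormedSpace ℂ F]
    [MatrixNorms F] : MatrixNorms (StrongDual ℂ F) where
  matNorm {ι} _ _ u := ⨆ (m : ℕ) (a : Matrix (Fin m) (Fin m) F) (_ : MatrixNorms.matNorm a ≤ 1),
    ‖(Matrix.of fun p q : ι × Fin m => u p.1 q.1 (a p.2 q.2))‖ₑ

/-- Complete boundedness of a linear map. -/
def IsCompletelyBounded {V W : Type*} [AddCommGroup V] [Module ℂ V] [AddCommGroup W] [Module ℂ W]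
    [MatrixNorms V] [MatrixNorms W] (T : V →ₗ[ℂ] W) : Prop :=
  ∃ C : ℝ≥0, ∀ (n : ℕ) (x : Matrix (Fin n) (Fin n) V),
    MatrixNorms.matNorm (x.map T) ≤ C * MatrixNorms.matNorm x

/-- (Joint) complete boundedness of a bilinear map, i.e. complete boundedness of the induced map
on the operator space projective tensor product. -/
def IsJointlyCompletelyBounded {U V W : Type*} [AddCommGroup U] [Module ℂ U] [AddCommGroup V]
    [Module ℂ V] [AddCommGroup W] [Module ℂ W] [MatrixNorms U] [MatrixNorms V] [MatrixNorms W]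
    (T : U →ₗ[ℂ] V →ₗ[ℂ] W) : Prop :=
  ∃ C : ℝ≥0, ∀ (n m : ℕ) (x : Matrix (Fin n) (Fin n) U) (y : Matrix (Fin m) (Fin m) V),
    MatrixNorms.matNorm (Matrix.of fun p q : Fin n × Fin m => T (x p.1 q.1) (y p.2 q.2)) ≤
      C * MatrixNorms.matNorm x * MatrixNorms.matNorm y

/-! ### Operator Connes-amenability -/

/-- A normal dual operator `A`-bimodule structure on the dual operator space `E = F^*`, where the
topology of `A` is its weak* topology: `left a x = a · x` and `right a x = x · a`. The actions are
completely bounded; `E` is a dual bimodule, i.e. `x ↦ a · x` and `x ↦ x · a` are weak*-continuous;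
and `E` is normal, i.e. `a ↦ a · x` and `a ↦ x · a` are weak*-continuous. -/
structure NormalDualOperatorBimodule (A : Type*) [Ring A] [Algebra ℂ A] [MatrixNorms A]
    [TopologicalSpace A] (F : Type*) [NormedAddCommGroup F] [NormedSpace ℂ F]
    [OperatorSpace F] where
  left : A →ₗ[ℂ] StrongDual ℂ F →ₗ[ℂ] StrongDual ℂ F
  right : A →ₗ[ℂ] StrongDual ℂ F →ₗ[ℂ] StrongDual ℂ F
  left_mul : ∀ a b x, left (a * b) x = left a (left b x)
  right_mul : ∀ a b x, right (a * b) x = right b (right a x)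
  left_right : ∀ a b x, left a (right b x) = right b (left a x)
  left_cb : IsJointlyCompletelyBounded left
  right_cb : IsJointlyCompletelyBounded right
  left_dual : ∀ a, Continuous fun x : WeakDual ℂ F =>
    StrongDual.toWeakDual (left a (WeakDual.toStrongDual x))
  right_dual : ∀ a, Continuous fun x : WeakDual ℂ F =>
    StrongDual.toWeakDual (right a (WeakDual.toStrongDual x))
  left_normal : ∀ x, Continuous fun a : A => StrongDual.toWeakDual (left a x)
  right_normal : ∀ x, Continuous fun a : A => StrongDual.toWeakDual (right a x)

/-- Operator Connes-amenability of an algebra `A` with given matrix norms, whose topology is its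
weak* topology: every weak*-continuous completely bounded derivation from `A` into a normal dual
operator `A`-bimodule is inner. -/
def IsOperatorConnesAmenable (A : Type u) [Ring A] [Algebra ℂ A] [MatrixNorms A]
    [TopologicalSpace A] : Prop :=
  ∀ (F : Type u) [NormedAddCommGroup F] [NormedSpace ℂ F] [CompleteSpace F] [OperatorSpace F]
    (E : NormalDualOperatorBimodule A F) (D : A →ₗ[ℂ] StrongDual ℂ F),
    IsCompletelyBounded D →
    (Continuous fun a : A => StrongDual.toWeakDual (D a)) →
    (∀ a b, D (a * b) = E.left a (D b) + E.right b (D a)) →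
    ∃ x : StrongDual ℂ F, ∀ a, D a = E.left a x - E.right a x

/-! ### Unitary representations -/

/-- A strongly continuous unitary representation of `G` on a Hilbert space. -/
structure UnitaryRep (G : Type u) [Group G] [TopologicalSpace G] where
  H : Type u
  [normed : NormedAddCommGroup H]
  [innerProduct : InnerProductSpace ℂ H]
  [complete : CompleteSpace H]
  π : G →* (H ≃ₗᵢ[ℂ] H)
  continuous_apply : ∀ ξ : H, Continuous fun s => π s ξ

namespace UnitaryRep

attribute [instance] normed innerProduct complete

section

variable {G : Type u} [Group G] [TopologicalSpace G]

/-- The matrix coefficient `s ↦ ⟨π(s)ξ, η⟩` (Mathlib's inner product is linear in the second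
variable). -/
def coeff (ρ : UnitaryRep G) (ξ η : ρ.H) : G → ℂ := fun s => inner ℂ η (ρ.π s ξ)

/-- A constructor from a multiplicative family of isometries. -/
def ofIsometry (H : Type u) [NormedAddCommGroup H] [InnerProductSpace ℂ H] [CompleteSpace H]
    (T : G → H →L[ℂ] H) (hn : ∀ s ξ, ‖T s ξ‖ = ‖ξ‖) (h1 : ∀ ξ, T 1 ξ = ξ)
    (hm : ∀ s t ξ, T (s * t) ξ = T s (T t ξ)) (hc : ∀ ξ, Continuous fun s => T s ξ) :
    UnitaryRep G where
  H := H
  π :=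
    { toFun := fun s =>
        { toFun := T s
          invFun := T s⁻¹
          left_inv := fun ξ => by rw [← hm]; simp [h1]
          right_inv := fun ξ => by rw [← hm]; simp [h1]
          map_add' := by simp
          map_smul' := by simp
          norm_map' := hn s }
      map_one' := by ext ξ; exact h1 ξ
      map_mul' := fun s t => by ext ξ; exact hm s t ξ }
  continuous_apply := hc

/-- The trivial one-dimensional representation. -/
def trivial (G : Type u) [Group G] [TopologicalSpace G] : UnitaryRep G :=
  ofIsometry (EuclideanSpace ℂ PUnit.{u + 1}) (fun _ => ContinuousLinearMap.id _ _)
    (by simp) (by simp) (by simp) (fun _ => continuous_const)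

/-- The direct sum of two representations. -/
def directSum (ρ σ : UnitaryRep G) : UnitaryRep G :=
  ofIsometry (WithLp 2 (ρ.H × σ.H))
    (fun s => ((WithLp.prodContinuousLinearEquiv 2 ℂ ρ.H σ.H).symm.toContinuousLinearMap).comp
      (((ρ.π s).toContinuousLinearEquiv.toContinuousLinearMap.prodMap
        (σ.π s).toContinuousLinearEquiv.toContinuousLinearMap).comp
        (WithLp.prodContinuousLinearEquiv 2 ℂ ρ.H σ.H).toContinuousLinearMap))
    (by
      intro s ξ
      rw [← sq_eq_sq₀ (norm_nonneg _) (norm_nonneg _), WithLp.prod_norm_sq_eq_of_L2,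
        WithLp.prod_norm_sq_eq_of_L2]
      simp)
    (by intro ξ; simp)
    (by intro s t ξ; simp; rfl)
    (by
      intro ξ
      refine (WithLp.prodContinuousLinearEquiv 2 ℂ ρ.H σ.H).symm.continuous.comp ?_
      exact (ρ.continuous_apply ξ.fst).prodMk (σ.continuous_apply ξ.snd))

/-- The tensor product of two representations, on the Hilbert space tensor product. -/
def tensor (ρ σ : UnitaryRep G) : UnitaryRep G :=
  ofIsometry (UniformSpace.Completion (ρ.H ⊗[ℂ] σ.H))
    (fun s => (TensorProduct.mapIsometry (ρ.π s).toLinearIsometry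
      (σ.π s).toLinearIsometry).toContinuousLinearMap.completion)
    (by
      intro s ξ
      induction ξ using UniformSpace.Completion.induction_on with
      | hp => exact isClosed_eq (by fun_prop) (by fun_prop)
      | ih x => simp)
    (by
      intro ξ
      induction ξ using UniformSpace.Completion.induction_on with
      | hp => exact isClosed_eq (by fun_prop) (by fun_prop)
      | ih x =>
        rw [ContinuousLinearMap.completion_apply_coe]
        congr 1
        induction x using TensorProduct.induction_on with
        | zero => simp
        | tmul x y => simp
        | add x y hx hy => rw [map_add, hx, hy])
    (by
      intro s t ξ
      induction ξ using UniformSpace.Completion.induction_on with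
      | hp => exact isClosed_eq (by fun_prop) (by fun_prop)
      | ih x =>
        simp only [ContinuousLinearMap.completion_apply_coe]
        congr 1
        induction x using TensorProduct.induction_on with
        | zero => simp
        | tmul x y => simp
        | add x y hx hy => simp only [map_add, hx, hy])
    (by
      intro ξ
      refine continuous_of_uniform_approx_of_continuous fun U hU => ?_
      obtain ⟨ε, hε, hεU⟩ := Metric.mem_uniformity_dist.1 hU
      obtain ⟨x, hx⟩ := UniformSpace.Completion.denseRange_coe.exists_dist_lt ξ hε
      refine ⟨fun s => (TensorProduct.mapIsometry (ρ.π s).toLinearIsometry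
        (σ.π s).toLinearIsometry).toContinuousLinearMap.completion x, ?_, fun s => hεU ?_⟩
      · simp only [ContinuousLinearMap.completion_apply_coe]
        refine (UniformSpace.Completion.continuous_coe _).comp ?_
        clear hx
        induction x using TensorProduct.induction_on with
        | zero => simpa using continuous_const
        | tmul x y =>
          exact TensorProduct.continuous_tmul.comp
            ((ρ.continuous_apply x).prodMk (σ.continuous_apply y))
        | add x y hx hy =>
          simp only [map_add]
          exact hx.add hy
      · rw [dist_eq_norm, ← map_sub]
        rw [dist_eq_norm] at hx
        refine lt_of_eq_of_lt ?_ hx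
        generalize ξ - (x : UniformSpace.Completion (ρ.H ⊗[ℂ] σ.H)) = ζ
        induction ζ using UniformSpace.Completion.induction_on with
        | hp => exact isClosed_eq (by fun_prop) (by fun_prop)
        | ih x => simp)

/-- The constant function `1`, sums and products of coefficients. -/
theorem coeff_trivial (c : ℂ) (s : G) :
    (trivial G).coeff (WithLp.toLp 2 fun _ => c : EuclideanSpace ℂ PUnit.{u + 1})
      (WithLp.toLp 2 fun _ => (1 : ℂ) : EuclideanSpace ℂ PUnit.{u + 1}) s = c := by
  change inner ℂ (WithLp.toLp 2 fun _ => (1 : ℂ) : EuclideanSpace ℂ PUnit.{u + 1})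
    (WithLp.toLp 2 fun _ => c : EuclideanSpace ℂ PUnit.{u + 1}) = c
  simp [PiLp.inner_apply]

theorem coeff_directSum (ρ σ : UnitaryRep G) (ξ η : ρ.H) (ξ' η' : σ.H) (s : G) :
    (ρ.directSum σ).coeff (WithLp.toLp 2 (ξ, ξ') : WithLp 2 (ρ.H × σ.H))
      (WithLp.toLp 2 (η, η') : WithLp 2 (ρ.H × σ.H)) s = ρ.coeff ξ η s + σ.coeff ξ' η' s :=
  rfl

theorem coeff_tensor (ρ σ : UnitaryRep G) (ξ η : ρ.H) (ξ' η' : σ.H) (s : G) :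
    (ρ.tensor σ).coeff ((ξ ⊗ₜ[ℂ] ξ' : ρ.H ⊗[ℂ] σ.H) : UniformSpace.Completion (ρ.H ⊗[ℂ] σ.H))
      ((η ⊗ₜ[ℂ] η' : ρ.H ⊗[ℂ] σ.H) : UniformSpace.Completion (ρ.H ⊗[ℂ] σ.H)) s =
      ρ.coeff ξ η s * σ.coeff ξ' η' s := by
  have h : (ρ.tensor σ).π s
      ((ξ ⊗ₜ[ℂ] ξ' : ρ.H ⊗[ℂ] σ.H) : UniformSpace.Completion (ρ.H ⊗[ℂ] σ.H)) =
      ((ρ.π s ξ ⊗ₜ[ℂ] σ.π s ξ' : ρ.H ⊗[ℂ] σ.H) : UniformSpace.Completion (ρ.H ⊗[ℂ] σ.H)) := by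
    exact (ContinuousLinearMap.completion_apply_coe _ _).trans (by simp)
  unfold coeff
  rw [h]
  exact (UniformSpace.Completion.inner_coe _ _).trans (TensorProduct.inner_tmul ..)

end

/-! ### The integrated form of a representation -/

section

variable {G : Type u} [Group G] [TopologicalSpace G] [IsTopologicalGroup G]
  [LocallyCompactSpace G] [MeasurableSpace G] [BorelSpace G]

theorem integrable_smul (ρ : UnitaryRep G) (f : C_c(G, ℂ)) (ξ : ρ.H) :
    Integrable (fun s => f s • ρ.π s ξ) (Measure.haar : Measure G) :=
  (f.continuous.smul (ρ.continuous_apply ξ)).integrable_of_hasCompactSupport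
    f.hasCompactSupport.smul_right

/-- The operator `π(f) = ∫ f(s) π(s) ds` (in the strong sense), with respect to left Haar
measure. -/
def integrate (ρ : UnitaryRep G) : C_c(G, ℂ) →ₗ[ℂ] (ρ.H →L[ℂ] ρ.H) where
  toFun f := LinearMap.mkContinuous
    { toFun := fun ξ => ∫ s, f s • ρ.π s ξ ∂(Measure.haar : Measure G)
      map_add' := fun ξ η => by
        simp only [map_add, smul_add]
        exact integral_add (ρ.integrable_smul f ξ) (ρ.integrable_smul f η)
      map_smul' := fun c ξ => by
        simp only [map_smul, RingHom.id_apply]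
        rw [← integral_smul]
        simp only [smul_comm c] }
    (∫ s, ‖f s‖ ∂(Measure.haar : Measure G))
    (fun ξ => by
      refine (norm_integral_le_integral_norm _).trans (le_of_eq ?_)
      simp only [norm_smul, LinearIsometryEquiv.norm_map]
      exact integral_mul_const _ _)
  map_add' f g := by
    ext ξ
    simp only [CompactlySupportedContinuousMap.coe_add, Pi.add_apply, add_smul]
    exact integral_add (ρ.integrable_smul f ξ) (ρ.integrable_smul g ξ)
  map_smul' c f := by
    ext ξ
    simp only [CompactlySupportedContinuousMap.coe_smul, Pi.smul_apply, smul_assoc]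
    exact integral_smul _ _

theorem integrate_apply (ρ : UnitaryRep G) (f : C_c(G, ℂ)) (ξ : ρ.H) :
    ρ.integrate f ξ = ∫ s, f s • ρ.π s ξ ∂(Measure.haar : Measure G) := rfl

theorem norm_integrate_le (ρ : UnitaryRep G) (f : C_c(G, ℂ)) :
    ‖ρ.integrate f‖ ≤ ∫ s, ‖f s‖ ∂(Measure.haar : Measure G) :=
  LinearMap.mkContinuous_norm_le _ (integral_nonneg fun _ => norm_nonneg _) (fun ξ => by
    refine (norm_integral_le_integral_norm _).trans (le_of_eq ?_)
    simp only [norm_smul, LinearIsometryEquiv.norm_map]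
    exact integral_mul_const _ _)

theorem inner_integrate (ρ : UnitaryRep G) (f : C_c(G, ℂ)) (ξ η : ρ.H) :
    inner ℂ η (ρ.integrate f ξ) = ∫ s, f s * ρ.coeff ξ η s ∂(Measure.haar : Measure G) := by
  rw [integrate_apply, ← integral_inner (ρ.integrable_smul f ξ)]
  simp only [inner_smul_right, coeff]

end

end UnitaryRep

/-! ### The full group C*-algebra as an operator space -/

section

variable (G : Type u) [Group G] [TopologicalSpace G] [IsTopologicalGroup G]
  [LocallyCompactSpace G] [MeasurableSpace G] [BorelSpace G]

/-- The space `C_c(G)`, to be given the universal C*-seminorm. -/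
def PreGroupCStar : Type u := C_c(G, ℂ)

instance : AddCommGroup (PreGroupCStar G) := inferInstanceAs (AddCommGroup C_c(G, ℂ))

instance : Module ℂ (PreGroupCStar G) := inferInstanceAs (Module ℂ C_c(G, ℂ))

/-- The underlying function of an element of `PreGroupCStar G`. -/
def PreGroupCStar.toCc : PreGroupCStar G ≃ₗ[ℂ] C_c(G, ℂ) := LinearEquiv.refl ℂ C_c(G, ℂ)

/-- The universal C*-seminorm `‖f‖ = sup_π ‖π(f)‖`, over all unitary representations of `G`. -/
instance : Norm (PreGroupCStar G) where
  norm f := ⨆ ρ : UnitaryRep G, ‖ρ.integrate (PreGroupCStar.toCc G f)‖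

variable {G}

theorem UnitaryRep.norm_integrate_le_norm (ρ : UnitaryRep G) (f : PreGroupCStar G) :
    ‖ρ.integrate (PreGroupCStar.toCc G f)‖ ≤ ‖f‖ :=
  le_ciSup (f := fun ρ : UnitaryRep G => ‖ρ.integrate (PreGroupCStar.toCc G f)‖)
    ⟨_, by rintro _ ⟨σ, rfl⟩; exact σ.norm_integrate_le _⟩ ρ

theorem PreGroupCStar.norm_le {f : PreGroupCStar G} {C : ℝ}
    (h : ∀ ρ : UnitaryRep G, ‖ρ.integrate (PreGroupCStar.toCc G f)‖ ≤ C) : ‖f‖ ≤ C :=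
  haveI : Nonempty (UnitaryRep G) := ⟨UnitaryRep.trivial G⟩
  ciSup_le h

theorem PreGroupCStar.core : SeminormedSpace.Core ℂ (PreGroupCStar G) where
  norm_nonneg f := (norm_nonneg _).trans ((UnitaryRep.trivial G).norm_integrate_le_norm f)
  norm_smul c f := by
    change ⨆ ρ : UnitaryRep G, ‖ρ.integrate (PreGroupCStar.toCc G (c • f))‖ =
      ‖c‖ * ⨆ ρ : UnitaryRep G, ‖ρ.integrate (PreGroupCStar.toCc G f)‖
    simp only [map_smul, norm_smul]
    exact (Real.mul_iSup_of_nonneg (norm_nonneg c) _).symm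
  norm_triangle f g := PreGroupCStar.norm_le fun ρ => by
    rw [map_add, map_add]
    exact (norm_add_le _ _).trans
      (add_le_add (ρ.norm_integrate_le_norm f) (ρ.norm_integrate_le_norm g))

variable (G)

instance : SeminormedAddCommGroup (PreGroupCStar G) :=
  SeminormedAddCommGroup.ofCore PreGroupCStar.core

instance : NormedSpace ℂ (PreGroupCStar G) where
  norm_smul_le c f := (PreGroupCStar.core.norm_smul c f).le

/-- The full group C*-algebra `C*(G)`, as a Banach space: the completion of `C_c(G)` (equivalently,
of `L¹(G)`) in the norm `sup_π ‖π(f)‖`. -/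
abbrev GroupCStar : Type u := UniformSpace.Completion (PreGroupCStar G)

variable {G}

/-- The extension of a unitary representation `π` of `G` to `C*(G)`. -/
def UnitaryRep.extend (ρ : UnitaryRep G) : GroupCStar G →L[ℂ] (ρ.H →L[ℂ] ρ.H) :=
  (LinearMap.mkContinuous (ρ.integrate ∘ₗ (PreGroupCStar.toCc G).toLinearMap) 1
    (fun f => by rw [one_mul]; exact ρ.norm_integrate_le_norm f)).extend
    (UniformSpace.Completion.toComplL : PreGroupCStar G →L[ℂ] GroupCStar G)

theorem UnitaryRep.extend_coe (ρ : UnitaryRep G) (f : PreGroupCStar G) :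
    ρ.extend (f : GroupCStar G) = ρ.integrate (PreGroupCStar.toCc G f) :=
  ContinuousLinearMap.extend_eq _ UniformSpace.Completion.denseRange_coe
    (UniformSpace.Completion.isUniformInducing_coe _) f

/-- The bounded operator on `H^ι` given by a matrix of bounded operators on `H`. -/
def opMatrix {H : Type*} [NormedAddCommGroup H] [InnerProductSpace ℂ H] {ι : Type} [Fintype ι]
    (X : Matrix ι ι (H →L[ℂ] H)) :
    PiLp 2 (fun _ : ι => H) →L[ℂ] PiLp 2 (fun _ : ι => H) :=
  (PiLp.continuousLinearEquiv 2 ℂ (fun _ : ι => H)).symm.toContinuousLinearMap.comp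
    ((ContinuousLinearMap.pi fun i => ∑ j, (X i j).comp (ContinuousLinearMap.proj j)).comp
      (PiLp.continuousLinearEquiv 2 ℂ (fun _ : ι => H)).toContinuousLinearMap)

/-- The matrix norms of the C*-algebra `C*(G)`: `‖[a i j]‖ = sup_π ‖[π(a i j)]‖`. -/
instance : MatrixNorms (GroupCStar G) where
  matNorm a := ⨆ ρ : UnitaryRep G, ‖opMatrix (a.map ρ.extend)‖ₑ

/-! ### The Fourier-Stieltjes algebra -/

section

variable (G : Type u) [Group G] [TopologicalSpace G]

/-- The Fourier-Stieltjes algebra as an algebra of functions on `G`, with the pointwise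
operations: the set of all matrix coefficients of unitary representations of `G`. -/
def fourierStieltjesSubalgebra : Subalgebra ℂ (G → ℂ) where
  carrier := {u | ∃ (ρ : UnitaryRep G) (ξ η : ρ.H), u = ρ.coeff ξ η}
  add_mem' := by
    rintro _ _ ⟨ρ, ξ, η, rfl⟩ ⟨σ, ξ', η', rfl⟩
    exact ⟨ρ.directSum σ, _, _, funext fun s => (ρ.coeff_directSum σ ξ η ξ' η' s).symm⟩
  mul_mem' := by
    rintro _ _ ⟨ρ, ξ, η, rfl⟩ ⟨σ, ξ', η', rfl⟩
    exact ⟨ρ.tensor σ, _, _, funext fun s => (ρ.coeff_tensor σ ξ η ξ' η' s).symm⟩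
  algebraMap_mem' c :=
    ⟨UnitaryRep.trivial G, _, _, funext fun s => (UnitaryRep.coeff_trivial c s).symm⟩

/-- The Fourier-Stieltjes algebra `B(G)`. -/
def FourierStieltjes : Type u := fourierStieltjesSubalgebra G

instance : CommRing (FourierStieltjes G) :=
  inferInstanceAs (CommRing (fourierStieltjesSubalgebra G))

instance : Algebra ℂ (FourierStieltjes G) :=
  inferInstanceAs (Algebra ℂ (fourierStieltjesSubalgebra G))

variable {G}

/-- The elements of `B(G)` as functions on `G`. -/
def FourierStieltjes.toFun : FourierStieltjes G →ₐ[ℂ] (G → ℂ) :=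
  (fourierStieltjesSubalgebra G).val

theorem FourierStieltjes.exists_coeff (u : FourierStieltjes G) :
    ∃ (ρ : UnitaryRep G) (ξ η : ρ.H), toFun u = ρ.coeff ξ η := u.2

end

namespace FourierStieltjes

/-- The linear functional `f ↦ ∫ f u` on `C_c(G)`, for `u ∈ B(G)`. -/
def preFunctional (u : FourierStieltjes G) : PreGroupCStar G →ₗ[ℂ] ℂ where
  toFun f := ∫ s, PreGroupCStar.toCc G f s * toFun u s ∂(Measure.haar : Measure G)
  map_add' f g := by
    obtain ⟨ρ, ξ, η, h⟩ := exists_coeff u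
    simp only [h, ← ρ.inner_integrate]
    simp
  map_smul' c f := by
    obtain ⟨ρ, ξ, η, h⟩ := exists_coeff u
    simp only [h, ← ρ.inner_integrate]
    simp

/-- The functional `f ↦ ∫ f u` is bounded for the norm of `C*(G)`. -/
theorem exists_bound_preFunctional (u : FourierStieltjes G) :
    ∃ C, ∀ f : PreGroupCStar G, ‖preFunctional u f‖ ≤
      C * ‖(UniformSpace.Completion.toComplL : PreGroupCStar G →L[ℂ] GroupCStar G) f‖ := by
  obtain ⟨ρ, ξ, η, h⟩ := exists_coeff u
  refine ⟨‖ξ‖ * ‖η‖, fun f => ?_⟩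
  have h1 : preFunctional u f = inner ℂ η (ρ.integrate (PreGroupCStar.toCc G f) ξ) := by
    rw [ρ.inner_integrate, ← h]; rfl
  rw [h1, UniformSpace.Completion.coe_toComplL, UniformSpace.Completion.norm_coe]
  calc ‖inner ℂ η (ρ.integrate (PreGroupCStar.toCc G f) ξ)‖
      ≤ ‖η‖ * ‖ρ.integrate (PreGroupCStar.toCc G f) ξ‖ := norm_inner_le_norm _ _
    _ ≤ ‖η‖ * (‖f‖ * ‖ξ‖) := by
        gcongr
        exact ContinuousLinearMap.le_of_opNorm_le _ (ρ.norm_integrate_le_norm f) ξ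
    _ = ‖ξ‖ * ‖η‖ * ‖f‖ := by ring

/-- The functional on `C*(G)` given by `u ∈ B(G)`: the continuous extension of `f ↦ ∫ f u`. -/
def functional (u : FourierStieltjes G) : StrongDual ℂ (GroupCStar G) :=
  (preFunctional u).extendOfNorm
    (UniformSpace.Completion.toComplL : PreGroupCStar G →L[ℂ] GroupCStar G).toLinearMap

theorem functional_coe (u : FourierStieltjes G) (f : PreGroupCStar G) :
    functional u (f : GroupCStar G) =
      ∫ s, PreGroupCStar.toCc G f s * toFun u s ∂(Measure.haar : Measure G) :=
  LinearMap.extendOfNorm_eq (f := preFunctional u)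
    (e := (UniformSpace.Completion.toComplL : PreGroupCStar G →L[ℂ] GroupCStar G).toLinearMap)
    UniformSpace.Completion.denseRange_coe (exists_bound_preFunctional u) f

/-- The pairing of `C*(G)` with `B(G)` is given by `⟨a, π_{ξ,η}⟩ = ⟨π(a)ξ, η⟩`. -/
theorem functional_eq_inner (u : FourierStieltjes G) (ρ : UnitaryRep G) (ξ η : ρ.H)
    (h : toFun u = ρ.coeff ξ η) (a : GroupCStar G) :
    functional u a = inner ℂ η (ρ.extend a ξ) := by
  induction a using UniformSpace.Completion.induction_on with
  | hp => exact isClosed_eq (by fun_prop) (by fun_prop)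
  | ih f => rw [functional_coe, h, ρ.extend_coe, ρ.inner_integrate]

theorem integrable_mul (u : FourierStieltjes G) (f : C_c(G, ℂ)) :
    Integrable (fun s => f s * toFun u s) (Measure.haar : Measure G) := by
  obtain ⟨ρ, ξ, η, h⟩ := exists_coeff u
  have := (ρ.integrable_smul f ξ).const_inner (𝕜 := ℂ) η
  simpa only [inner_smul_right, h, UnitaryRep.coeff] using this

/-- The identification of `B(G)` with the dual of `C*(G)`. -/
def toDual : FourierStieltjes G →ₗ[ℂ] StrongDual ℂ (GroupCStar G) where
  toFun := functional
  map_add' u v := by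
    ext a
    induction a using UniformSpace.Completion.induction_on with
    | hp => exact isClosed_eq (by fun_prop) (by fun_prop)
    | ih f =>
      rw [add_apply]
      simp only [functional_coe, map_add, Pi.add_apply, mul_add]
      exact integral_add (integrable_mul u _) (integrable_mul v _)
  map_smul' c u := by
    ext a
    induction a using UniformSpace.Completion.induction_on with
    | hp => exact isClosed_eq (by fun_prop) (by fun_prop)
    | ih f =>
      rw [smul_apply]
      simp only [functional_coe, map_smul, Pi.smul_apply, mul_smul_comm, RingHom.id_apply]
      exact integral_smul _ _

/-- The dual operator space structure of `B(G) = C*(G)^*`. -/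
instance : MatrixNorms (FourierStieltjes G) where
  matNorm u := MatrixNorms.matNorm (u.map toDual)

/-- The weak* topology of `B(G) = C*(G)^*`. -/
instance : TopologicalSpace (FourierStieltjes G) :=
  TopologicalSpace.induced (fun u => StrongDual.toWeakDual (toDual u)) inferInstance

end FourierStieltjes

end

/-! ### Property (T) and the almost periodic compactification -/

/-- Kazhdan's property (T): there are a compact set `Q` and `ε > 0` such that every unitary
representation with a nonzero `(Q, ε)`-invariant vector has a nonzero invariant vector. -/
def HasPropertyT (G : Type u) [Group G] [TopologicalSpace G] : Prop :=
  ∃ Q : Set G, IsCompact Q ∧ ∃ ε : ℝ, 0 < ε ∧ ∀ ρ : UnitaryRep G,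
    (∃ ξ : ρ.H, ξ ≠ 0 ∧ ∀ s ∈ Q, ‖ρ.π s ξ - ξ‖ < ε * ‖ξ‖) →
    ∃ ξ : ρ.H, ξ ≠ 0 ∧ ∀ s, ρ.π s ξ = ξ

section

variable (G : Type u) [Group G] [TopologicalSpace G]

/-- The homomorphism from `G` into the product of the unitary groups `U(n)` over all continuous
finite-dimensional unitary representations `G → U(n)`. -/
def toUnitaryProduct : G →* ((p : Σ n : ℕ, G →ₜ* Matrix.unitaryGroup (Fin n) ℂ) →
    Matrix.unitaryGroup (Fin p.1) ℂ) :=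
  MonoidHom.pi fun p => p.2.toMonoidHom

/-- The almost periodic (Bohr) compactification of `G`: the closure of the image of `G` in the
product of the unitary groups over all its continuous finite-dimensional unitary
representations. -/
abbrev AlmostPeriodicCompactification : Type u :=
  (toUnitaryProduct G).range.topologicalClosure

end

end

noncomputable section

universe u

/-! ### Norms of scalar and operator matrices -/

/-! The obstruction is a weak*-continuous character of `B(G)` living at infinity: an element `p` of
`C*(G)` on which every `u` in `B(G)` acts as the scalar `⟨p, u⟩`, with `⟨p, 1⟩ = 1`, while every
compact set carries some `u` that equals `1` there and has `⟨p, u⟩ = 0`.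

Property (T) gives the Kazhdan projection `q` in `C*(G)`, the norm limit of powers of an averaging
operator with a spectral gap that is uniform over all representations (`exists_spectral_gap`,
`exists_kazhdan_projection`). Pairing with `q` takes a coefficient of `π` to the corresponding inner
product of invariant components. This functional is not multiplicative, but it is after
localisation. Let `N` be the kernel of the map into the Bohr compactification. Since the latter is
finite, `N` is open of finite index, so `b = [G : N] 1_N` belongs to `B(G)`; put `p = b · q`. A
coefficient whose first vector is fixed by `N` is constant on `N`. If the first vector `ξ` is
orthogonal to the `N`-fixed vectors, every product with the coefficient is killed by `q`: an
invariant vector of `π ⊗ σ` defines an intertwining compact slice map `S`, the eigenspaces of `S*S`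
for nonzero eigenvalues are finite-dimensional subrepresentations, on which `N` acts trivially, and
therefore `Sξ = 0` (`slice_eq_zero`). Splitting `ξ` accordingly makes `u ↦ ⟨p, u⟩` multiplicative.
It kills coefficients of the regular representation because `G` is not compact.

Now let `I` be the kernel of the trivial representation in `C*(G)`, identified with `C*(G)/ℂp`, and
let `E = I^*`. The left action on `E` is dual to multiplication, the right action is through the
character, and restriction of functionals to `I` is a derivation. If it were inner, implemented by
`φ`, then `φ` composed with the projection along `p` would be a functional `ψ` on `C*(G)` with `ψ(u
· y) = ⟨y, u⟩` whenever `⟨p, u⟩ = 0`. For `f` in `C_c(G)` and `u = 1` on its support this reads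
`ψ(f) = ∫ f`, so `ψ` is the trivial representation. But `ψ(p) = 0` and `⟨p, 1⟩ = 1`.

Two analytic points remain: the action of `B(G)` on `C*(G)` is completely contractive
(`matNorm_mulOp_le`), and `u ↦ φ(u · x)` is weak*-continuous for every functional `φ` on `C*(G)`
(`exists_functional_eq`). -/

theorem Matrix.sum_norm_mulVec_sq_le {ι κ : Type*} [Fintype ι] [Fintype κ]
    [DecidableEq κ] (α : Matrix ι κ ℂ) (x : κ → ℂ) :
    ∑ i, ‖∑ k, α i k * x k‖ ^ 2 ≤ ‖α‖ ^ 2 * ∑ k, ‖x k‖ ^ 2 := by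
  have h := Matrix.l2_opNorm_mulVec α (WithLp.toLp 2 x)
  have h2 := pow_le_pow_left₀ (norm_nonneg _) h 2
  rw [mul_pow, EuclideanSpace.norm_sq_eq, EuclideanSpace.norm_sq_eq] at h2
  exact h2

theorem Matrix.l2_opNorm_le_of_sum_sq_le {ι κ : Type*} [Fintype ι] [Fintype κ]
    [DecidableEq κ] (α : Matrix ι κ ℂ) {C : ℝ} (hC : 0 ≤ C)
    (h : ∀ x : κ → ℂ, ∑ i, ‖∑ k, α i k * x k‖ ^ 2 ≤ C ^ 2 * ∑ k, ‖x k‖ ^ 2) : ‖α‖ ≤ C := by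
  rw [Matrix.l2_opNorm_def]
  refine ContinuousLinearMap.opNorm_le_bound _ hC fun x => ?_
  refine abs_le_of_sq_le_sq' ?_ (by positivity) |>.2
  rw [mul_pow, EuclideanSpace.norm_sq_eq, EuclideanSpace.norm_sq_eq]
  exact h x

theorem Matrix.l2_opNorm_submatrix_le {ι κ : Type*} [Fintype ι] [Fintype κ] [DecidableEq ι]
    [DecidableEq κ] (α : Matrix ι ι ℂ) (e : κ ≃ ι) : ‖α.submatrix e e‖ ≤ ‖α‖ := by
  refine Matrix.l2_opNorm_le_of_sum_sq_le _ (norm_nonneg _) fun x => ?_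
  have h := α.sum_norm_mulVec_sq_le (x ∘ e.symm)
  rw [← Equiv.sum_comp e, ← Equiv.sum_comp e (fun k => ‖(x ∘ e.symm) k‖ ^ 2)] at h
  refine (le_of_eq (Finset.sum_congr rfl fun i _ => ?_)).trans (h.trans (le_of_eq ?_))
  · rw [← Equiv.sum_comp e (fun k => α (e i) k * (x ∘ e.symm) k)]
    simp
  · simp

/-- Scalar matrices act on columns of vectors of a Hilbert space with their operator norm. -/
theorem Matrix.sum_norm_smul_sq_le {ι κ H : Type*} [Fintype ι] [Fintype κ] [DecidableEq κ]
    [NormedAddCommGroup H] [InnerProductSpace ℂ H] (α : Matrix ι κ ℂ) (h : κ → H) :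
    ∑ i, ‖∑ k, α i k • h k‖ ^ 2 ≤ ‖α‖ ^ 2 * ∑ k, ‖h k‖ ^ 2 := by
  -- Only finitely many vectors occur: coordinates in an orthonormal basis of their span reduce the
  -- bound to the scalar one, one coordinate at a time.
  let V : Submodule ℂ H := Submodule.span ℂ (Set.range h)
  have : FiniteDimensional ℂ V := FiniteDimensional.span_of_finite ℂ (Set.finite_range h)
  let b := stdOrthonormalBasis ℂ V
  let g : κ → V := fun k => ⟨h k, Submodule.subset_span ⟨k, rfl⟩⟩
  have key : ∀ v : V, ‖(v : H)‖ ^ 2 = ∑ l, ‖inner ℂ (b l) v‖ ^ 2 := fun v => by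
    rw [b.sum_sq_norm_inner_right]; rfl
  have h1 : ∀ i, ‖∑ k, α i k • h k‖ ^ 2 = ∑ l, ‖∑ k, α i k * inner ℂ (b l) (g k)‖ ^ 2 := by
    intro i
    have : ∑ k, α i k • h k = ((∑ k, α i k • g k : V) : H) := by simp [g]
    rw [this, key]
    simp only [inner_sum, inner_smul_right]
  have h2 : ∀ k, ‖h k‖ ^ 2 = ∑ l, ‖inner ℂ (b l) (g k)‖ ^ 2 := fun k => key (g k)
  simp only [h1, h2]
  rw [Finset.sum_comm, Finset.sum_comm (s := (Finset.univ : Finset κ)), Finset.mul_sum]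
  exact Finset.sum_le_sum fun l _ => α.sum_norm_mulVec_sq_le _

section opMatrix

variable {H : Type*} [NormedAddCommGroup H] [InnerProductSpace ℂ H]

theorem opMatrix_apply {ι : Type} [Fintype ι] (X : Matrix ι ι (H →L[ℂ] H))
    (h : PiLp 2 (fun _ : ι => H)) (i : ι) : opMatrix X h i = ∑ j, X i j (h j) := by
  simp [opMatrix]

theorem sum_norm_opMatrix_sq_le {ι : Type} [Fintype ι] (X : Matrix ι ι (H →L[ℂ] H)) (h : ι → H) :
    ∑ i, ‖∑ j, X i j (h j)‖ ^ 2 ≤ ‖opMatrix X‖ ^ 2 * ∑ j, ‖h j‖ ^ 2 := by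
  have h1 := (opMatrix X).le_opNorm (WithLp.toLp 2 h)
  have h2 := pow_le_pow_left₀ (norm_nonneg _) h1 2
  rw [mul_pow, PiLp.norm_sq_eq_of_L2, PiLp.norm_sq_eq_of_L2] at h2
  simpa only [opMatrix_apply] using h2

theorem norm_opMatrix_le_of_sum_sq_le {ι : Type} [Fintype ι] (X : Matrix ι ι (H →L[ℂ] H)) {C : ℝ}
    (hC : 0 ≤ C) (h : ∀ x : ι → H, ∑ i, ‖∑ k, X i k (x k)‖ ^ 2 ≤ C ^ 2 * ∑ k, ‖x k‖ ^ 2) :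
    ‖opMatrix X‖ ≤ C := by
  refine ContinuousLinearMap.opNorm_le_bound _ hC fun x => ?_
  refine abs_le_of_sq_le_sq' ?_ (by positivity) |>.2
  rw [mul_pow, PiLp.norm_sq_eq_of_L2, PiLp.norm_sq_eq_of_L2]
  simpa only [opMatrix_apply] using h x

theorem ContinuousLinearMap.opNorm_le_of_inner_le (T : H →L[ℂ] H) {C : ℝ} (hC : 0 ≤ C)
    (h : ∀ x y, ‖inner ℂ y (T x)‖ ≤ C * ‖x‖ * ‖y‖) : ‖T‖ ≤ C := by
  refine ContinuousLinearMap.opNorm_le_bound _ hC fun x => ?_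
  rcases (norm_nonneg (T x)).eq_or_lt with h0 | h0
  · rw [← h0]; positivity
  refine le_of_mul_le_mul_right ?_ h0
  have h1 := h x (T x)
  rw [inner_self_eq_norm_sq_to_K] at h1
  rw [← sq]
  simpa using h1

theorem inner_opMatrix {ι : Type} [Fintype ι] (X : Matrix ι ι (H →L[ℂ] H))
    (x y : PiLp 2 (fun _ : ι => H)) :
    inner ℂ y (opMatrix X x) = ∑ i, ∑ j, inner ℂ (y i) (X i j (x j)) := by
  simp only [PiLp.inner_apply, opMatrix_apply, inner_sum]

theorem norm_opMatrix_le_of_inner_le {ι : Type} [Fintype ι] (X : Matrix ι ι (H →L[ℂ] H)) {C : ℝ}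
    (hC : 0 ≤ C) (h : ∀ x y : PiLp 2 (fun _ : ι => H),
      ‖∑ i, ∑ j, inner ℂ (y i) (X i j (x j))‖ ≤ C * ‖x‖ * ‖y‖) :
    ‖opMatrix X‖ ≤ C :=
  (opMatrix X).opNorm_le_of_inner_le hC fun x y => by
    rw [inner_opMatrix]
    exact h x y

theorem opMatrix_add {ι : Type} [Fintype ι] (X Y : Matrix ι ι (H →L[ℂ] H)) :
    opMatrix (X + Y) = opMatrix X + opMatrix Y := by
  ext h i
  simp [opMatrix_apply, Finset.sum_add_distrib]

theorem norm_opMatrix_le_sum {ι : Type} [Fintype ι] [DecidableEq ι] (X : Matrix ι ι (H →L[ℂ] H)) :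
    ‖opMatrix X‖ ≤ ∑ i, ∑ j, ‖X i j‖ := by
  refine norm_opMatrix_le_of_inner_le X (by positivity) fun x y => ?_
  refine (norm_sum_le _ _).trans ?_
  rw [Finset.sum_mul, Finset.sum_mul]
  refine Finset.sum_le_sum fun i _ => (norm_sum_le _ _).trans ?_
  rw [Finset.sum_mul, Finset.sum_mul]
  refine Finset.sum_le_sum fun j _ => (norm_inner_le_norm _ _).trans ?_
  calc ‖y i‖ * ‖X i j (x j)‖ ≤ ‖y‖ * (‖X i j‖ * ‖x‖) := by
        gcongr
        · exact PiLp.norm_apply_le y i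
        · exact ((X i j).le_opNorm _).trans (by gcongr; exact PiLp.norm_apply_le x j)
    _ = ‖X i j‖ * ‖x‖ * ‖y‖ := by ring

theorem norm_opMatrix_single (T : H →L[ℂ] H) :
    ‖opMatrix (Matrix.of fun _ _ : Fin 1 => T)‖ = ‖T‖ := by
  refine le_antisymm ?_ ?_
  · refine norm_opMatrix_le_of_sum_sq_le _ (norm_nonneg _) fun x => ?_
    simp only [Matrix.of_apply, Finset.univ_unique, Finset.sum_singleton]
    rw [← mul_pow]
    exact pow_le_pow_left₀ (norm_nonneg _) (T.le_opNorm _) 2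
  · refine ContinuousLinearMap.opNorm_le_bound _ (ContinuousLinearMap.opNorm_nonneg _) fun x => ?_
    have h := sum_norm_opMatrix_sq_le (Matrix.of fun _ _ : Fin 1 => T) (fun _ => x)
    simp only [Matrix.of_apply, Finset.univ_unique, Finset.sum_singleton] at h
    rw [← mul_pow] at h
    exact (abs_le_of_sq_le_sq' h (by positivity)).2

/-- On columns of vectors, `αXβ` is the composite of `β`, `X` and `α`, and scalar matrices act on
columns with at most their Euclidean operator norm. -/
theorem norm_opMatrix_scalarMulMul_le {ι κ : Type} [Fintype ι] [DecidableEq ι] [Fintype κ]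
    [DecidableEq κ] (α : Matrix ι κ ℂ) (X : Matrix κ κ (H →L[ℂ] H)) (β : Matrix κ ι ℂ) :
    ‖opMatrix (scalarMulMul α X β)‖ ≤ ‖α‖ * ‖opMatrix X‖ * ‖β‖ := by
  refine norm_opMatrix_le_of_sum_sq_le _ (by positivity) fun x => ?_
  have h1 : ∀ i, ∑ j, scalarMulMul α X β i j (x j) =
      ∑ k, α i k • ∑ l, X k l (∑ j, β l j • x j) := by
    intro i
    simp only [scalarMulMul, Matrix.of_apply, sum_apply, smul_apply,
      map_sum, map_smul, Finset.smul_sum, smul_smul]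
    rw [Finset.sum_comm]
    refine Finset.sum_congr rfl fun k _ => ?_
    rw [Finset.sum_comm]
  simp only [h1]
  calc _ ≤ ‖α‖ ^ 2 * (‖opMatrix X‖ ^ 2 * (‖β‖ ^ 2 * ∑ j, ‖x j‖ ^ 2)) :=
        (α.sum_norm_smul_sq_le _).trans (mul_le_mul_of_nonneg_left
          ((sum_norm_opMatrix_sq_le X _).trans (mul_le_mul_of_nonneg_left
            (β.sum_norm_smul_sq_le _) (by positivity))) (by positivity))
    _ = _ := by ring

theorem norm_opMatrix_fromBlocks_le {ι κ : Type} [Fintype ι] [Fintype κ]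
    (X : Matrix ι ι (H →L[ℂ] H)) (Y : Matrix κ κ (H →L[ℂ] H)) :
    ‖opMatrix (Matrix.fromBlocks X 0 0 Y)‖ ≤ max ‖opMatrix X‖ ‖opMatrix Y‖ := by
  refine norm_opMatrix_le_of_sum_sq_le _ (by positivity) fun x => ?_
  simp only [Fintype.sum_sum_type, Matrix.fromBlocks_apply₁₁, Matrix.fromBlocks_apply₁₂,
    Matrix.fromBlocks_apply₂₁, Matrix.fromBlocks_apply₂₂, Matrix.zero_apply,
    zero_apply, Finset.sum_const_zero, add_zero, zero_add, mul_add]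
  refine add_le_add ((sum_norm_opMatrix_sq_le X _).trans ?_)
    ((sum_norm_opMatrix_sq_le Y _).trans ?_) <;>
  · gcongr
    first | exact le_max_left _ _ | exact le_max_right _ _

theorem norm_opMatrix_le_fromBlocks_left {ι κ : Type} [Fintype ι] [Fintype κ]
    (X : Matrix ι ι (H →L[ℂ] H)) (Y : Matrix κ κ (H →L[ℂ] H)) :
    ‖opMatrix X‖ ≤ ‖opMatrix (Matrix.fromBlocks X 0 0 Y)‖ := by
  refine norm_opMatrix_le_of_sum_sq_le _ (by positivity) fun x => ?_
  have h := sum_norm_opMatrix_sq_le (Matrix.fromBlocks X 0 0 Y) (Sum.elim x 0)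
  simpa [Fintype.sum_sum_type] using h

theorem norm_opMatrix_le_fromBlocks_right {ι κ : Type} [Fintype ι] [Fintype κ]
    (X : Matrix ι ι (H →L[ℂ] H)) (Y : Matrix κ κ (H →L[ℂ] H)) :
    ‖opMatrix Y‖ ≤ ‖opMatrix (Matrix.fromBlocks X 0 0 Y)‖ := by
  refine norm_opMatrix_le_of_sum_sq_le _ (by positivity) fun x => ?_
  have h := sum_norm_opMatrix_sq_le (Matrix.fromBlocks X 0 0 Y) (Sum.elim 0 x)
  simpa [Fintype.sum_sum_type] using h

/-- The operator is `c ⊗ 1` after `1 ⊗ X`; each factor is estimated with the other index frozen. -/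
theorem norm_opMatrix_kronecker_le {ι κ : Type} [Fintype ι] [DecidableEq ι] [Fintype κ]
    (c : Matrix ι ι ℂ) (X : Matrix κ κ (H →L[ℂ] H)) :
    ‖opMatrix (Matrix.of fun p q : ι × κ => c p.1 q.1 • X p.2 q.2)‖ ≤ ‖c‖ * ‖opMatrix X‖ := by
  refine norm_opMatrix_le_of_sum_sq_le _ (by positivity) fun x => ?_
  have h1 : ∀ i k, ∑ q : ι × κ, (c i q.1 • X k q.2) (x q) =
      ∑ j, c i j • ∑ l, X k l (x (j, l)) := by
    intro i k
    rw [Fintype.sum_prod_type]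
    simp [Finset.smul_sum]
  simp only [Matrix.of_apply]
  rw [Fintype.sum_prod_type, Finset.sum_comm]
  simp only [h1]
  calc _ ≤ ∑ k, ‖c‖ ^ 2 * ∑ j, ‖∑ l, X k l (x (j, l))‖ ^ 2 :=
        Finset.sum_le_sum fun k _ => c.sum_norm_smul_sq_le _
    _ = ‖c‖ ^ 2 * ∑ j, ∑ k, ‖∑ l, X k l (x (j, l))‖ ^ 2 := by
        rw [← Finset.mul_sum, Finset.sum_comm]
    _ ≤ ‖c‖ ^ 2 * ∑ j, (‖opMatrix X‖ ^ 2 * ∑ l, ‖x (j, l)‖ ^ 2) := by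
        gcongr with j
        exact sum_norm_opMatrix_sq_le X _
    _ = _ := by rw [← Finset.mul_sum, ← Fintype.sum_prod_type (fun q : ι × κ => ‖x q‖ ^ 2)]; ring

end opMatrix

/-! ### The group C*-algebra as an operator space -/

section

variable {G : Type u} [Group G] [TopologicalSpace G] [IsTopologicalGroup G]
  [LocallyCompactSpace G] [MeasurableSpace G] [BorelSpace G]

theorem UnitaryRep.norm_extend_le (ρ : UnitaryRep G) (a : GroupCStar G) : ‖ρ.extend a‖ ≤ ‖a‖ := by
  induction a using UniformSpace.Completion.induction_on with
  | hp => exact isClosed_le (by fun_prop) (by fun_prop)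
  | ih f =>
    rw [ρ.extend_coe, UniformSpace.Completion.norm_coe]
    exact ρ.norm_integrate_le_norm f

/-- The norm is given as a supremum over representations only on `C_c(G)`. Since all extended
representations are contractive, approximation carries the formula over to the completion. -/
theorem GroupCStar.norm_le {a : GroupCStar G} {C : ℝ}
    (h : ∀ ρ : UnitaryRep G, ‖ρ.extend a‖ ≤ C) : ‖a‖ ≤ C := by
  refine le_of_forall_pos_le_add fun ε hε => ?_
  obtain ⟨f, hf⟩ := UniformSpace.Completion.denseRange_coe.exists_dist_lt a (half_pos hε)
  rw [dist_eq_norm] at hf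
  have h1 : ‖(f : GroupCStar G)‖ ≤ C + ε / 2 := by
    rw [UniformSpace.Completion.norm_coe]
    refine PreGroupCStar.norm_le fun ρ => ?_
    rw [← ρ.extend_coe]
    have h2 : ρ.extend (f : GroupCStar G) = ρ.extend a - ρ.extend (a - f) := by
      rw [map_sub, sub_sub_cancel]
    rw [h2]
    exact (norm_sub_le _ _).trans (add_le_add (h ρ) ((ρ.norm_extend_le _).trans hf.le))
  have h3 : ‖a‖ ≤ ‖a - f‖ + ‖(f : GroupCStar G)‖ := by
    simpa using norm_add_le (a - f) (f : GroupCStar G)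
  linarith

theorem GroupCStar.ext_extend {a b : GroupCStar G}
    (h : ∀ ρ : UnitaryRep G, ρ.extend a = ρ.extend b) : a = b := by
  rw [← sub_eq_zero, ← norm_le_zero_iff]
  exact GroupCStar.norm_le fun ρ => by rw [map_sub, h, sub_self, norm_zero]

theorem GroupCStar.enorm_opMatrix_le {ι : Type} [Fintype ι] [DecidableEq ι]
    (a : Matrix ι ι (GroupCStar G)) (ρ : UnitaryRep G) :
    ‖opMatrix (a.map ρ.extend)‖ₑ ≤ MatrixNorms.matNorm a :=
  le_iSup (fun ρ : UnitaryRep G => ‖opMatrix (a.map ρ.extend)‖ₑ) ρ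

theorem GroupCStar.matNorm_le {ι : Type} [Fintype ι] [DecidableEq ι]
    {a : Matrix ι ι (GroupCStar G)} {C : ℝ≥0∞}
    (h : ∀ ρ : UnitaryRep G, ‖opMatrix (a.map ρ.extend)‖ₑ ≤ C) : MatrixNorms.matNorm a ≤ C :=
  iSup_le h

/-- Ruan's axioms hold for the operator matrices in each single representation and survive the
supremum. -/
instance GroupCStar.instOperatorSpace : OperatorSpace (GroupCStar G) where
  matNorm_single v := by
    have h : ∀ ρ : UnitaryRep G, ‖opMatrix ((Matrix.of fun _ _ : Fin 1 => v).map ρ.extend)‖ₑ =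
        ‖ρ.extend v‖ₑ := fun ρ => by
      rw [← ofReal_norm, ← ofReal_norm]
      exact congrArg ENNReal.ofReal (norm_opMatrix_single (ρ.extend v))
    refine le_antisymm (GroupCStar.matNorm_le fun ρ => ?_) ?_
    · rw [h, enorm_le_iff_norm_le]
      exact ρ.norm_extend_le v
    · by_cases ht : MatrixNorms.matNorm (Matrix.of fun _ _ : Fin 1 => v) = ∞
      · rw [ht]; exact le_top
      · rw [← ofReal_norm, ENNReal.ofReal_le_iff_le_toReal ht]
        refine GroupCStar.norm_le fun ρ => ?_
        rw [← ENNReal.ofReal_le_iff_le_toReal ht, ofReal_norm, ← h]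
        exact GroupCStar.enorm_opMatrix_le _ ρ
  matNorm_add_le x y := GroupCStar.matNorm_le fun ρ => by
    have : (x + y).map ρ.extend = x.map ρ.extend + y.map ρ.extend := by ext; simp
    rw [this, opMatrix_add]
    exact (enorm_add_le _ _).trans (add_le_add (GroupCStar.enorm_opMatrix_le x ρ)
      (GroupCStar.enorm_opMatrix_le y ρ))
  matNorm_scalarMulMul_le α x β := GroupCStar.matNorm_le fun ρ => by
    have : (scalarMulMul α x β).map ρ.extend = scalarMulMul α (x.map ρ.extend) β := by
      ext; simp [scalarMulMul]
    rw [this]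
    refine le_trans ?_ (mul_le_mul_left (mul_le_mul_right (GroupCStar.enorm_opMatrix_le x ρ) _) _)
    simp only [← ofReal_norm]
    rw [← ENNReal.ofReal_mul (by positivity), ← ENNReal.ofReal_mul (by positivity)]
    exact ENNReal.ofReal_le_ofReal (norm_opMatrix_scalarMulMul_le _ _ _)
  matNorm_fromBlocks x y := by
    have h : ∀ ρ : UnitaryRep G, (Matrix.fromBlocks x 0 0 y).map ρ.extend =
        Matrix.fromBlocks (x.map ρ.extend) 0 0 (y.map ρ.extend) := fun ρ => by
      rw [Matrix.fromBlocks_map, Matrix.map_zero _ (map_zero _), Matrix.map_zero _ (map_zero _)]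
    refine le_antisymm (GroupCStar.matNorm_le fun ρ => ?_)
      (max_le (GroupCStar.matNorm_le fun ρ => ?_) (GroupCStar.matNorm_le fun ρ => ?_))
    · rw [h]
      have h1 : ‖opMatrix (Matrix.fromBlocks (x.map ρ.extend) 0 0 (y.map ρ.extend))‖ₑ ≤
          max ‖opMatrix (x.map ρ.extend)‖ₑ ‖opMatrix (y.map ρ.extend)‖ₑ := by
        simp only [← ofReal_norm, ← ENNReal.ofReal_max]
        exact ENNReal.ofReal_le_ofReal (norm_opMatrix_fromBlocks_le _ _)
      exact h1.trans (max_le_max (GroupCStar.enorm_opMatrix_le x ρ)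
        (GroupCStar.enorm_opMatrix_le y ρ))
    · refine le_trans ?_ (GroupCStar.enorm_opMatrix_le _ ρ)
      rw [h, enorm_le_iff_norm_le]
      exact norm_opMatrix_le_fromBlocks_left _ _
    · refine le_trans ?_ (GroupCStar.enorm_opMatrix_le _ ρ)
      rw [h, enorm_le_iff_norm_le]
      exact norm_opMatrix_le_fromBlocks_right _ _

theorem GroupCStar.matNorm_ne_top {ι : Type} [Fintype ι] [DecidableEq ι]
    (a : Matrix ι ι (GroupCStar G)) : MatrixNorms.matNorm a ≠ ∞ := by
  refine ne_top_of_le_ne_top ENNReal.ofReal_ne_top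
    (GroupCStar.matNorm_le (C := ENNReal.ofReal (∑ i, ∑ j, ‖a i j‖)) fun ρ => ?_)
  rw [← ofReal_norm]
  refine ENNReal.ofReal_le_ofReal ((norm_opMatrix_le_sum _).trans ?_)
  gcongr with i _ j _
  exact ρ.norm_extend_le _

theorem GroupCStar.matNorm_kronecker_le {ι κ : Type} [Fintype ι] [DecidableEq ι] [Fintype κ]
    [DecidableEq κ] (c : Matrix ι ι ℂ) (x : Matrix κ κ (GroupCStar G)) :
    MatrixNorms.matNorm (Matrix.of fun p q : ι × κ => c p.1 q.1 • x p.2 q.2) ≤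
      ‖c‖ₑ * MatrixNorms.matNorm x := by
  refine GroupCStar.matNorm_le fun ρ => ?_
  refine le_trans ?_ (mul_le_mul_right (GroupCStar.enorm_opMatrix_le x ρ) _)
  have : (Matrix.of fun p q : ι × κ => c p.1 q.1 • x p.2 q.2).map ρ.extend =
      Matrix.of fun p q : ι × κ => c p.1 q.1 • (x.map ρ.extend) p.2 q.2 := by
    ext; simp
  rw [this]
  simp only [← ofReal_norm]
  rw [← ENNReal.ofReal_mul (by positivity)]
  exact ENNReal.ofReal_le_ofReal (norm_opMatrix_kronecker_le _ _)

end

/-! ### Generalities on operator spaces and their duals -/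

section

variable {V : Type*} [NormedAddCommGroup V] [NormedSpace ℂ V] [OperatorSpace V]

/-- Relabelling multiplies on both sides by permutation matrices, which are contractions. -/
theorem OperatorSpace.matNorm_submatrix_le {ι κ : Type} [Fintype ι] [DecidableEq ι] [Fintype κ]
    [DecidableEq κ] (x : Matrix ι ι V) (e : κ ≃ ι) :
    MatrixNorms.matNorm (x.submatrix e e) ≤ MatrixNorms.matNorm x := by
  let α : Matrix κ ι ℂ := (1 : Matrix ι ι ℂ).submatrix e id
  let β : Matrix ι κ ℂ := (1 : Matrix ι ι ℂ).submatrix id e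
  have h : x.submatrix e e = scalarMulMul α x β := by
    ext i j
    simp [scalarMulMul, α, β, Matrix.one_apply, ite_smul]
  have hα : ‖α‖ₑ ≤ 1 := by
    have : ‖α‖ ≤ 1 := Matrix.l2_opNorm_le_of_sum_sq_le _ zero_le_one fun y => by
      simp [α, Matrix.one_apply, Equiv.sum_comp e (fun i => ‖y i‖ ^ 2)]
    simpa [enorm_le_iff_norm_le] using ENNReal.ofReal_le_ofReal this
  have hβ : ‖β‖ₑ ≤ 1 := by
    have : ‖β‖ ≤ 1 := Matrix.l2_opNorm_le_of_sum_sq_le _ zero_le_one fun y => by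
      rw [← Equiv.sum_comp e]
      simp [β, Matrix.one_apply]
    simpa [enorm_le_iff_norm_le] using ENNReal.ofReal_le_ofReal this
  rw [h]
  refine (OperatorSpace.matNorm_scalarMulMul_le α x β).trans ?_
  calc _ ≤ 1 * MatrixNorms.matNorm x * 1 := by gcongr
    _ = _ := by simp

theorem OperatorSpace.matNorm_smul_le {ι : Type} [Fintype ι] [DecidableEq ι] (c : ℂ)
    (x : Matrix ι ι V) : MatrixNorms.matNorm (c • x) ≤ ‖c‖ₑ * MatrixNorms.matNorm x := by
  have h : c • x = scalarMulMul (c • (1 : Matrix ι ι ℂ)) x 1 := by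
    ext i j
    simp [scalarMulMul, Matrix.one_apply, ite_smul]
  have h1 : ‖(1 : Matrix ι ι ℂ)‖ₑ ≤ 1 := by
    have : ‖(1 : Matrix ι ι ℂ)‖ ≤ 1 := Matrix.l2_opNorm_le_of_sum_sq_le _ zero_le_one fun y => by
      simp [Matrix.one_apply]
    simpa [enorm_le_iff_norm_le] using ENNReal.ofReal_le_ofReal this
  rw [h]
  refine (OperatorSpace.matNorm_scalarMulMul_le _ x _).trans ?_
  calc _ ≤ (‖c‖ₑ * 1) * MatrixNorms.matNorm x * 1 := by
        gcongr
        rw [enorm_smul]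
        gcongr
    _ = _ := by simp

theorem OperatorSpace.eq_zero_of_matNorm_eq_zero {ι : Type} [Fintype ι] [DecidableEq ι]
    {x : Matrix ι ι V} (hx : MatrixNorms.matNorm x = 0) : x = 0 := by
  ext k l
  let α : Matrix (Fin 1) ι ℂ := Matrix.of fun _ i => if i = k then 1 else 0
  let β : Matrix ι (Fin 1) ℂ := Matrix.of fun i _ => if i = l then 1 else 0
  have h : (Matrix.of fun _ _ : Fin 1 => x k l) = scalarMulMul α x β := by
    ext i j
    simp [scalarMulMul, α, β, ite_smul]
  have h1 := OperatorSpace.matNorm_scalarMulMul_le α x β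
  rw [← h, OperatorSpace.matNorm_single, hx] at h1
  simpa using h1

/-- The pairing of matrices over `F^*` with matrices over `F`. -/
theorem OperatorSpace.enorm_pairing_le {ι κ : Type} [Fintype ι] [DecidableEq ι] [Fintype κ]
    [DecidableEq κ] (φ : Matrix ι ι (StrongDual ℂ V)) (x : Matrix κ κ V)
    (hx : MatrixNorms.matNorm x ≠ ∞) :
    ‖(Matrix.of fun p q : ι × κ => φ p.1 q.1 (x p.2 q.2))‖ₑ ≤
      MatrixNorms.matNorm φ * MatrixNorms.matNorm x := by
  have h1 : ∀ y : Matrix κ κ V, MatrixNorms.matNorm y ≤ 1 →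
      ‖(Matrix.of fun p q : ι × κ => φ p.1 q.1 (y p.2 q.2))‖ₑ ≤ MatrixNorms.matNorm φ := by
    intro y hy
    -- The dual matrix norm is a supremum over index sets `Fin m` only, so a general index set has
    -- to be relabelled first.
    let e : Fin (Fintype.card κ) ≃ κ := (Fintype.equivFin κ).symm
    let y' := y.submatrix e e
    have hy' : MatrixNorms.matNorm y' ≤ 1 := (OperatorSpace.matNorm_submatrix_le y e).trans hy
    let f : ι × κ ≃ ι × Fin (Fintype.card κ) := (Equiv.refl ι).prodCongr e.symm
    have h2 : (Matrix.of fun p q : ι × κ => φ p.1 q.1 (y p.2 q.2)) =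
        (Matrix.of fun p q : ι × Fin (Fintype.card κ) =>
          φ p.1 q.1 (y' p.2 q.2)).submatrix f f := by
      ext p q
      simp [y', f]
    rw [h2]
    refine le_trans ?_ (le_iSup₂_of_le (Fintype.card κ) y' (le_iSup_of_le hy' le_rfl))
    rw [enorm_le_iff_norm_le]
    exact Matrix.l2_opNorm_submatrix_le _ f
  -- Rescaling `x` to norm one needs a nonzero norm; a matrix of norm zero is zero.
  by_cases h0 : MatrixNorms.matNorm x = 0
  · have : (Matrix.of fun p q : ι × κ => φ p.1 q.1 (x p.2 q.2)) = 0 := by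
      ext p q
      simp [OperatorSpace.eq_zero_of_matNorm_eq_zero h0]
    rw [this]
    simp
  · set r : ℝ := (MatrixNorms.matNorm x).toReal with hr
    have hr0 : 0 < r := ENNReal.toReal_pos h0 hx
    have hrx : MatrixNorms.matNorm x = ENNReal.ofReal r := (ENNReal.ofReal_toReal hx).symm
    have h2 := h1 (((r : ℂ)⁻¹) • x) ((OperatorSpace.matNorm_smul_le _ x).trans (le_of_eq (by
      rw [hrx, ← ofReal_norm, ← ENNReal.ofReal_mul (by positivity)]
      simp [abs_of_pos hr0, hr0.ne'])))
    have h3 : (Matrix.of fun p q : ι × κ => φ p.1 q.1 (x p.2 q.2)) =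
        (r : ℂ) • Matrix.of fun p q : ι × κ => φ p.1 q.1 ((((r : ℂ)⁻¹) • x) p.2 q.2) := by
      ext p q
      have : (r : ℂ) ≠ 0 := by exact_mod_cast hr0.ne'
      simp [this]
    rw [h3, enorm_smul, hrx, mul_comm]
    gcongr
    rw [← ofReal_norm]
    simp [abs_of_pos hr0]

/-- A subspace of an operator space is an operator space. -/
instance Submodule.instOperatorSpace (F : Submodule ℂ V) : OperatorSpace F where
  matNorm x := MatrixNorms.matNorm (x.map F.subtype)
  matNorm_single v := OperatorSpace.matNorm_single (v : V)
  matNorm_add_le x y := by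
    refine le_of_eq_of_le ?_ (OperatorSpace.matNorm_add_le (x.map F.subtype) (y.map F.subtype))
    congr 1
  matNorm_scalarMulMul_le α x β := by
    refine le_of_eq_of_le ?_ (OperatorSpace.matNorm_scalarMulMul_le α (x.map F.subtype) β)
    congr 1
    ext i j
    simp [scalarMulMul]
  matNorm_fromBlocks x y := by
    refine Eq.trans ?_ (OperatorSpace.matNorm_fromBlocks (x.map F.subtype) (y.map F.subtype))
    congr 1
    rw [Matrix.fromBlocks_map, Matrix.map_zero _ (map_zero _), Matrix.map_zero _ (map_zero _)]

theorem Submodule.matNorm_def (F : Submodule ℂ V) {ι : Type} [Fintype ι] [DecidableEq ι]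
    (x : Matrix ι ι F) : MatrixNorms.matNorm x = MatrixNorms.matNorm (x.map F.subtype) := rfl

end

theorem Matrix.norm_sum_star_mul_le {ι : Type*} [Fintype ι] [DecidableEq ι] (W : Matrix ι ι ℂ)
    (x y : ι → ℂ) : ‖∑ p, ∑ q, starRingEnd ℂ (y p) * W p q * x q‖ ≤
      ‖W‖ * √(∑ q, ‖x q‖ ^ 2) * √(∑ p, ‖y p‖ ^ 2) := by
  have h1 : ∑ p, ∑ q, starRingEnd ℂ (y p) * W p q * x q =
      inner ℂ (WithLp.toLp 2 y : EuclideanSpace ℂ ι)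
        (WithLp.toLp 2 (fun p => ∑ q, W p q * x q) : EuclideanSpace ℂ ι) := by
    rw [PiLp.inner_apply]
    refine Finset.sum_congr rfl fun p _ => ?_
    simp only [RCLike.inner_apply, Finset.sum_mul]
    refine Finset.sum_congr rfl fun q _ => by ring
  rw [h1]
  refine (norm_inner_le_norm _ _).trans ?_
  rw [mul_comm]
  have h2 : ∀ z : ι → ℂ, ‖(WithLp.toLp 2 z : EuclideanSpace ℂ ι)‖ = √(∑ p, ‖z p‖ ^ 2) :=
    fun z => EuclideanSpace.norm_eq _
  rw [h2, h2]
  gcongr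
  rw [← Real.sqrt_sq (norm_nonneg W), ← Real.sqrt_mul (sq_nonneg _)]
  exact Real.sqrt_le_sqrt (W.sum_norm_mulVec_sq_le x)

/-! ### Tensor products of representations -/

namespace UnitaryRep

section

variable {G : Type u} [Group G] [TopologicalSpace G]

/-- The elementary tensors in the space of `ρ ⊗ σ`, as a continuous bilinear map. -/
def tmul (ρ σ : UnitaryRep G) : ρ.H →L[ℂ] σ.H →L[ℂ] (ρ.tensor σ).H :=
  ((ContinuousLinearMap.compL ℂ σ.H (ρ.H ⊗[ℂ] σ.H) (UniformSpace.Completion (ρ.H ⊗[ℂ] σ.H)))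
    UniformSpace.Completion.toComplL).comp (TensorProduct.mkL ℂ ρ.H σ.H)

variable (ρ σ : UnitaryRep G)

theorem tmul_apply (x : ρ.H) (y : σ.H) : ρ.tmul σ x y =
    ((x ⊗ₜ[ℂ] y : ρ.H ⊗[ℂ] σ.H) : UniformSpace.Completion (ρ.H ⊗[ℂ] σ.H)) := rfl

theorem inner_tmul (x x' : ρ.H) (y y' : σ.H) :
    inner ℂ (ρ.tmul σ x y) (ρ.tmul σ x' y') = inner ℂ x x' * inner ℂ y y' :=
  (UniformSpace.Completion.inner_coe _ _).trans (TensorProduct.inner_tmul ..)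

theorem tensor_π_tmul (s : G) (x : ρ.H) (y : σ.H) :
    (ρ.tensor σ).π s (ρ.tmul σ x y) = ρ.tmul σ (ρ.π s x) (σ.π s y) :=
  (ContinuousLinearMap.completion_apply_coe _ _).trans (by simp [tmul_apply])

/-- Closed induction on the Hilbert space tensor product. -/
theorem tensor_induction {p : (ρ.tensor σ).H → Prop} (hp : IsClosed {z | p z}) (h0 : p 0)
    (ht : ∀ x y, p (ρ.tmul σ x y)) (ha : ∀ z w, p z → p w → p (z + w)) (z : (ρ.tensor σ).H) :
    p z := by
  refine UniformSpace.Completion.induction_on (α := ρ.H ⊗[ℂ] σ.H) (p := p) z hp fun w => ?_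
  induction w using TensorProduct.induction_on with
  | zero => exact h0
  | tmul x y => exact ht x y
  | add x y hx hy =>
    have := ha _ _ hx hy
    exact (UniformSpace.Completion.coe_add x y) ▸ this

/-- This makes `y ↦ ∑ e_k ⊗ y_k` an isometry into the tensor product, used below to compress
operators of `ρ ⊗ σ`. -/
theorem norm_sum_tmul_sq {N : Type*} [Fintype N] {e : N → ρ.H} (he : Orthonormal ℂ e)
    (y : N → σ.H) : ‖∑ k, ρ.tmul σ (e k) (y k)‖ ^ 2 = ∑ k, ‖y k‖ ^ 2 := by
  classical
  have h : inner ℂ (∑ k, ρ.tmul σ (e k) (y k)) (∑ k, ρ.tmul σ (e k) (y k)) =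
      ((∑ k, ‖y k‖ ^ 2 : ℝ) : ℂ) := by
    rw [sum_inner]
    simp only [inner_sum, inner_tmul, orthonormal_iff_ite.1 he, ite_mul, one_mul, zero_mul,
      Finset.sum_ite_eq, Finset.mem_univ, if_true, inner_self_eq_norm_sq_to_K]
    simp
  rw [inner_self_eq_norm_sq_to_K] at h
  exact Complex.ofReal_injective (by simpa using h)

/-- The coefficient `⟨π(·)ξ, η⟩` as an element of the Fourier-Stieltjes algebra. -/
def coefficient (ξ η : ρ.H) : FourierStieltjes G := ⟨ρ.coeff ξ η, ρ, ξ, η, rfl⟩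

theorem toFun_coefficient (ξ η : ρ.H) :
    FourierStieltjes.toFun (ρ.coefficient ξ η) = ρ.coeff ξ η := rfl

theorem continuous_coeff (ξ η : ρ.H) : Continuous (ρ.coeff ξ η) :=
  continuous_const.inner (ρ.continuous_apply ξ)

end

end UnitaryRep

/-! ### Products in `B(G)` and multiplication on `C_c(G)` -/

namespace FourierStieltjes

section

variable {G : Type u} [Group G] [TopologicalSpace G]

theorem toFun_injective : Function.Injective (toFun : FourierStieltjes G →ₐ[ℂ] (G → ℂ)) :=
  Subtype.val_injective

theorem exists_coefficient (u : FourierStieltjes G) :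
    ∃ (ρ : UnitaryRep G) (ξ η : ρ.H), u = ρ.coefficient ξ η := by
  obtain ⟨ρ, ξ, η, h⟩ := exists_coeff u
  exact ⟨ρ, ξ, η, toFun_injective h⟩

theorem coefficient_mul_coefficient (ρ σ : UnitaryRep G) (ξ η : ρ.H) (ξ' η' : σ.H) :
    ρ.coefficient ξ η * σ.coefficient ξ' η' =
      (ρ.tensor σ).coefficient (ρ.tmul σ ξ ξ') (ρ.tmul σ η η') :=
  toFun_injective (funext fun s => (ρ.coeff_tensor σ ξ η ξ' η' s).symm)

theorem continuous_toFun (u : FourierStieltjes G) : Continuous (toFun u) := by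
  obtain ⟨ρ, ξ, η, h⟩ := exists_coeff u
  exact h ▸ ρ.continuous_coeff ξ η

/-- Pointwise multiplication of functions of compact support with elements of `B(G)`. -/
def mulPre (u : FourierStieltjes G) : PreGroupCStar G →ₗ[ℂ] PreGroupCStar G where
  toFun f := (PreGroupCStar.toCc G).symm
    { toFun := fun s => toFun u s * PreGroupCStar.toCc G f s
      continuous_toFun := (continuous_toFun u).mul (PreGroupCStar.toCc G f).continuous
      hasCompactSupport' := (PreGroupCStar.toCc G f).hasCompactSupport.mul_left }
  map_add' f g := by
    apply (PreGroupCStar.toCc G).injective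
    ext s
    simp [mul_add]
  map_smul' c f := by
    apply (PreGroupCStar.toCc G).injective
    ext s
    simp [mul_left_comm]

theorem toCc_mulPre (u : FourierStieltjes G) (f : PreGroupCStar G) (s : G) :
    PreGroupCStar.toCc G (mulPre u f) s = toFun u s * PreGroupCStar.toCc G f s := rfl

end

/-! ### The action of `B(G)` on `C*(G)` -/

variable {G : Type u} [Group G] [TopologicalSpace G] [IsTopologicalGroup G]
  [LocallyCompactSpace G] [MeasurableSpace G] [BorelSpace G]

theorem functional_coefficient (ρ : UnitaryRep G) (ξ η : ρ.H) (a : GroupCStar G) :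
    functional (ρ.coefficient ξ η) a = inner ℂ η (ρ.extend a ξ) :=
  functional_eq_inner _ ρ ξ η rfl a

theorem ext_functional {a b : GroupCStar G}
    (h : ∀ u : FourierStieltjes G, functional u a = functional u b) : a = b :=
  GroupCStar.ext_extend fun ρ => ContinuousLinearMap.ext fun ξ => ext_inner_left ℂ fun η => by
    rw [← functional_coefficient, h, functional_coefficient]

/-- Products of coefficients are coefficients of tensor products. So multiplying `f` by a
coefficient of `ρ` before applying `σ` amounts to compressing `(ρ ⊗ σ)(f)`, which gives norm bounds
independent of `σ`. -/
theorem inner_integrate_mulPre (ρ σ : UnitaryRep G) (ξ η : ρ.H) (ξ' η' : σ.H)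
    (f : PreGroupCStar G) :
    inner ℂ η' (σ.integrate (PreGroupCStar.toCc G (mulPre (ρ.coefficient ξ η) f)) ξ') =
      inner ℂ (ρ.tmul σ η η')
        ((ρ.tensor σ).integrate (PreGroupCStar.toCc G f) (ρ.tmul σ ξ ξ')) := by
  rw [UnitaryRep.inner_integrate, UnitaryRep.inner_integrate]
  congr 1
  ext s
  rw [toCc_mulPre, ρ.toFun_coefficient]
  have := ρ.coeff_tensor σ ξ η ξ' η' s
  rw [← UnitaryRep.tmul_apply, ← UnitaryRep.tmul_apply] at this
  rw [this]
  ring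

theorem norm_mulPre_coefficient_le (ρ : UnitaryRep G) (ξ η : ρ.H) (f : PreGroupCStar G) :
    ‖mulPre (ρ.coefficient ξ η) f‖ ≤ ‖ξ‖ * ‖η‖ * ‖f‖ := by
  refine PreGroupCStar.norm_le fun σ => ?_
  have hn : ∀ (x : ρ.H) (y : σ.H), ‖ρ.tmul σ x y‖ = ‖x‖ * ‖y‖ := fun x y =>
    (UniformSpace.Completion.norm_coe _).trans (TensorProduct.norm_tmul x y)
  have hf : 0 ≤ ‖f‖ := norm_nonneg f
  refine ContinuousLinearMap.opNorm_le_of_inner_le _ (by positivity) fun ξ' η' => ?_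
  rw [inner_integrate_mulPre]
  calc _ ≤ ‖ρ.tmul σ η η'‖ * (‖f‖ * ‖ρ.tmul σ ξ ξ'‖) :=
        (norm_inner_le_norm _ _).trans (mul_le_mul_of_nonneg_left
          (ContinuousLinearMap.le_of_opNorm_le _ ((ρ.tensor σ).norm_integrate_le_norm f) _)
          (norm_nonneg _))
    _ = _ := by rw [hn, hn]; ring

theorem exists_bound_mulPre (u : FourierStieltjes G) :
    ∃ C, ∀ f : PreGroupCStar G, ‖mulPre u f‖ ≤ C * ‖f‖ := by
  obtain ⟨ρ, ξ, η, rfl⟩ := exists_coefficient u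
  exact ⟨_, norm_mulPre_coefficient_le ρ ξ η⟩

/-- Multiplication with `u ∈ B(G)` on `C*(G)`: the predual of multiplication with `u` on `B(G)`. -/
def mulOp (u : FourierStieltjes G) : GroupCStar G →L[ℂ] GroupCStar G :=
  ((UniformSpace.Completion.toComplL : PreGroupCStar G →L[ℂ] GroupCStar G).comp
    ((mulPre u).mkContinuousOfExistsBound (exists_bound_mulPre u))).extend
    (UniformSpace.Completion.toComplL : PreGroupCStar G →L[ℂ] GroupCStar G)

theorem mulOp_coe (u : FourierStieltjes G) (f : PreGroupCStar G) :
    mulOp u (f : GroupCStar G) = (mulPre u f : PreGroupCStar G) :=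
  ContinuousLinearMap.extend_eq _ UniformSpace.Completion.denseRange_coe
    (UniformSpace.Completion.isUniformInducing_coe _) f

theorem norm_mulOp_coefficient_le (ρ : UnitaryRep G) (ξ η : ρ.H) (a : GroupCStar G) :
    ‖mulOp (ρ.coefficient ξ η) a‖ ≤ ‖ξ‖ * ‖η‖ * ‖a‖ := by
  induction a using UniformSpace.Completion.induction_on with
  | hp => exact isClosed_le (by fun_prop) (by fun_prop)
  | ih f =>
    rw [mulOp_coe, UniformSpace.Completion.norm_coe, UniformSpace.Completion.norm_coe]
    exact norm_mulPre_coefficient_le ρ ξ η f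

theorem functional_mulOp (u v : FourierStieltjes G) (a : GroupCStar G) :
    functional v (mulOp u a) = functional (u * v) a := by
  induction a using UniformSpace.Completion.induction_on with
  | hp => exact isClosed_eq (by fun_prop) (by fun_prop)
  | ih f =>
    rw [mulOp_coe, functional_coe, functional_coe]
    congr 1
    ext s
    rw [toCc_mulPre, map_mul, Pi.mul_apply]
    ring

theorem functional_add (u v : FourierStieltjes G) (a : GroupCStar G) :
    functional (u + v) a = functional u a + functional v a :=
  congrArg (fun φ : StrongDual ℂ (GroupCStar G) => φ a) (toDual.map_add u v)

theorem functional_smul (c : ℂ) (u : FourierStieltjes G) (a : GroupCStar G) :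
    functional (c • u) a = c * functional u a :=
  congrArg (fun φ : StrongDual ℂ (GroupCStar G) => φ a) (toDual.map_smul c u)

theorem mulOp_add (u v : FourierStieltjes G) (a : GroupCStar G) :
    mulOp (u + v) a = mulOp u a + mulOp v a :=
  ext_functional fun w => by
    simp only [map_add, functional_mulOp, add_mul, functional_add]

theorem mulOp_smul (c : ℂ) (u : FourierStieltjes G) (a : GroupCStar G) :
    mulOp (c • u) a = c • mulOp u a :=
  ext_functional fun w => by
    simp only [map_smul, functional_mulOp, smul_mul_assoc, functional_smul, smul_eq_mul]

theorem mulOp_mul (u v : FourierStieltjes G) (a : GroupCStar G) :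
    mulOp (u * v) a = mulOp v (mulOp u a) :=
  ext_functional fun w => by
    simp only [functional_mulOp, mul_assoc]

theorem inner_extend_mulOp (ρ σ : UnitaryRep G) (ξ η : ρ.H) (ξ' η' : σ.H) (a : GroupCStar G) :
    inner ℂ η' (σ.extend (mulOp (ρ.coefficient ξ η) a) ξ') =
      inner ℂ (ρ.tmul σ η η') ((ρ.tensor σ).extend a (ρ.tmul σ ξ ξ')) := by
  rw [← functional_coefficient, functional_mulOp, coefficient_mul_coefficient,
    functional_coefficient]

/-- In a representation `σ` this matrix becomes `w* [(ρ ⊗ σ)(x)] w`, where `w` is the isometry given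
by the orthonormal family `e`. -/
theorem matNorm_mulOp_coefficient_le {κ N : Type} [Fintype κ] [DecidableEq κ] [Fintype N]
    [DecidableEq N] (ρ : UnitaryRep G) {e : N → ρ.H} (he : Orthonormal ℂ e)
    (x : Matrix κ κ (GroupCStar G)) :
    MatrixNorms.matNorm (Matrix.of fun p q : κ × N =>
      mulOp (ρ.coefficient (e q.2) (e p.2)) (x p.1 q.1)) ≤ MatrixNorms.matNorm x := by
  refine GroupCStar.matNorm_le fun σ => le_trans ?_
    (GroupCStar.enorm_opMatrix_le x (ρ.tensor σ))
  rw [enorm_le_iff_norm_le]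
  refine norm_opMatrix_le_of_inner_le _ (norm_nonneg _) fun ξ η => ?_
  let w : (κ × N → σ.H) → PiLp 2 (fun _ : κ => (ρ.tensor σ).H) := fun z =>
    WithLp.toLp 2 fun p => ∑ k, ρ.tmul σ (e k) (z (p, k))
  have hw : ∀ z : PiLp 2 (fun _ : κ × N => σ.H), ‖w z‖ = ‖z‖ := fun z => by
    rw [← sq_eq_sq₀ (norm_nonneg _) (norm_nonneg _), PiLp.norm_sq_eq_of_L2,
      PiLp.norm_sq_eq_of_L2, Fintype.sum_prod_type]
    exact Finset.sum_congr rfl fun p _ => ρ.norm_sum_tmul_sq σ he _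
  have h : ∑ p, ∑ q, inner ℂ (η p) (((Matrix.of fun p q : κ × N =>
        mulOp (ρ.coefficient (e q.2) (e p.2)) (x p.1 q.1)).map σ.extend) p q (ξ q)) =
      inner ℂ (w η) (opMatrix (x.map (ρ.tensor σ).extend) (w ξ)) := by
    rw [inner_opMatrix]
    simp only [Fintype.sum_prod_type, Matrix.map_apply, Matrix.of_apply, inner_extend_mulOp, w,
      map_sum, sum_inner, inner_sum]
    refine Finset.sum_congr rfl fun p _ => ?_
    rw [Finset.sum_comm]
    refine Finset.sum_congr rfl fun q _ => ?_
    rw [Finset.sum_comm]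
  rw [h, ← hw ξ, ← hw η]
  refine (norm_inner_le_norm _ _).trans ?_
  rw [mul_comm]
  gcongr
  exact ContinuousLinearMap.le_opNorm _ _

theorem functional_mulOp_comm (u v : FourierStieltjes G) (a : GroupCStar G) :
    functional v (mulOp u a) = functional u (mulOp v a) := by
  rw [functional_mulOp, functional_mulOp, mul_comm]

/-- The action of `B(G)` on `C*(G)` is completely contractive. -/
theorem matNorm_mulOp_le {ι κ : Type} [Fintype ι] [DecidableEq ι] [Fintype κ] [DecidableEq κ]
    (u : Matrix ι ι (FourierStieltjes G)) (x : Matrix κ κ (GroupCStar G)) :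
    MatrixNorms.matNorm (Matrix.of fun p q : ι × κ => mulOp (u p.1 q.1) (x p.2 q.2)) ≤
      MatrixNorms.matNorm u * MatrixNorms.matNorm x := by
  refine GroupCStar.matNorm_le fun ρ => ?_
  by_cases hC : MatrixNorms.matNorm u * MatrixNorms.matNorm x = ∞
  · rw [hC]; exact le_top
  rw [← ofReal_norm, ENNReal.ofReal_le_iff_le_toReal hC]
  refine norm_opMatrix_le_of_inner_le _ ENNReal.toReal_nonneg fun ξ η => ?_
  -- Expanding the test vectors in an orthonormal basis `e` of their joint span turns the form into
  -- a scalar matrix `W`, sandwiched between coordinate vectors of the same norms as `ξ` and `η`.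
  let V : Submodule ℂ ρ.H := Submodule.span ℂ (Set.range ξ ∪ Set.range η)
  have : FiniteDimensional ℂ V := FiniteDimensional.span_of_finite ℂ
    ((Set.finite_range _).union (Set.finite_range _))
  let b := stdOrthonormalBasis ℂ V
  let e : Fin (Module.finrank ℂ V) → ρ.H := fun k => b k
  have he : Orthonormal ℂ e := b.orthonormal.comp_linearIsometry V.subtypeₗᵢ
  let ξ' : ι × κ → V := fun p => ⟨ξ p, Submodule.subset_span (Or.inl ⟨p, rfl⟩)⟩
  let η' : ι × κ → V := fun p => ⟨η p, Submodule.subset_span (Or.inr ⟨p, rfl⟩)⟩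
  have hexp : ∀ v : V, (v : ρ.H) = ∑ k, inner ℂ (b k) v • e k := fun v => by
    conv_lhs => rw [← b.sum_repr' v]
    simp [e]
  have hnorm : ∀ v : V, ‖(v : ρ.H)‖ ^ 2 = ∑ k, ‖inner ℂ (b k) v‖ ^ 2 := fun v => by
    rw [b.sum_sq_norm_inner_right]; rfl
  let Z : Matrix (κ × Fin (Module.finrank ℂ V)) (κ × Fin (Module.finrank ℂ V)) (GroupCStar G) :=
    Matrix.of fun p q => mulOp (ρ.coefficient (e q.2) (e p.2)) (x p.1 q.1)
  let W : Matrix (ι × (κ × Fin (Module.finrank ℂ V))) (ι × (κ × Fin (Module.finrank ℂ V))) ℂ :=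
    Matrix.of fun p q => (u.map toDual) p.1 q.1 (Z p.2 q.2)
  have hW : ‖W‖ ≤ (MatrixNorms.matNorm u * MatrixNorms.matNorm x).toReal := by
    rw [← ENNReal.ofReal_le_iff_le_toReal hC, ofReal_norm]
    exact (OperatorSpace.enorm_pairing_le (u.map toDual) Z (GroupCStar.matNorm_ne_top Z)).trans
      (mul_le_mul_right (matNorm_mulOp_coefficient_le ρ he x) _)
  let β : ι × (κ × Fin (Module.finrank ℂ V)) → ℂ := fun p => inner ℂ (b p.2.2) (ξ' (p.1, p.2.1))
  let α : ι × (κ × Fin (Module.finrank ℂ V)) → ℂ := fun p => inner ℂ (b p.2.2) (η' (p.1, p.2.1))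
  have hβ : √(∑ p, ‖β p‖ ^ 2) = ‖ξ‖ := by
    rw [← Real.sqrt_sq (norm_nonneg ξ), PiLp.norm_sq_eq_of_L2]
    congr 1
    simp only [Fintype.sum_prod_type, β]
    exact Finset.sum_congr rfl fun i _ => Finset.sum_congr rfl fun k _ => (hnorm _).symm
  have hα : √(∑ p, ‖α p‖ ^ 2) = ‖η‖ := by
    rw [← Real.sqrt_sq (norm_nonneg η), PiLp.norm_sq_eq_of_L2]
    congr 1
    simp only [Fintype.sum_prod_type, α]
    exact Finset.sum_congr rfl fun i _ => Finset.sum_congr rfl fun k _ => (hnorm _).symm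
  have hterm : ∀ p q : ι × κ, inner ℂ (η p) (ρ.extend (mulOp (u p.1 q.1) (x p.2 q.2)) (ξ q)) =
      ∑ k, ∑ l, starRingEnd ℂ (α (p.1, (p.2, k))) * W (p.1, (p.2, k)) (q.1, (q.2, l)) *
        β (q.1, (q.2, l)) := by
    intro p q
    have h1 : ξ q = ∑ l, β (q.1, (q.2, l)) • e l := hexp (ξ' q)
    have h2 : η p = ∑ k, α (p.1, (p.2, k)) • e k := hexp (η' p)
    rw [h1, h2, sum_inner]
    refine Finset.sum_congr rfl fun k _ => ?_
    rw [map_sum, inner_sum]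
    refine Finset.sum_congr rfl fun l _ => ?_
    -- Commutativity of `B(G)` exchanges roles: the coefficient of `ρ` now acts on `x`, where
    -- `matNorm_mulOp_coefficient_le` applies, and `u` is only paired with the result.
    rw [map_smul, inner_smul_left, inner_smul_right, ← functional_coefficient,
      functional_mulOp_comm]
    change _ = _ * functional (u p.1 q.1) (mulOp (ρ.coefficient (e l) (e k)) (x p.2 q.2)) * _
    ring
  have hsum : ∑ p, ∑ q, inner ℂ (η p) (((Matrix.of fun p q : ι × κ =>
        mulOp (u p.1 q.1) (x p.2 q.2)).map ρ.extend) p q (ξ q)) =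
      ∑ p, ∑ q, starRingEnd ℂ (α p) * W p q * β q := by
    simp only [Matrix.map_apply, Matrix.of_apply, hterm]
    simp only [Fintype.sum_prod_type]
    refine Finset.sum_congr rfl fun i _ => Finset.sum_congr rfl fun p _ => ?_
    symm
    rw [Finset.sum_comm]
    refine Finset.sum_congr rfl fun j _ => ?_
    rw [Finset.sum_comm]
  rw [hsum]
  refine (W.norm_sum_star_mul_le β α).trans ?_
  rw [hα, hβ]
  gcongr

end FourierStieltjes

/-! ### Normality: the maps `u ↦ φ(u · x)` are given by elements of `C*(G)` -/

theorem CompactlySupportedContinuousMap.exists_mul_eq_self {X : Type*} [TopologicalSpace X]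
    [LocallyCompactSpace X] [T2Space X] (f : C_c(X, ℂ)) :
    ∃ k : C_c(X, ℂ), k * f = f := by
  obtain ⟨k, hk1, hk2, -, -⟩ := exists_continuousMap_one_of_isCompact_subset_isOpen
    f.hasCompactSupport.isCompact isOpen_univ (Set.subset_univ _)
  refine ⟨⟨⟨fun s => (k s : ℂ), by fun_prop⟩, ?_⟩, ?_⟩
  · exact HasCompactSupport.comp_left (g := fun x : ℝ => (x : ℂ)) hk2 (by simp)
  · ext s
    by_cases hs : s ∈ tsupport f
    · have := hk1 hs
      simp only [Pi.one_apply] at this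
      simp [this]
    · simp [image_eq_zero_of_notMem_tsupport hs]

section

variable {G : Type u} [Group G] [TopologicalSpace G] [IsTopologicalGroup G]
  [LocallyCompactSpace G] [MeasurableSpace G] [BorelSpace G]

theorem CompactlySupportedContinuousMap.memLp_haar (f : C_c(G, ℂ)) (p : ℝ≥0∞) :
    MemLp f p (Measure.haar : Measure G) :=
  f.continuous.memLp_of_hasCompactSupport f.hasCompactSupport

/-- The inclusion of `C_c(G)` into `L²(G)`. -/
def CompactlySupportedContinuousMap.toL2 :
    C_c(G, ℂ) →ₗ[ℂ] Lp ℂ 2 (Measure.haar : Measure G) where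
  toFun f := (f.memLp_haar 2).toLp f
  map_add' f g := (MemLp.toLp_add (f.memLp_haar 2) (g.memLp_haar 2))
  map_smul' c f := (MemLp.toLp_const_smul c (f.memLp_haar 2))

open CompactlySupportedContinuousMap

/-- The closure of `C_c(G)` in `L²(G)`. -/
abbrev L2Closure (G : Type u) [Group G] [TopologicalSpace G] [IsTopologicalGroup G]
    [LocallyCompactSpace G] [MeasurableSpace G] [BorelSpace G] :
    Submodule ℂ (Lp ℂ 2 (Measure.haar : Measure G)) :=
  (LinearMap.range (toL2 (G := G))).topologicalClosure

/-- The inclusion of `C_c(G)` into its closure in `L²(G)`. -/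
def CompactlySupportedContinuousMap.toL2Closure : C_c(G, ℂ) →ₗ[ℂ] L2Closure G :=
  toL2.codRestrict _ fun f => Submodule.le_topologicalClosure _ ⟨f, rfl⟩

theorem CompactlySupportedContinuousMap.denseRange_toL2Closure :
    DenseRange (toL2Closure : C_c(G, ℂ) →ₗ[ℂ] L2Closure G) := by
  refine Metric.denseRange_iff.2 fun v r hr => ?_
  obtain ⟨_, ⟨f, rfl⟩, hf⟩ := Metric.mem_closure_iff.1 v.2 r hr
  exact ⟨f, hf⟩

theorem CompactlySupportedContinuousMap.norm_toL2_star (f : C_c(G, ℂ)) :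
    ‖toL2 (star f)‖ = ‖toL2 f‖ := by
  refine (Lp.norm_toLp _ ((star f).memLp_haar 2)).trans
    (Eq.trans ?_ (Lp.norm_toLp _ (f.memLp_haar 2)).symm)
  congr 1
  exact eLpNorm_congr_norm_ae (Filter.Eventually.of_forall fun s => by simp)

theorem CompactlySupportedContinuousMap.inner_toL2 (f g : C_c(G, ℂ)) :
    inner ℂ (toL2 f) (toL2 g) = ∫ s, (star f * g) s ∂(Measure.haar : Measure G) := by
  rw [L2.inner_def]
  refine integral_congr_ae ?_
  filter_upwards [(f.memLp_haar 2).coeFn_toLp, (g.memLp_haar 2).coeFn_toLp] with s hf hg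
  change inner ℂ ((f.memLp_haar 2).toLp f s) ((g.memLp_haar 2).toLp g s) = _
  rw [hf, hg]
  simp [mul_comm]

theorem PreGroupCStar.norm_le_integral (f : PreGroupCStar G) :
    ‖f‖ ≤ ∫ s, ‖toCc G f s‖ ∂(Measure.haar : Measure G) :=
  PreGroupCStar.norm_le fun ρ => ρ.norm_integrate_le _

/-- The C*-norm is at most the `L¹`-norm, and Cauchy–Schwarz applies to the pointwise product. This
makes `h ↦ φ(fh)` continuous for the `L²`-norm. -/
theorem PreGroupCStar.norm_mul_le (f g : C_c(G, ℂ)) :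
    ‖(toCc G).symm (f * g)‖ ≤ ‖toL2 f‖ * ‖toL2 g‖ := by
  refine (PreGroupCStar.norm_le_integral _).trans ?_
  have hf := (f.memLp_haar 2).norm
  have hg := (g.memLp_haar 2).norm
  have h1 : ∫ s, ‖toCc G ((toCc G).symm (f * g)) s‖ ∂(Measure.haar : Measure G) =
      inner ℝ (hf.toLp _) (hg.toLp _) := by
    rw [L2.inner_def]
    refine integral_congr_ae ?_
    filter_upwards [hf.coeFn_toLp, hg.coeFn_toLp] with s h h'
    rw [h, h']
    simp [mul_comm]
  rw [h1]
  refine (real_inner_le_norm _ _).trans (le_of_eq ?_)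
  have h2 : ∀ h : C_c(G, ℂ), ‖(h.memLp_haar 2).norm.toLp‖ = ‖toL2 h‖ := fun h => by
    refine (Lp.norm_toLp _ _).trans (Eq.trans ?_ (Lp.norm_toLp _ (h.memLp_haar 2)).symm)
    rw [eLpNorm_norm]
  rw [h2, h2]

namespace FourierStieltjes

/-- With `k = 1` on the support of `f`, `φ(uf) = φ(f · uk)` is an `L²`-bounded functional of `uk`.
Riesz represents it by some `v` in the closure of `C_c(G)`. If `g_n → v` with `g_n` in `C_c(G)`,
then the functions `conj(g_n) k` converge in `C*(G)`, and their limit is `y`. -/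
theorem exists_functional_eq_coe [T2Space G] (φ : StrongDual ℂ (GroupCStar G))
    (f : PreGroupCStar G) :
    ∃ y : GroupCStar G, ∀ u : FourierStieltjes G, φ (mulOp u (f : GroupCStar G)) =
      functional u y := by
  let toC := PreGroupCStar.toCc G
  obtain ⟨k, hk⟩ := (toC f).exists_mul_eq_self
  let ψ : C_c(G, ℂ) →ₗ[ℂ] ℂ :=
    { toFun := fun h => φ ((toC.symm (toC f * h) : PreGroupCStar G) : GroupCStar G)
      map_add' := fun h h' => by
        rw [mul_add, map_add, UniformSpace.Completion.coe_add, map_add]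
      map_smul' := fun c h => by
        rw [mul_smul_comm, map_smul, UniformSpace.Completion.coe_smul, map_smul, RingHom.id_apply] }
  have hψ : ∃ C, ∀ h, ‖ψ h‖ ≤ C * ‖toL2 h‖ := ⟨‖φ‖ * ‖toL2 (toC f)‖, fun h => by
    refine (φ.le_opNorm _).trans ?_
    rw [UniformSpace.Completion.norm_coe, mul_assoc]
    gcongr
    exact PreGroupCStar.norm_mul_le _ _⟩
  let v := (InnerProductSpace.toDual ℂ (L2Closure G)).symm (ψ.extendOfNorm toL2Closure)
  have hv : ∀ h, inner ℂ (v : Lp ℂ 2 (Measure.haar : Measure G)) (toL2 h) = ψ h := fun h => by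
    change inner ℂ v (toL2Closure h) = ψ h
    rw [InnerProductSpace.toDual_symm_apply]
    exact LinearMap.extendOfNorm_eq denseRange_toL2Closure hψ h
  obtain ⟨w, hw, hwv⟩ := mem_closure_iff_seq_limit.1 v.2
  choose g hg using hw
  let z : ℕ → GroupCStar G := fun n => ((toC.symm (star (g n) * k) : PreGroupCStar G))
  -- The fixed factor `k` is what turns `L²`-convergence of `g n` into convergence in `C*(G)`.
  have hz : CauchySeq z := by
    have hc : CauchySeq w := hwv.cauchySeq
    rw [Metric.cauchySeq_iff'] at hc ⊢
    intro ε hε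
    obtain ⟨N, hN⟩ := hc (ε / (‖toL2 k‖ + 1)) (by positivity)
    refine ⟨N, fun n hn => ?_⟩
    have h1 : z n - z N = ((toC.symm (star (g n - g N) * k) : PreGroupCStar G)) := by
      rw [star_sub, sub_mul, map_sub, UniformSpace.Completion.coe_sub]
    rw [dist_eq_norm, h1, UniformSpace.Completion.norm_coe]
    have h2 : ‖w n - w N‖ < ε / (‖toL2 k‖ + 1) := by
      rw [← dist_eq_norm]; exact hN n hn
    rw [lt_div_iff₀ (by positivity)] at h2
    refine (PreGroupCStar.norm_mul_le _ _).trans_lt (lt_of_le_of_lt ?_ h2)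
    rw [norm_toL2_star, map_sub, hg, hg]
    gcongr
    linarith
  obtain ⟨y, hy⟩ := cauchySeq_tendsto_of_complete hz
  refine ⟨y, fun u => ?_⟩
  have h1 : Filter.Tendsto (fun n => functional u (z n)) Filter.atTop (nhds (functional u y)) :=
    ((functional u).continuous.tendsto y).comp hy
  have h2 : ∀ n, functional u (z n) = inner ℂ (w n) (toL2 (toC (mulPre u (toC.symm k)))) := by
    intro n
    rw [← hg n, inner_toL2, functional_coe]
    congr 1
    ext s
    have h3 : toC (mulPre u (toC.symm k)) s = toFun u s * k s := rfl
    simp only [CompactlySupportedContinuousMap.mul_apply, h3]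
    change (star (g n) * k) s * _ = _
    simp only [CompactlySupportedContinuousMap.mul_apply]
    ring
  have h4 : Filter.Tendsto (fun n => functional u (z n)) Filter.atTop
      (nhds (inner ℂ (v : Lp ℂ 2 (Measure.haar : Measure G)) (toL2 (toC (mulPre u (toC.symm k)))))) := by
    simp only [h2]
    exact hwv.inner tendsto_const_nhds
  rw [tendsto_nhds_unique h1 h4, hv]
  change _ = φ _
  rw [mulOp_coe]
  congr 2
  apply toC.injective
  ext s
  have h5 : toC (mulPre u (toC.symm k)) s = toFun u s * k s := rfl
  have h6 : k s * toC f s = toC f s := congrArg (fun h : C_c(G, ℂ) => h s) hk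
  change toFun u s * toC f s = (toC f * toC (mulPre u (toC.symm k))) s
  rw [CompactlySupportedContinuousMap.mul_apply, h5]
  linear_combination -(toFun u s) * h6

/-- Coefficients determine the norm of `y`, and a coefficient acts on `C*(G)` with norm at most the
product of the norms of its vectors. Applied to differences, this lets representing elements pass to
limits. -/
theorem norm_le_of_forall_functional_eq (φ : StrongDual ℂ (GroupCStar G)) {x y : GroupCStar G}
    (h : ∀ u : FourierStieltjes G, φ (mulOp u x) = functional u y) : ‖y‖ ≤ ‖φ‖ * ‖x‖ := by
  refine GroupCStar.norm_le fun ρ => ?_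
  refine ContinuousLinearMap.opNorm_le_of_inner_le _ (by positivity) fun ξ η => ?_
  rw [← functional_coefficient, ← h]
  calc _ ≤ ‖φ‖ * (‖ξ‖ * ‖η‖ * ‖x‖) := (φ.le_opNorm _).trans
        (mul_le_mul_of_nonneg_left (norm_mulOp_coefficient_le ρ ξ η x) (norm_nonneg _))
    _ = _ := by ring

theorem exists_functional_eq [T2Space G] (φ : StrongDual ℂ (GroupCStar G)) (x : GroupCStar G) :
    ∃ y : GroupCStar G, ∀ u : FourierStieltjes G, φ (mulOp u x) = functional u y := by
  obtain ⟨w, hw, hwx⟩ := mem_closure_iff_seq_limit.1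
    (UniformSpace.Completion.denseRange_coe (α := PreGroupCStar G) x)
  choose f hf using hw
  choose z hz using fun n => exists_functional_eq_coe φ (f n)
  have hc : CauchySeq z := by
    have hc : CauchySeq w := hwx.cauchySeq
    rw [Metric.cauchySeq_iff'] at hc ⊢
    intro ε hε
    obtain ⟨N, hN⟩ := hc (ε / (‖φ‖ + 1)) (by positivity)
    refine ⟨N, fun n hn => ?_⟩
    have h1 : ‖z n - z N‖ ≤ ‖φ‖ * ‖w n - w N‖ :=
      norm_le_of_forall_functional_eq φ fun u => by
        rw [map_sub, map_sub, map_sub, ← hz, ← hz, hf, hf]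
    have h2 : ‖w n - w N‖ < ε / (‖φ‖ + 1) := by
      rw [← dist_eq_norm]; exact hN n hn
    rw [lt_div_iff₀ (by positivity)] at h2
    rw [dist_eq_norm]
    refine lt_of_le_of_lt h1 (lt_of_le_of_lt ?_ h2)
    rw [mul_comm]
    gcongr
    linarith
  obtain ⟨y, hy⟩ := cauchySeq_tendsto_of_complete hc
  refine ⟨y, fun u => ?_⟩
  have h1 : Filter.Tendsto (fun n => functional u (z n)) Filter.atTop (nhds (functional u y)) :=
    ((functional u).continuous.tendsto y).comp hy
  have h2 : Filter.Tendsto (fun n => φ (mulOp u (w n))) Filter.atTop (nhds (φ (mulOp u x))) :=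
    ((φ.comp (mulOp u)).continuous.tendsto x).comp hwx
  refine tendsto_nhds_unique h2 (h1.congr fun n => ?_)
  rw [← hz, hf]

end FourierStieltjes

end

namespace UnitaryRep

/-! ### Invariant vectors and subrepresentations -/

section

variable {G : Type u} [Group G] [TopologicalSpace G] (ρ : UnitaryRep G)

theorem π_mul_apply (s t : G) (ξ : ρ.H) : ρ.π (s * t) ξ = ρ.π s (ρ.π t ξ) := by
  rw [map_mul]
  rfl

/-- The subspace of vectors that are invariant under a subgroup. -/
def fixed (N : Subgroup G) : Submodule ℂ ρ.H where
  carrier := {ξ | ∀ s ∈ N, ρ.π s ξ = ξ}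
  add_mem' hξ hη s hs := by rw [map_add, hξ s hs, hη s hs]
  zero_mem' s _ := map_zero _
  smul_mem' c ξ hξ s hs := by rw [map_smul, hξ s hs]

theorem isClosed_fixed (N : Subgroup G) : IsClosed (ρ.fixed N : Set ρ.H) := by
  have : (ρ.fixed N : Set ρ.H) = ⋂ s ∈ N, {ξ | ρ.π s ξ = ξ} := by
    ext ξ
    simp [fixed]
  rw [this]
  exact isClosed_biInter fun s _ => isClosed_eq (ρ.π s).continuous continuous_id

instance (N : Subgroup G) : CompleteSpace (ρ.fixed N) := (ρ.isClosed_fixed N).completeSpace_coe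

theorem inner_π_left (s : G) (ξ η : ρ.H) :
    inner ℂ (ρ.π s ξ) η = inner ℂ ξ (ρ.π s⁻¹ η) := by
  rw [← (ρ.π s⁻¹).inner_map_map, ← π_mul_apply]
  simp

theorem inner_π_right_of_mem_fixed {N : Subgroup G} {s : G} (hs : s ∈ N) {ζ : ρ.H}
    (hζ : ζ ∈ ρ.fixed N) (ξ : ρ.H) : inner ℂ ζ (ρ.π s ξ) = inner ℂ ζ ξ := by
  conv_lhs => rw [← hζ s hs]
  exact (ρ.π s).inner_map_map _ _

theorem π_mem_orthogonal_fixed (s : G) {ξ : ρ.H} (hξ : ξ ∈ (ρ.fixed ⊤)ᗮ) :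
    ρ.π s ξ ∈ (ρ.fixed ⊤)ᗮ := fun ζ hζ => by
  rw [ρ.inner_π_right_of_mem_fixed (Subgroup.mem_top s) hζ]
  exact hξ ζ hζ

/-- The subrepresentation on the complement of the invariant vectors. -/
def complement : UnitaryRep G :=
  ofIsometry ((ρ.fixed ⊤)ᗮ : Submodule ℂ ρ.H)
    (fun s => ((ρ.π s).toContinuousLinearEquiv.toContinuousLinearMap.comp
      (ρ.fixed ⊤)ᗮ.subtypeL).codRestrict _ fun ξ => ρ.π_mem_orthogonal_fixed s ξ.2)
    (fun s ξ => (ρ.π s).norm_map ξ)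
    (fun ξ => Subtype.ext (by simp))
    (fun s t ξ => Subtype.ext (ρ.π_mul_apply s t ξ))
    (fun ξ => (ρ.continuous_apply ξ).subtype_mk _)

/-- The restriction of `ρ` to the complement of its invariant vectors has no nonzero invariant
vector, hence by (T) no almost invariant one. -/
theorem exists_le_norm_π_sub {Q : Set G} {ε : ℝ}
    (h : ∀ ρ : UnitaryRep G, (∃ ξ : ρ.H, ξ ≠ 0 ∧ ∀ s ∈ Q, ‖ρ.π s ξ - ξ‖ < ε * ‖ξ‖) →
      ∃ ξ : ρ.H, ξ ≠ 0 ∧ ∀ s, ρ.π s ξ = ξ) {ξ : ρ.H} (hξ : ξ ∈ (ρ.fixed ⊤)ᗮ) (h0 : ξ ≠ 0) :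
    ∃ s ∈ Q, ε * ‖ξ‖ ≤ ‖ρ.π s ξ - ξ‖ := by
  by_contra! hcon
  obtain ⟨ζ, hζ0, hζ⟩ := h ρ.complement ⟨(⟨ξ, hξ⟩ : ((ρ.fixed ⊤)ᗮ : Submodule ℂ ρ.H)),
    fun h => h0 (congrArg Subtype.val h), hcon⟩
  let ζ' : ((ρ.fixed ⊤)ᗮ : Submodule ℂ ρ.H) := ζ
  have h1 : (ζ' : ρ.H) ∈ ρ.fixed ⊤ := fun s _ =>
    congrArg (Subtype.val : ((ρ.fixed ⊤)ᗮ : Submodule ℂ ρ.H) → ρ.H) (hζ s)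
  have h2 : inner ℂ (ζ' : ρ.H) (ζ' : ρ.H) = 0 := ζ'.2 _ h1
  exact hζ0 (Subtype.ext (inner_self_eq_zero.1 h2) : ζ' = 0)

end

/-! ### Convolution -/

variable {G : Type u} [Group G] [TopologicalSpace G] [IsTopologicalGroup G]
  [LocallyCompactSpace G] [MeasurableSpace G] [BorelSpace G]

open scoped Pointwise in
/-- Convolution of functions with compact support. -/
def conv (f g : C_c(G, ℂ)) : C_c(G, ℂ) where
  toFun t := ∫ s, f s * g (s⁻¹ * t) ∂(Measure.haar : Measure G)
  continuous_toFun := by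
    rw [← continuousOn_univ]
    refine continuousOn_integral_of_compact_support f.hasCompactSupport.isCompact ?_ ?_
    · have h1 := f.continuous
      have h2 := g.continuous
      exact Continuous.continuousOn (by unfold Function.uncurry; fun_prop)
    · intro t s _ hs
      simp [image_eq_zero_of_notMem_tsupport hs]
  hasCompactSupport' := by
    refine HasCompactSupport.intro
      (f.hasCompactSupport.isCompact.mul g.hasCompactSupport.isCompact) fun t ht => ?_
    refine integral_eq_zero_of_ae (Filter.Eventually.of_forall fun s => ?_)
    by_contra hne
    have h1 := left_ne_zero_of_mul hne
    have h2 := right_ne_zero_of_mul hne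
    exact ht ⟨s, subset_tsupport _ h1, s⁻¹ * t, subset_tsupport _ h2, by simp⟩

open scoped Pointwise in
-- Fubini and left invariance of Haar measure. This is needed so that powers of `π(f)` again come
-- from elements of `C_c(G)`.
theorem integrate_conv (ρ : UnitaryRep G) (f g : C_c(G, ℂ)) (ξ : ρ.H) :
    ρ.integrate (conv f g) ξ = ρ.integrate f (ρ.integrate g ξ) := by
  have h1 : ∀ t, (conv f g) t • ρ.π t ξ =
      ∫ s, (f s * g (s⁻¹ * t)) • ρ.π t ξ ∂(Measure.haar : Measure G) := fun t =>
    (integral_smul_const _ _).symm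
  have h2 : ∀ s, ∫ t, (f s * g (s⁻¹ * t)) • ρ.π t ξ ∂(Measure.haar : Measure G) =
      f s • ρ.π s (ρ.integrate g ξ) := by
    intro s
    simp only [mul_smul]
    rw [integral_smul, integrate_apply]
    congr 1
    rw [← integral_mul_left_eq_self _ s]
    simp only [inv_mul_cancel_left, π_mul_apply, ← map_smul]
    exact (ρ.π s).toContinuousLinearEquiv.integral_comp_comm _
  rw [integrate_apply, integrate_apply]
  simp only [h1]
  rw [integral_integral_swap_of_hasCompactSupport]
  · simp only [h2]
  · have h1 := f.continuous
    have h2 := g.continuous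
    have h3 := ρ.continuous_apply ξ
    unfold Function.uncurry
    fun_prop
  · refine HasCompactSupport.intro
      ((f.hasCompactSupport.isCompact.mul g.hasCompactSupport.isCompact).prod
        f.hasCompactSupport.isCompact) ?_
    rintro ⟨t, s⟩ hts
    simp only [Function.uncurry]
    by_contra hne
    have hne' : f s * g (s⁻¹ * t) ≠ 0 := left_ne_zero_of_smul hne
    have h1 := subset_tsupport _ (left_ne_zero_of_mul hne')
    have h2 := subset_tsupport _ (right_ne_zero_of_mul hne')
    exact hts ⟨⟨s, h1, s⁻¹ * t, h2, by simp⟩, h1⟩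

/-! ### The spectral gap -/

theorem inner_integrate_of_mem_fixed (ρ : UnitaryRep G) {f : C_c(G, ℂ)}
    (hf : ∫ s, f s ∂(Measure.haar : Measure G) = 1) {ζ : ρ.H} (hζ : ζ ∈ ρ.fixed ⊤) (ξ : ρ.H) :
    inner ℂ ζ (ρ.integrate f ξ) = inner ℂ ζ ξ := by
  rw [inner_integrate]
  simp only [coeff, ρ.inner_π_right_of_mem_fixed (Subgroup.mem_top _) hζ]
  rw [integral_mul_const, hf, one_mul]

theorem integrate_of_mem_fixed (ρ : UnitaryRep G) {f : C_c(G, ℂ)}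
    (hf : ∫ s, f s ∂(Measure.haar : Measure G) = 1) {ξ : ρ.H} (hξ : ξ ∈ ρ.fixed ⊤) :
    ρ.integrate f ξ = ξ := by
  rw [integrate_apply]
  simp only [hξ _ (Subgroup.mem_top _)]
  rw [integral_smul_const, hf, one_smul]

theorem integrate_mem_orthogonal (ρ : UnitaryRep G) {f : C_c(G, ℂ)}
    (hf : ∫ s, f s ∂(Measure.haar : Measure G) = 1) {ξ : ρ.H} (hξ : ξ ∈ (ρ.fixed ⊤)ᗮ) :
    ρ.integrate f ξ ∈ (ρ.fixed ⊤)ᗮ := fun ζ hζ => by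
  rw [ρ.inner_integrate_of_mem_fixed hf hζ]
  exact hξ ζ hζ

/-- A real function with compact support as a complex one. -/
def ofRealCc (f : C_c(G, ℝ)) : C_c(G, ℂ) where
  toFun s := (f s : ℂ)
  continuous_toFun := Complex.continuous_ofReal.comp f.continuous
  hasCompactSupport' := f.hasCompactSupport.comp_left (g := fun x : ℝ => (x : ℂ)) (by simp)

theorem integral_ofRealCc (f : C_c(G, ℝ)) : ∫ s, ofRealCc f s ∂(Measure.haar : Measure G) =
    ((∫ s, f s ∂(Measure.haar : Measure G) : ℝ) : ℂ) := integral_ofReal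

theorem integrate_ofRealCc (ρ : UnitaryRep G) (f : C_c(G, ℝ)) (ξ : ρ.H) :
    ρ.integrate (ofRealCc f) ξ = ∫ s, f s • ρ.π s ξ ∂(Measure.haar : Measure G) := rfl

theorem integrable_mul_of_continuous (f : C_c(G, ℝ)) {g : G → ℝ} (hg : Continuous g) :
    Integrable (fun s => f s * g s) (Measure.haar : Measure G) :=
  (f.continuous.mul hg).integrable_of_hasCompactSupport f.hasCompactSupport.mul_right

/-- This is the variance identity: `π(f)ξ` is the mean of `π(s)ξ` for the density `f`, and all
`π(s)ξ` have norm `‖ξ‖`. If `‖π(f)ξ‖` is nearly `‖ξ‖`, the orbit concentrates around the mean. -/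
theorem integral_mul_norm_sub_sq (ρ : UnitaryRep G) {f : C_c(G, ℝ)}
    (hf : ∫ s, f s ∂(Measure.haar : Measure G) = 1) (ξ : ρ.H) :
    ∫ s, f s * ‖ρ.π s ξ - ρ.integrate (ofRealCc f) ξ‖ ^ 2 ∂(Measure.haar : Measure G) =
      ‖ξ‖ ^ 2 - ‖ρ.integrate (ofRealCc f) ξ‖ ^ 2 := by
  set η := ρ.integrate (ofRealCc f) ξ with hη
  have hc := ρ.continuous_apply ξ
  have h1 : ∀ s, f s * ‖ρ.π s ξ - η‖ ^ 2 =
      f s * (‖ξ‖ ^ 2 + ‖η‖ ^ 2) - 2 * (f s * (inner ℂ η (ρ.π s ξ)).re) := by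
    intro s
    rw [@norm_sub_sq ℂ, (ρ.π s).norm_map, ← inner_re_symm]
    simp only [RCLike.re_to_complex]
    ring
  have h2 : ∫ s, f s * (inner ℂ η (ρ.π s ξ)).re ∂(Measure.haar : Measure G) = ‖η‖ ^ 2 := by
    have h3 := ρ.inner_integrate (ofRealCc f) ξ η
    rw [← hη, inner_self_eq_norm_sq_to_K] at h3
    have h4 := congrArg Complex.re h3
    rw [← RCLike.re_to_complex, ← RCLike.re_to_complex, ← integral_re] at h4
    · have h5 : ∀ s, RCLike.re (ofRealCc f s * ρ.coeff ξ η s) =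
          f s * (inner ℂ η (ρ.π s ξ)).re := fun s => Complex.re_ofReal_mul _ _
      simp only [h5] at h4
      rw [← h4]
      norm_cast
    · exact ((ofRealCc f).continuous.mul (ρ.continuous_coeff ξ η)).integrable_of_hasCompactSupport
        (ofRealCc f).hasCompactSupport.mul_right
  simp only [h1]
  rw [integral_sub, integral_mul_const, integral_const_mul, h2, hf]
  · ring
  · exact integrable_mul_of_continuous f continuous_const
  · exact (integrable_mul_of_continuous f (by fun_prop)).const_mul 2

/-- The vector `π(t)π(f₀)ξ` averages `π(s)ξ` against the translated density `f₀(t⁻¹s)`, which is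
dominated by `C f`. -/
theorem norm_π_integrate_sub_le (ρ : UnitaryRep G) {f₀ f : C_c(G, ℝ)} (h₀ : ∀ s, 0 ≤ f₀ s)
    (hf₀ : ∫ s, f₀ s ∂(Measure.haar : Measure G) = 1)
    {C : ℝ} {t : G} (hC : ∀ s, f₀ (t⁻¹ * s) ≤ C * f s) (ξ η : ρ.H) :
    ‖ρ.π t (ρ.integrate (ofRealCc f₀) ξ) - η‖ ≤
      C * ∫ s, f s * ‖ρ.π s ξ - η‖ ∂(Measure.haar : Measure G) := by
  have hc := ρ.continuous_apply ξ
  have h1 : ρ.π t (ρ.integrate (ofRealCc f₀) ξ) - η =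
      ∫ s, f₀ s • (ρ.π (t * s) ξ - η) ∂(Measure.haar : Measure G) := by
    have h2 : ρ.π t (ρ.integrate (ofRealCc f₀) ξ) =
        ∫ s, f₀ s • ρ.π (t * s) ξ ∂(Measure.haar : Measure G) := by
      rw [integrate_ofRealCc]
      refine ((ρ.π t).toContinuousLinearEquiv.integral_comp_comm _).symm.trans ?_
      congr 1
      ext s
      rw [π_mul_apply]
      exact ((ρ.π t).toContinuousLinearEquiv.toContinuousLinearMap.restrictScalars ℝ).map_smul _ _
    have h3 : η = ∫ s, f₀ s • η ∂(Measure.haar : Measure G) := by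
      rw [integral_smul_const, hf₀, one_smul]
    rw [h2]
    conv_lhs => rw [h3]
    rw [← integral_sub]
    · simp only [smul_sub]
    · exact (f₀.continuous.smul (by fun_prop)).integrable_of_hasCompactSupport
        f₀.hasCompactSupport.smul_right
    · exact (f₀.continuous.smul (by fun_prop)).integrable_of_hasCompactSupport
        f₀.hasCompactSupport.smul_right
  rw [h1]
  refine (norm_integral_le_integral_norm _).trans ?_
  have h4 : ∀ s, ‖f₀ s • (ρ.π (t * s) ξ - η)‖ = f₀ (t⁻¹ * (t * s)) * ‖ρ.π (t * s) ξ - η‖ := by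
    intro s
    rw [norm_smul, Real.norm_of_nonneg (h₀ s), inv_mul_cancel_left]
  simp only [h4]
  rw [integral_mul_left_eq_self (fun s => f₀ (t⁻¹ * s) * ‖ρ.π s ξ - η‖) t, ← integral_const_mul]
  refine integral_mono ?_ ((integrable_mul_of_continuous f (by fun_prop)).const_mul C) fun s => ?_
  · have h5 := f₀.continuous
    refine Continuous.integrable_of_hasCompactSupport (by fun_prop) (HasCompactSupport.mul_right ?_)
    exact f₀.hasCompactSupport.comp_homeomorph (Homeomorph.mulLeft t⁻¹)
  · simp only
    rw [← mul_assoc]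
    exact mul_le_mul_of_nonneg_right (hC s) (norm_nonneg _)

open scoped Pointwise in
theorem exists_dominating [T2Space G] {Q : Set G} (hQ : IsCompact Q) :
    ∃ (f₀ f : C_c(G, ℝ)) (C : ℝ), 0 < C ∧ (∀ s, 0 ≤ f₀ s) ∧ (∀ s, 0 ≤ f s) ∧
      ∫ s, f₀ s ∂(Measure.haar : Measure G) = 1 ∧ ∫ s, f s ∂(Measure.haar : Measure G) = 1 ∧
      ∀ t ∈ insert 1 Q, ∀ s, f₀ (t⁻¹ * s) ≤ C * f s := by
  obtain ⟨g, hgc, hg0, hg1⟩ := exists_continuous_nonneg_pos (1 : G)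
  have hgi : 0 < ∫ s, g s ∂(Measure.haar : Measure G) :=
    g.continuous.integral_pos_of_hasCompactSupport_nonneg_nonzero hgc hg0 hg1
  have hK : IsCompact (insert 1 Q * tsupport g) := (hQ.insert 1).mul hgc.isCompact
  obtain ⟨k, hk1, hkc, -, hk⟩ := exists_continuousMap_one_of_isCompact_subset_isOpen hK
    isOpen_univ (Set.subset_univ _)
  have hki : 0 < ∫ s, k s ∂(Measure.haar : Measure G) := by
    refine k.continuous.integral_pos_of_hasCompactSupport_nonneg_nonzero hkc
      (fun s => (hk s).1) (x := 1) ?_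
    rw [hk1 ⟨1, Set.mem_insert _ _, 1, subset_tsupport _ hg1, by simp⟩]
    simp
  obtain ⟨M, hM⟩ := hgc.exists_bound_of_continuous g.continuous
  set a := ∫ s, g s ∂(Measure.haar : Measure G)
  set c := ∫ s, k s ∂(Measure.haar : Measure G)
  have hM0 : 0 < M := lt_of_lt_of_le (norm_pos_iff.2 hg1) (hM 1)
  -- Every translate of `f₀ = g / a` in question is at most `M / a`, and `f = k / c` equals `1 / c`
  -- on their supports; hence the constant `M c / a`.
  refine ⟨⟨⟨fun s => a⁻¹ * g s, by fun_prop⟩, hgc.mul_left⟩,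
    ⟨⟨fun s => c⁻¹ * k s, by fun_prop⟩, HasCompactSupport.mul_left hkc⟩, a⁻¹ * M * c,
    by positivity, fun s => mul_nonneg (by positivity) (hg0 s),
    fun s => mul_nonneg (by positivity) (hk s).1, ?_, ?_, ?_⟩
  · exact (integral_const_mul _ _).trans (inv_mul_cancel₀ hgi.ne')
  · exact (integral_const_mul _ _).trans (inv_mul_cancel₀ hki.ne')
  · intro t ht s
    change a⁻¹ * g (t⁻¹ * s) ≤ a⁻¹ * M * c * (c⁻¹ * k s)
    rw [show a⁻¹ * M * c * (c⁻¹ * k s) = a⁻¹ * (M * k s) by field_simp]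
    refine mul_le_mul_of_nonneg_left ?_ (by positivity)
    by_cases h : g (t⁻¹ * s) = 0
    · rw [h]
      exact mul_nonneg hM0.le (hk s).1
    · rw [hk1 ⟨t, ht, t⁻¹ * s, subset_tsupport _ h, by simp⟩]
      simpa using (le_abs_self _).trans (hM (t⁻¹ * s))

/-- Property (T) yields a uniform spectral gap for the operator of some probability density. -/
theorem exists_spectral_gap [T2Space G] (hT : HasPropertyT G) :
    ∃ (f : C_c(G, ℂ)) (r : ℝ), 0 ≤ r ∧ r < 1 ∧ ∫ s, f s ∂(Measure.haar : Measure G) = 1 ∧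
      ∀ ρ : UnitaryRep G, ‖ρ.integrate f‖ ≤ 1 ∧
        ∀ ξ ∈ (ρ.fixed ⊤)ᗮ, ‖ρ.integrate f ξ‖ ≤ r * ‖ξ‖ := by
  obtain ⟨Q, hQ, ε, hε, hρ⟩ := hT
  obtain ⟨f₀, f, C, hC, h₀, hf, hi₀, hi, hdom⟩ := exists_dominating hQ
  -- If `‖ξ‖ = 1` and `‖π(f)ξ‖ > 1 - δ`, the variance is at most `2δ ≤ κ² / C²`, and `π(f₀)ξ` is
  -- moved by at most `2κ ≤ ε / 4` on `Q`. Its norm is at least `(1 - δ) - κ ≥ 5 / 8`, contradicting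
  -- (T).
  set κ : ℝ := min ε 1 / 8 with hκ
  have hκ0 : 0 < κ := by positivity
  have hκε : κ ≤ ε / 8 := by rw [hκ]; gcongr; exact min_le_left _ _
  have hκ1 : κ ≤ 1 / 8 := by rw [hκ]; gcongr; exact min_le_right _ _
  set δ : ℝ := min (1 / 4) (κ ^ 2 / (2 * C ^ 2)) with hδ
  have hδ0 : 0 < δ := by positivity
  have hδ4 : δ ≤ 1 / 4 := min_le_left _ _
  have hδC : δ ≤ κ ^ 2 / (2 * C ^ 2) := min_le_right _ _
  refine ⟨ofRealCc f, 1 - δ, by linarith, by linarith, by rw [integral_ofRealCc, hi]; simp,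
    fun ρ => ⟨?_, ?_⟩⟩
  · refine (ρ.norm_integrate_le _).trans (le_of_eq ?_)
    rw [← hi]
    congr 1
    ext s
    change ‖(f s : ℂ)‖ = f s
    rw [Complex.norm_real, Real.norm_of_nonneg (hf s)]
  have key : ∀ ξ ∈ (ρ.fixed ⊤)ᗮ, ‖ξ‖ = 1 → ‖ρ.integrate (ofRealCc f) ξ‖ ≤ 1 - δ := by
    intro ξ hξ hn
    by_contra! hlt
    set η := ρ.integrate (ofRealCc f) ξ with hη
    set η₀ := ρ.integrate (ofRealCc f₀) ξ with hη₀
    have hvar := ρ.integral_mul_norm_sub_sq hi ξ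
    rw [← hη, hn] at hvar
    have hD : 1 ^ 2 - ‖η‖ ^ 2 ≤ κ ^ 2 / C ^ 2 := by
      have : κ ^ 2 / (2 * C ^ 2) = κ ^ 2 / C ^ 2 / 2 := by field_simp
      nlinarith
    have hc := ρ.continuous_apply ξ
    have hL1 : ∫ s, f s * ‖ρ.π s ξ - η‖ ∂(Measure.haar : Measure G) ≤ κ / C := by
      -- The weights in this arithmetic–geometric inequality are chosen so that each term integrates
      -- to at most `κ / (2C)`.
      have h1 : ∀ s, f s * ‖ρ.π s ξ - η‖ ≤
          C / (2 * κ) * (f s * ‖ρ.π s ξ - η‖ ^ 2) + κ / (2 * C) * f s := by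
        intro s
        have h2 : ‖ρ.π s ξ - η‖ ≤ C / (2 * κ) * ‖ρ.π s ξ - η‖ ^ 2 + κ / (2 * C) := by
          have h3 : C / (2 * κ) * ‖ρ.π s ξ - η‖ ^ 2 + κ / (2 * C) - ‖ρ.π s ξ - η‖ =
              (C * ‖ρ.π s ξ - η‖ - κ) ^ 2 / (2 * κ * C) := by field_simp; ring
          have h4 : 0 ≤ (C * ‖ρ.π s ξ - η‖ - κ) ^ 2 / (2 * κ * C) := by positivity
          linarith
        have := mul_le_mul_of_nonneg_left h2 (hf s)
        linarith
      have hi2 : Integrable (fun s => C / (2 * κ) * (f s * ‖ρ.π s ξ - η‖ ^ 2))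
          (Measure.haar : Measure G) :=
        (integrable_mul_of_continuous f (by fun_prop)).const_mul _
      have hi3 : Integrable (fun s => κ / (2 * C) * f s) (Measure.haar : Measure G) :=
        (f.continuous.integrable_of_hasCompactSupport f.hasCompactSupport).const_mul _
      have h5 := integral_mono (integrable_mul_of_continuous f (by fun_prop)) (hi2.add hi3) h1
      refine h5.trans ?_
      simp only [Pi.add_apply]
      rw [integral_add hi2 hi3, integral_const_mul, integral_const_mul, hvar, hi]
      have h6 : C / (2 * κ) * (1 ^ 2 - ‖η‖ ^ 2) ≤ C / (2 * κ) * (κ ^ 2 / C ^ 2) := by gcongr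
      have h7 : C / (2 * κ) * (κ ^ 2 / C ^ 2) + κ / (2 * C) * 1 = κ / C := by field_simp; ring
      linarith
    have hclose : ∀ t ∈ insert 1 Q, ‖ρ.π t η₀ - η‖ ≤ κ := by
      intro t ht
      refine (ρ.norm_π_integrate_sub_le h₀ hi₀ (hdom t ht) ξ η).trans ?_
      calc _ ≤ C * (κ / C) := by gcongr
        _ = κ := by field_simp
    have h1 : ‖η₀ - η‖ ≤ κ := by simpa using hclose 1 (Set.mem_insert _ _)
    have hn₀ : 5 / 8 ≤ ‖η₀‖ := by
      have : ‖η‖ ≤ ‖η₀‖ + ‖η₀ - η‖ := by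
        have := norm_sub_le η₀ (η₀ - η)
        simpa using this
      linarith
    obtain ⟨t, ht, hle⟩ := ρ.exists_le_norm_π_sub hρ
      (ρ.integrate_mem_orthogonal (by rw [integral_ofRealCc, hi₀]; simp) hξ)
      (ξ := η₀) (norm_pos_iff.1 (by linarith))
    have h2 : ‖ρ.π t η₀ - η₀‖ ≤ κ + κ := by
      have := norm_sub_le (ρ.π t η₀ - η) (η₀ - η)
      rw [sub_sub_sub_cancel_right] at this
      linarith [hclose t (Set.mem_insert_of_mem _ ht)]
    nlinarith
  intro ξ hξ
  rcases eq_or_ne ξ 0 with rfl | h0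
  · simp
  have hn : ‖ξ‖ ≠ 0 := norm_ne_zero_iff.2 h0
  have h1 := key (((‖ξ‖ : ℂ)⁻¹) • ξ) (Submodule.smul_mem _ _ hξ) (by
    rw [norm_smul, norm_inv, Complex.norm_real, norm_norm, inv_mul_cancel₀ hn])
  rw [map_smul, norm_smul, norm_inv, Complex.norm_real, norm_norm, inv_mul_le_iff₀ (by positivity)]
    at h1
  linarith

/-- The Kazhdan projection: an element of `C*(G)` that acts in every representation as the
orthogonal projection onto the invariant vectors. -/
theorem exists_kazhdan_projection [T2Space G] (hT : HasPropertyT G) :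
    ∃ p : GroupCStar G, ∀ (ρ : UnitaryRep G) (ξ : ρ.H), ρ.extend p ξ ∈ ρ.fixed ⊤ ∧
      ∀ ζ ∈ ρ.fixed ⊤, inner ℂ ζ (ρ.extend p ξ) = inner ℂ ζ ξ := by
  obtain ⟨f, r, hr0, hr1, hf, hgap⟩ := exists_spectral_gap hT
  -- `F n` is the `(n + 1)`-fold convolution power of `f`; the zeroth power is unavailable, since
  -- `C_c(G)` need not contain a unit for convolution.
  let F : ℕ → C_c(G, ℂ) := fun n => Nat.rec f (fun _ g => conv f g) n
  have hF : ∀ (ρ : UnitaryRep G) n (ξ : ρ.H), ρ.integrate (F n) ξ =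
      ((ρ.integrate f) ^ (n + 1)) ξ := by
    intro ρ n
    induction n with
    | zero => intro ξ; simp [F]
    | succ n ih =>
      intro ξ
      rw [pow_succ', mul_apply_eq_comp, ← ih]
      exact ρ.integrate_conv f (F n) ξ
  have hpow : ∀ (ρ : UnitaryRep G) n, ∀ ξ ∈ (ρ.fixed ⊤)ᗮ,
      ‖((ρ.integrate f) ^ n) ξ‖ ≤ r ^ n * ‖ξ‖ := by
    intro ρ n
    induction n with
    | zero => intro ξ _; simp
    | succ n ih =>
      intro ξ hξ
      rw [pow_succ, mul_apply_eq_comp]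
      refine (ih _ (ρ.integrate_mem_orthogonal hf hξ)).trans ?_
      rw [pow_succ, mul_assoc]
      gcongr
      exact (hgap ρ).2 ξ hξ
  have hsub : ∀ (ρ : UnitaryRep G) (ξ : ρ.H), ρ.integrate f ξ - ξ ∈ (ρ.fixed ⊤)ᗮ :=
    fun ρ ξ ζ hζ => by rw [inner_sub_right, ρ.inner_integrate_of_mem_fixed hf hζ, sub_self]
  let z : ℕ → GroupCStar G := fun n => (((PreGroupCStar.toCc G).symm (F n) : PreGroupCStar G))
  have hz : ∀ (ρ : UnitaryRep G) n, ρ.extend (z n) = (ρ.integrate f) ^ (n + 1) := by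
    intro ρ n
    ext ξ
    rw [← hF, ρ.extend_coe, LinearEquiv.apply_symm_apply]
  -- Since `π(f)ξ - ξ` is orthogonal to the invariant vectors, successive powers differ by `O(r^n)`,
  -- uniformly in the representation. Uniformity gives convergence in `C*(G)` itself.
  have hc : CauchySeq z := by
    refine cauchySeq_of_le_geometric r 2 hr1 fun n => ?_
    rw [dist_comm, dist_eq_norm]
    refine GroupCStar.norm_le fun ρ => ?_
    rw [map_sub, hz ρ (n + 1), hz ρ n]
    refine ContinuousLinearMap.opNorm_le_bound _ (by positivity) fun ξ => ?_
    have h1 : ((ρ.integrate f) ^ (n + 1 + 1) - (ρ.integrate f) ^ (n + 1)) ξ =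
        ((ρ.integrate f) ^ (n + 1)) (ρ.integrate f ξ - ξ) := by
      rw [pow_succ _ (n + 1), sub_apply, mul_apply_eq_comp, map_sub]
    rw [h1]
    refine (hpow ρ (n + 1) _ (hsub ρ ξ)).trans ?_
    have h2 : ‖ρ.integrate f ξ - ξ‖ ≤ 2 * ‖ξ‖ := by
      refine (norm_sub_le _ _).trans ?_
      have := ContinuousLinearMap.le_of_opNorm_le _ (hgap ρ).1 ξ
      linarith
    calc r ^ (n + 1) * ‖ρ.integrate f ξ - ξ‖ ≤ r ^ n * (2 * ‖ξ‖) := by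
          gcongr ?_ * ?_
          exact pow_le_pow_of_le_one hr0 hr1.le (Nat.le_succ n)
      _ = 2 * r ^ n * ‖ξ‖ := by ring
  obtain ⟨p, hp⟩ := cauchySeq_tendsto_of_complete hc
  refine ⟨p, fun ρ ξ => ?_⟩
  have hlim : Filter.Tendsto (fun n => ((ρ.integrate f) ^ (n + 1)) ξ) Filter.atTop
      (nhds (ρ.extend p ξ)) := by
    have h1 : Filter.Tendsto (fun n => ρ.extend (z n) ξ) Filter.atTop (nhds (ρ.extend p ξ)) :=
      (((ContinuousLinearMap.apply ℂ ρ.H ξ).comp ρ.extend).continuous.tendsto p).comp hp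
    simpa only [hz] using h1
  have hinner : ∀ ζ ∈ ρ.fixed ⊤, inner ℂ ζ (ρ.extend p ξ) = inner ℂ ζ ξ := by
    intro ζ hζ
    have h1 : Filter.Tendsto (fun n => inner ℂ ζ (((ρ.integrate f) ^ (n + 1)) ξ)) Filter.atTop
        (nhds (inner ℂ ζ (ρ.extend p ξ))) := tendsto_const_nhds.inner hlim
    have h2 : ∀ n, inner ℂ ζ (((ρ.integrate f) ^ n) ξ) = inner ℂ ζ ξ := by
      intro n
      induction n with
      | zero => simp
      | succ n ih =>
        rw [pow_succ', mul_apply_eq_comp, ρ.inner_integrate_of_mem_fixed hf hζ, ih]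
    simp only [h2] at h1
    exact (tendsto_nhds_unique h1 tendsto_const_nhds)
  refine ⟨?_, hinner⟩
  have hfix : ρ.integrate f (ρ.extend p ξ) = ρ.extend p ξ := by
    have h1 : Filter.Tendsto (fun n => ((ρ.integrate f) ^ (n + 1 + 1)) ξ) Filter.atTop
        (nhds (ρ.integrate f (ρ.extend p ξ))) := by
      have := ((ρ.integrate f).continuous.tendsto _).comp hlim
      refine this.congr fun n => ?_
      rw [pow_succ' _ (n + 1)]
      rfl
    exact tendsto_nhds_unique h1 (hlim.comp (Filter.tendsto_add_atTop_nat 1))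
  -- The limit is fixed by `π(f)`, hence so is its component `w` orthogonal to the invariant
  -- vectors; the gap `r < 1` then forces `w = 0`.
  obtain ⟨v, hv, w, hw, hvw⟩ := (ρ.fixed ⊤).exists_add_mem_mem_orthogonal (ρ.extend p ξ)
  have hw0 : w = 0 := by
    rw [hvw, map_add, ρ.integrate_of_mem_fixed hf hv, add_right_inj] at hfix
    have h1 := (hgap ρ).2 w hw
    rw [hfix] at h1
    by_contra h0
    have := norm_pos_iff.2 h0
    nlinarith
  rw [hvw, hw0, add_zero]
  exact hv

end UnitaryRep

namespace UnitaryRep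

/-! ### Invariant vectors in tensor products -/

variable {G : Type u} [Group G] [TopologicalSpace G] (ρ σ : UnitaryRep G)

/-- The conjugate-linear slice map `η ↦ (η^* ⊗ 1)ζ` of a vector `ζ` of the tensor product. -/
def slice : (ρ.tensor σ).H →L[ℂ] ρ.H →SL[starRingEnd ℂ] σ.H :=
  ((ContinuousLinearMap.adjoint (𝕜 := ℂ) (E := σ.H)
    (F := (ρ.tensor σ).H)).toLinearIsometry.toContinuousLinearMap.comp (ρ.tmul σ)).flip

/-- The conjugate-linear slice map `y ↦ (1 ⊗ y^*)ζ` of a vector `ζ` of the tensor product. -/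
def slice' : (ρ.tensor σ).H →L[ℂ] σ.H →SL[starRingEnd ℂ] ρ.H :=
  ((ContinuousLinearMap.adjoint (𝕜 := ℂ) (E := ρ.H)
    (F := (ρ.tensor σ).H)).toLinearIsometry.toContinuousLinearMap.comp (ρ.tmul σ).flip).flip

theorem inner_slice (ζ : (ρ.tensor σ).H) (η : ρ.H) (y : σ.H) :
    inner ℂ y (ρ.slice σ ζ η) = inner ℂ (ρ.tmul σ η y) ζ :=
  ContinuousLinearMap.adjoint_inner_right (ρ.tmul σ η) y ζ

theorem inner_slice' (ζ : (ρ.tensor σ).H) (η : ρ.H) (y : σ.H) :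
    inner ℂ η (ρ.slice' σ ζ y) = inner ℂ (ρ.tmul σ η y) ζ :=
  ContinuousLinearMap.adjoint_inner_right ((ρ.tmul σ).flip y) η ζ

/-- Elementary tensors have slice maps of rank at most one. Compact operators form a norm-closed
subspace, and the slice map depends continuously on `ζ`. -/
theorem isCompactOperator_slice (ζ : (ρ.tensor σ).H) : IsCompactOperator (ρ.slice σ ζ) := by
  refine ρ.tensor_induction σ (p := fun ζ => IsCompactOperator (ρ.slice σ ζ)) ?_ ?_ ?_ ?_ ζ
  · exact (isClosed_setOfPred_isCompactOperator (σ₁₂ := starRingEnd ℂ) (M₁ := ρ.H)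
      (M₂ := σ.H)).preimage (ρ.slice σ).continuous
  · rw [map_zero]
    exact isCompactOperator_zero
  · intro x y
    have h : ∀ η, ρ.slice σ (ρ.tmul σ x y) η = inner ℂ η x • y := fun η =>
      ext_inner_left ℂ fun z => by rw [inner_slice, inner_tmul, inner_smul_right]
    refine ⟨(fun c : ℂ => c • y) '' Metric.closedBall 0 1,
      (isCompact_closedBall 0 1).image (by fun_prop), ?_⟩
    have hc : Continuous fun η : ρ.H => inner ℂ η x := continuous_id.inner continuous_const
    have : (fun η : ρ.H => inner ℂ η x) ⁻¹' Metric.ball (0 : ℂ) 1 ∈ nhds (0 : ρ.H) :=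
      hc.continuousAt.preimage_mem_nhds (by simpa using Metric.ball_mem_nhds (0 : ℂ) one_pos)
    filter_upwards [this] with η hη
    exact ⟨inner ℂ η x, Metric.ball_subset_closedBall hη, (h η).symm⟩
  · intro z w hz hw
    rw [map_add]
    exact hz.add hw

/-- The positive compact operator `S^* S`, for the slice map `S` of `ζ`. -/
def sliceSq (ζ : (ρ.tensor σ).H) : ρ.H →L[ℂ] ρ.H := (ρ.slice' σ ζ).comp (ρ.slice σ ζ)

theorem inner_sliceSq (ζ : (ρ.tensor σ).H) (η η' : ρ.H) :
    inner ℂ η' (ρ.sliceSq σ ζ η) = inner ℂ (ρ.slice σ ζ η) (ρ.slice σ ζ η') := by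
  rw [inner_slice, ← inner_slice']
  rfl

theorem isCompactOperator_sliceSq (ζ : (ρ.tensor σ).H) : IsCompactOperator (ρ.sliceSq σ ζ) :=
  (ρ.isCompactOperator_slice σ ζ).continuous_comp (ρ.slice' σ ζ).continuous

theorem isSymmetric_sliceSq (ζ : (ρ.tensor σ).H) :
    ((ρ.sliceSq σ ζ : ρ.H →L[ℂ] ρ.H) : ρ.H →ₗ[ℂ] ρ.H).IsSymmetric := fun η η' => by
  rw [← inner_conj_symm]
  change starRingEnd ℂ (inner ℂ η' (ρ.sliceSq σ ζ η)) = inner ℂ η (ρ.sliceSq σ ζ η')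
  rw [inner_sliceSq, inner_sliceSq, inner_conj_symm]

theorem slice_π {ζ : (ρ.tensor σ).H} (hζ : ζ ∈ (ρ.tensor σ).fixed ⊤) (s : G) (η : ρ.H) :
    ρ.slice σ ζ (ρ.π s η) = σ.π s (ρ.slice σ ζ η) := by
  refine ext_inner_left ℂ fun y => ?_
  have h1 : y = σ.π s (σ.π s⁻¹ y) := by rw [← π_mul_apply]; simp
  rw [inner_slice]
  conv_lhs => rw [h1, ← tensor_π_tmul, inner_π_left, hζ _ (Subgroup.mem_top _)]
  conv_rhs => rw [h1, (σ.π s).inner_map_map, inner_slice]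

theorem sliceSq_π {ζ : (ρ.tensor σ).H} (hζ : ζ ∈ (ρ.tensor σ).fixed ⊤) (s : G) (η : ρ.H) :
    ρ.sliceSq σ ζ (ρ.π s η) = ρ.π s (ρ.sliceSq σ ζ η) := by
  refine ext_inner_left ℂ fun η' => ?_
  have h1 : η' = ρ.π s (ρ.π s⁻¹ η') := by rw [← π_mul_apply]; simp
  rw [inner_sliceSq, slice_π _ _ hζ, inner_π_left, ← slice_π _ _ hζ, ← inner_sliceSq]
  conv_rhs => rw [h1, (ρ.π s).inner_map_map]

/-! ### Finite-dimensional subrepresentations -/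

section

variable {V : Submodule ℂ ρ.H} [FiniteDimensional ℂ V]

/-- The matrix of `π(s)` on a finite-dimensional subspace. -/
def subMatrix (V : Submodule ℂ ρ.H) [FiniteDimensional ℂ V] (s : G) :
    Matrix (Fin (Module.finrank ℂ V)) (Fin (Module.finrank ℂ V)) ℂ :=
  Matrix.of fun i j => inner ℂ (stdOrthonormalBasis ℂ V i : ρ.H)
    (ρ.π s (stdOrthonormalBasis ℂ V j : ρ.H))

theorem sum_inner_smul_basis (v : V) :
    ∑ k, inner ℂ (stdOrthonormalBasis ℂ V k : ρ.H) (v : ρ.H) •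
      (stdOrthonormalBasis ℂ V k : ρ.H) = v := by
  conv_rhs => rw [← (stdOrthonormalBasis ℂ V).sum_repr' v]
  simp

theorem subMatrix_one : ρ.subMatrix V 1 = 1 := by
  ext i j
  have := orthonormal_iff_ite.1 (stdOrthonormalBasis ℂ V).orthonormal i j
  simpa [subMatrix, Matrix.one_apply] using this

theorem subMatrix_mul (hV : ∀ s, ∀ v ∈ V, ρ.π s v ∈ V) (s t : G) :
    ρ.subMatrix V (s * t) = ρ.subMatrix V s * ρ.subMatrix V t := by
  ext i j
  have h := ρ.sum_inner_smul_basis (V := V) ⟨_, hV t _ (stdOrthonormalBasis ℂ V j).2⟩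
  simp only [subMatrix, Matrix.of_apply, Matrix.mul_apply, π_mul_apply]
  simp only at h
  conv_lhs => rw [← h]
  simp only [map_sum, map_smul, inner_sum, inner_smul_right]
  exact Finset.sum_congr rfl fun k _ => mul_comm _ _

theorem star_subMatrix (s : G) : star (ρ.subMatrix V s) = ρ.subMatrix V s⁻¹ := by
  ext i j
  simp only [subMatrix, Matrix.star_apply, Matrix.of_apply]
  rw [← inner_π_left]
  exact inner_conj_symm _ _

theorem subMatrix_mem_unitaryGroup (hV : ∀ s, ∀ v ∈ V, ρ.π s v ∈ V) (s : G) :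
    ρ.subMatrix V s ∈ Matrix.unitaryGroup (Fin (Module.finrank ℂ V)) ℂ := by
  rw [Matrix.mem_unitaryGroup_iff, star_subMatrix, ← ρ.subMatrix_mul hV, mul_inv_cancel,
    subMatrix_one]

/-- The continuous homomorphism into `U(n)` given by a finite-dimensional subrepresentation. -/
def subHom (hV : ∀ s, ∀ v ∈ V, ρ.π s v ∈ V) :
    G →ₜ* Matrix.unitaryGroup (Fin (Module.finrank ℂ V)) ℂ where
  toFun s := ⟨ρ.subMatrix V s, ρ.subMatrix_mem_unitaryGroup hV s⟩
  map_one' := Subtype.ext ρ.subMatrix_one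
  map_mul' s t := Subtype.ext (ρ.subMatrix_mul hV s t)
  continuous_toFun := Continuous.subtype_mk (continuous_matrix fun _ _ =>
    continuous_const.inner (ρ.continuous_apply _)) _

/-- In an orthonormal basis the subrepresentation on `V` is one of the coordinates of the product of
unitary groups, so the kernel acts on it by the identity matrix. -/
theorem le_fixed_ker (hV : ∀ s, ∀ v ∈ V, ρ.π s v ∈ V) : V ≤ ρ.fixed (toUnitaryProduct G).ker := by
  intro v hv s hs
  have h1 : ρ.subHom hV s = 1 := congrFun (MonoidHom.mem_ker.1 hs) ⟨_, ρ.subHom hV⟩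
  have h2 : ρ.subMatrix V s = 1 := congrArg Subtype.val h1
  have h3 : ∀ j, ρ.π s (stdOrthonormalBasis ℂ V j : ρ.H) = (stdOrthonormalBasis ℂ V j : ρ.H) := by
    intro j
    have h := ρ.sum_inner_smul_basis (V := V) ⟨_, hV s _ (stdOrthonormalBasis ℂ V j).2⟩
    have h4 : ∀ k, inner ℂ (stdOrthonormalBasis ℂ V k : ρ.H)
        (ρ.π s (stdOrthonormalBasis ℂ V j : ρ.H)) = if k = j then 1 else 0 := fun k =>
      (congrFun (congrFun h2 k) j).trans Matrix.one_apply
    simp only [h4, ite_smul, one_smul, zero_smul, Finset.sum_ite_eq', Finset.mem_univ,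
      if_true] at h
    exact h.symm
  have h5 := ρ.sum_inner_smul_basis (V := V) ⟨v, hv⟩
  simp only at h5
  rw [← h5, map_sum]
  simp only [map_smul, h3]

end

/-- Invariance of `ζ` makes `T = S*S` commute with `ρ`. Its eigenspaces for nonzero eigenvalues are
invariant and finite-dimensional, hence fixed by the Bohr kernel and orthogonal to `ξ`. The spectral
theorem gives `Tξ = 0`, so `‖Sξ‖² = ⟨Tξ, ξ⟩ = 0`. -/
theorem slice_eq_zero {ζ : (ρ.tensor σ).H} (hζ : ζ ∈ (ρ.tensor σ).fixed ⊤) {ξ : ρ.H}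
    (hξ : ξ ∈ (ρ.fixed (toUnitaryProduct G).ker)ᗮ) : ρ.slice σ ζ ξ = 0 := by
  set T := ρ.sliceSq σ ζ with hT
  have hsymm := ρ.isSymmetric_sliceSq σ ζ
  have hcomp := ρ.isCompactOperator_sliceSq σ ζ
  have h1 : T ξ ∈ (⨆ μ, Module.End.eigenspace (T : ρ.H →ₗ[ℂ] ρ.H) μ)ᗮ := by
    rw [Submodule.mem_orthogonal]
    intro v hv
    refine Submodule.iSup_induction _ (motive := fun v => inner ℂ v (T ξ) = 0) hv ?_ (by simp) ?_
    · intro μ v hv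
      rw [Module.End.mem_eigenspace_iff] at hv
      have h2 : inner ℂ v (T ξ) = inner ℂ (T v) ξ := (hsymm v ξ).symm
      have h3 : T v = μ • v := hv
      rw [h2, h3, inner_smul_left]
      -- The eigenspace of `0` may be infinite-dimensional, but there the factor `μ` already gives
      -- orthogonality to `T ξ`.
      rcases eq_or_ne μ 0 with rfl | hμ
      · simp
      have := ContinuousLinearMap.finite_dimensional_eigenspace hcomp μ hμ
      have h4 := ρ.le_fixed_ker (V := Module.End.eigenspace (T : ρ.H →ₗ[ℂ] ρ.H) μ) (by
        intro s w hw
        rw [Module.End.mem_eigenspace_iff] at hw ⊢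
        change T (ρ.π s w) = _
        have hw' : T w = μ • w := hw
        rw [hT, ρ.sliceSq_π σ hζ, ← hT, hw', map_smul])
      rw [hξ v (h4 (Module.End.mem_eigenspace_iff.2 hv)), mul_zero]
    · intro v w hv hw
      rw [inner_add_left, hv, hw, add_zero]
  rw [ContinuousLinearMap.orthogonalComplement_iSup_eigenspaces_eq_bot hcomp hsymm] at h1
  have h2 : T ξ = 0 := h1
  have h3 := ρ.inner_sliceSq σ ζ ξ ξ
  rw [← hT, h2, inner_zero_right] at h3
  exact inner_self_eq_zero.1 h3.symm

end UnitaryRep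

namespace UnitaryRep

/-! ### Invariant vectors and coefficients with compact support -/

section

variable {G : Type u} [Group G] [TopologicalSpace G] [IsTopologicalGroup G]

open scoped Pointwise in
theorem exists_orthogonal_translates [NoncompactSpace G] (ρ : UnitaryRep G) {w : ρ.H} {K : Set G}
    (hK : IsCompact K) (hw : ∀ s ∉ K, inner ℂ w (ρ.π s w) = 0) (n : ℕ) :
    ∃ S : Finset G, S.card = n ∧
      ∀ s ∈ S, ∀ t ∈ S, s ≠ t → inner ℂ (ρ.π s w) (ρ.π t w) = 0 := by
  classical
  induction n with
  | zero => exact ⟨∅, by simp⟩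
  | succ n ih =>
    obtain ⟨S, hS, horth⟩ := ih
    -- Adding `1` to `K` ensures that the new element lies outside `S`, so that the cardinality
    -- grows.
    have hc : IsCompact (⋃ s ∈ S, s • insert 1 K) :=
      S.isCompact_biUnion fun s _ => (hK.insert 1).smul s
    obtain ⟨g, hg⟩ := (Set.ne_univ_iff_exists_notMem _).1 hc.ne_univ
    simp only [Set.mem_iUnion, not_exists] at hg
    have hg1 : ∀ s ∈ S, s⁻¹ * g ∉ insert 1 K := fun s hs h =>
      hg s hs ⟨s⁻¹ * g, h, by simp⟩
    have hgS : g ∉ S := fun h => hg1 g h (by simp)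
    have hgo : ∀ s ∈ S, inner ℂ (ρ.π s w) (ρ.π g w) = 0 := fun s hs => by
      rw [inner_π_left, ← π_mul_apply]
      exact hw _ fun h => hg1 s hs (Set.mem_insert_of_mem _ h)
    refine ⟨insert g S, by rw [Finset.card_insert_of_notMem hgS, hS], ?_⟩
    intro s hs t ht hst
    rw [Finset.mem_insert] at hs ht
    rcases hs with rfl | hs <;> rcases ht with rfl | ht
    · exact absurd rfl hst
    · exact inner_eq_zero_symm.1 (hgo t ht)
    · exact hgo s hs
    · exact horth s hs t ht hst

/-- The sum `W` of `n` orthogonal translates of `w` has `‖W‖² = n‖w‖²`, whereas `⟨W, ζ⟩ = n⟨w, ζ⟩`.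
Cauchy–Schwarz gives `n |⟨w, ζ⟩|² ≤ ‖w‖² ‖ζ‖²` for all `n ≥ 1`. -/
theorem inner_eq_zero_of_mem_fixed [NoncompactSpace G] (ρ : UnitaryRep G) {w : ρ.H} {K : Set G}
    (hK : IsCompact K) (hw : ∀ s ∉ K, inner ℂ w (ρ.π s w) = 0) {ζ : ρ.H} (hζ : ζ ∈ ρ.fixed ⊤) :
    inner ℂ w ζ = 0 := by
  by_contra hne
  have hpos : 0 < ‖inner ℂ w ζ‖ ^ 2 := by
    have := norm_pos_iff.2 hne
    positivity
  obtain ⟨n, hn⟩ := exists_nat_gt (‖w‖ ^ 2 * ‖ζ‖ ^ 2 / ‖inner ℂ w ζ‖ ^ 2)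
  rw [div_lt_iff₀ hpos] at hn
  obtain ⟨S, hS, horth⟩ := ρ.exists_orthogonal_translates hK hw n
  set W := ∑ s ∈ S, ρ.π s w with hW
  have h1 : inner ℂ W ζ = n * inner ℂ w ζ := by
    have : ∀ s ∈ S, inner ℂ (ρ.π s w) ζ = inner ℂ w ζ := fun s _ => by
      rw [inner_π_left, hζ _ (Subgroup.mem_top _)]
    rw [hW, sum_inner, Finset.sum_congr rfl this, Finset.sum_const, hS, nsmul_eq_mul]
  have h2 : ‖W‖ ^ 2 = n * ‖w‖ ^ 2 := by
    have h3 : inner ℂ W W = (n : ℂ) * (‖w‖ : ℂ) ^ 2 := by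
      have : ∀ s ∈ S, inner ℂ (ρ.π s w) W = (‖w‖ : ℂ) ^ 2 := fun s hs => by
        rw [hW, inner_sum, Finset.sum_eq_single s (fun t ht hts => horth s hs t ht hts.symm)
          (fun h => absurd hs h), inner_self_eq_norm_sq_to_K, (ρ.π s).norm_map]
        rfl
      conv_lhs => rw [hW, sum_inner]
      rw [Finset.sum_congr rfl this, Finset.sum_const, hS, nsmul_eq_mul]
    rw [inner_self_eq_norm_sq_to_K] at h3
    have h4 : ((‖W‖ ^ 2 : ℝ) : ℂ) = ((n * ‖w‖ ^ 2 : ℝ) : ℂ) := by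
      push_cast
      exact h3
    exact Complex.ofReal_injective h4
  have h5 := pow_le_pow_left₀ (norm_nonneg _) (norm_inner_le_norm (𝕜 := ℂ) W ζ) 2
  rw [h1, norm_mul, mul_pow, mul_pow, h2, Complex.norm_natCast] at h5
  have hn0 : (0 : ℝ) < n := by
    have : 0 ≤ ‖w‖ ^ 2 * ‖ζ‖ ^ 2 := by positivity
    by_contra h
    have : (n : ℝ) * ‖inner ℂ w ζ‖ ^ 2 ≤ 0 := mul_nonpos_of_nonpos_of_nonneg (not_lt.1 h) hpos.le
    linarith
  nlinarith

/-! ### The quasi-regular representation of a finite quotient -/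

/-- The representation of `G` on `ℓ²(G/N)` for an open subgroup `N` of finite index. -/
def quasiRegular (N : Subgroup G) [Fintype (G ⧸ N)] (hN : IsOpen (N : Set G)) : UnitaryRep G :=
  ofIsometry (EuclideanSpace ℂ (G ⧸ N))
    (fun s => (LinearIsometryEquiv.piLpCongrLeft 2 ℂ ℂ
      (MulAction.toPerm s : Equiv.Perm (G ⧸ N))).toContinuousLinearEquiv.toContinuousLinearMap)
    (fun s ξ => LinearIsometryEquiv.norm_map _ ξ)
    (fun ξ => by
      ext x
      simp [LinearIsometryEquiv.piLpCongrLeft_apply, Equiv.piCongrLeft'])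
    (fun s t ξ => by
      ext x
      simp [LinearIsometryEquiv.piLpCongrLeft_apply, Equiv.piCongrLeft', mul_smul])
    (fun ξ => by
      refine (PiLp.continuous_toLp 2 _).comp (continuous_pi fun x => ?_)
      induction x using QuotientGroup.induction_on with
      | H g =>
        have : DiscreteTopology (G ⧸ N) := QuotientGroup.discreteTopology hN
        exact (continuous_of_discreteTopology (f := fun y : G ⧸ N => ξ y)).comp
          (QuotientGroup.continuous_mk.comp (continuous_inv.mul continuous_const)))

variable (N : Subgroup G) [Fintype (G ⧸ N)] (hN : IsOpen (N : Set G))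

/-- The identification of the space of the quasi-regular representation with `ℓ²(G/N)`. -/
def quasiRegularEquiv : (quasiRegular N hN).H ≃ₗᵢ[ℂ] EuclideanSpace ℂ (G ⧸ N) :=
  LinearIsometryEquiv.refl ℂ (EuclideanSpace ℂ (G ⧸ N))

theorem quasiRegularEquiv_π (s : G) (ξ : (quasiRegular N hN).H) (x : G ⧸ N) :
    quasiRegularEquiv N hN ((quasiRegular N hN).π s ξ) x =
      quasiRegularEquiv N hN ξ (s⁻¹ • x) := rfl

open Classical in
/-- The unit vector of the trivial coset. -/
def quasiRegularVec : (quasiRegular N hN).H :=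
  (quasiRegularEquiv N hN).symm (EuclideanSpace.single ((1 : G) : G ⧸ N) (1 : ℂ))

theorem inner_quasiRegularVec (v : (quasiRegular N hN).H) :
    inner ℂ (quasiRegularVec N hN) v = quasiRegularEquiv N hN v ((1 : G) : G ⧸ N) := by
  classical
  rw [← (quasiRegularEquiv N hN).inner_map_map, quasiRegularVec,
    LinearIsometryEquiv.apply_symm_apply, EuclideanSpace.inner_single_left]
  simp

open Classical in
theorem coeff_quasiRegularVec (s : G) :
    (quasiRegular N hN).coeff (quasiRegularVec N hN) (quasiRegularVec N hN) s =
      if s ∈ N then 1 else 0 := by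
  rw [coeff, inner_quasiRegularVec, quasiRegularEquiv_π, quasiRegularVec,
    LinearIsometryEquiv.apply_symm_apply, PiLp.single_apply, MulAction.Quotient.smul_coe]
  simp [QuotientGroup.eq]

/-- The indicator function of `N` times the index `[G : N]`, as an element of `B(G)`. -/
def indexIndicator : FourierStieltjes G :=
  (Fintype.card (G ⧸ N) : ℂ) • (quasiRegular N hN).coefficient (quasiRegularVec N hN)
    (quasiRegularVec N hN)

end

/-! ### The regular representation -/

section

variable (G : Type u) [Group G] [TopologicalSpace G] [IsTopologicalGroup G]
  [LocallyCompactSpace G] [MeasurableSpace G] [BorelSpace G]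

/-- The left regular representation. -/
def regular : UnitaryRep G :=
  ofIsometry (Lp ℂ 2 (Measure.haar : Measure G))
    (fun s => (LinearIsometry.mk
      { toFun := fun f => DomMulAct.mk s⁻¹ • f
        map_add' := fun f g => smul_add _ f g
        map_smul' := fun c f => smul_comm _ c f }
      (fun f => DomMulAct.norm_smul_Lp (DomMulAct.mk s⁻¹) f)).toContinuousLinearMap)
    (fun s f => DomMulAct.norm_smul_Lp (DomMulAct.mk s⁻¹) f)
    (fun f => by
      change DomMulAct.mk (1 : G)⁻¹ • f = f
      rw [inv_one, DomMulAct.mk_one, one_smul])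
    (fun s t f => by
      change DomMulAct.mk (s * t)⁻¹ • f = DomMulAct.mk s⁻¹ • DomMulAct.mk t⁻¹ • f
      rw [mul_inv_rev, DomMulAct.mk_mul, mul_smul])
    (fun f => by
      change Continuous fun s : G => DomMulAct.mk s⁻¹ • f
      have : Fact ((2 : ℝ≥0∞) ≠ ∞) := ⟨by simp⟩
      exact (DomMulAct.continuous_mk.comp continuous_inv).smul continuous_const)

variable {G}

/-- The indicator function of a set of finite measure in the regular representation. -/
def regularVec {A : Set G} (hA : MeasurableSet A) (hA' : (Measure.haar : Measure G) A ≠ ∞) :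
    (regular G).H :=
  (indicatorConstLp 2 hA hA' (1 : ℂ) : Lp ℂ 2 (Measure.haar : Measure G))

theorem coeff_regularVec {A B : Set G} (hA : MeasurableSet A)
    (hA' : (Measure.haar : Measure G) A ≠ ∞) (hB : MeasurableSet B)
    (hB' : (Measure.haar : Measure G) B ≠ ∞) (s : G) :
    (regular G).coeff (regularVec hA hA') (regularVec hB hB') s =
      ((Measure.haar : Measure G).real (B ∩ (s⁻¹ * ·) ⁻¹' A) : ℂ) :=
  L2.inner_indicatorConstLp_one_indicatorConstLp_one hB
    (hA.preimage (measurable_const_mul s⁻¹)) hB' (by rwa [measure_preimage_mul])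

open scoped Pointwise in
/-- There is a coefficient of the regular representation that is `1` on a given compact set, such
that the second vector has a diagonal coefficient with compact support. -/
theorem exists_coeff_regular_eq_one [T2Space G] {K : Set G} (hK : IsCompact K) :
    ∃ (ξ η : (regular G).H) (L : Set G), IsCompact L ∧ (∀ s ∈ K, (regular G).coeff ξ η s = 1) ∧
      ∀ s ∉ L, inner ℂ η ((regular G).π s η) = 0 := by
  obtain ⟨A, hA, hA1⟩ := exists_compact_mem_nhds (1 : G)
  have hAm := hA.measurableSet
  have hA' : (Measure.haar : Measure G) A ≠ ∞ := hA.measure_lt_top.ne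
  have hB : IsCompact (K * A) := hK.mul hA
  have hBm := hB.measurableSet
  have hB' : (Measure.haar : Measure G) (K * A) ≠ ∞ := hB.measure_lt_top.ne
  have hpos : 0 < (Measure.haar : Measure G).real A :=
    ENNReal.toReal_pos (Measure.measure_pos_of_mem_nhds _ hA1).ne' hA'
  -- For `s ∈ K` the translate `sA` lies in `KA`, so the normalised indicator of `A` pairs to `1`
  -- with that of `KA`. For `s` outside `(KA)(KA)⁻¹` the set `KA` misses its translate by `s`.
  refine ⟨(((Measure.haar : Measure G).real A : ℂ)⁻¹) • regularVec hAm hA', regularVec hBm hB',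
    (K * A) * (K * A)⁻¹, hB.mul hB.inv, fun s hs => ?_, fun s hs => ?_⟩
  · have h1 : (K * A) ∩ (s⁻¹ * ·) ⁻¹' A = (s⁻¹ * ·) ⁻¹' A :=
      Set.inter_eq_right.2 fun t ht => ⟨s, hs, s⁻¹ * t, ht, by simp⟩
    have h2 := coeff_regularVec hAm hA' hBm hB' s
    rw [h1, measureReal_def, measure_preimage_mul, ← measureReal_def] at h2
    unfold coeff at h2 ⊢
    rw [map_smul, inner_smul_right, h2]
    exact inv_mul_cancel₀ (by exact_mod_cast hpos.ne')
  · have h1 := coeff_regularVec hBm hB' hBm hB' s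
    unfold coeff at h1
    rw [h1]
    have h2 : (K * A) ∩ (s⁻¹ * ·) ⁻¹' (K * A) = ∅ := by
      rw [Set.eq_empty_iff_forall_notMem]
      rintro t ⟨ht, ht'⟩
      refine hs ⟨t, ht, (s⁻¹ * t)⁻¹, Set.inv_mem_inv.2 ht', ?_⟩
      simp
    rw [h2]
    simp

end

end UnitaryRep

/-! ### The kernel of the Bohr compactification -/

section

variable (G : Type u) [Group G] [TopologicalSpace G]

theorem finite_quotient_ker (hAP : Finite (AlmostPeriodicCompactification G)) :
    Finite (G ⧸ (toUnitaryProduct G).ker) := by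
  have : Finite (toUnitaryProduct G).range :=
    Finite.of_injective (Subgroup.inclusion (Subgroup.le_topologicalClosure _))
      (Subgroup.inclusion_injective _)
  exact Finite.of_equiv _ (QuotientGroup.quotientKerEquivRange (toUnitaryProduct G)).symm.toEquiv

theorem isClosed_ker : IsClosed ((toUnitaryProduct G).ker : Set G) := by
  have hc : Continuous (toUnitaryProduct G) :=
    continuous_pi fun p => p.2.continuous_toFun
  exact isClosed_singleton.preimage hc

/-- A closed subgroup of finite index is open. Openness makes the action on `ℓ²(G/N)` continuous,
and hence puts the indicator of the kernel in `B(G)`. -/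
theorem isOpen_ker [IsTopologicalGroup G] (hAP : Finite (AlmostPeriodicCompactification G)) :
    IsOpen ((toUnitaryProduct G).ker : Set G) := by
  have := finite_quotient_ker G hAP
  have : (toUnitaryProduct G).ker.FiniteIndex := Subgroup.finiteIndex_of_finite_quotient
  exact Subgroup.isOpen_of_isClosed_of_finiteIndex _ (isClosed_ker G)

end

/-! ### The character at infinity -/

namespace FourierStieltjes

theorem indexIndicator_mul_coefficient {G : Type u} [Group G] [TopologicalSpace G]
    [IsTopologicalGroup G] {N : Subgroup G} [Fintype (G ⧸ N)]
    (hN : IsOpen (N : Set G)) (ρ : UnitaryRep G) {ξ : ρ.H} (hξ : ξ ∈ ρ.fixed N) (η : ρ.H) :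
    UnitaryRep.indexIndicator N hN * ρ.coefficient ξ η =
      (inner ℂ η ξ : ℂ) • UnitaryRep.indexIndicator N hN := by
  classical
  refine toFun_injective (funext fun s => ?_)
  simp only [UnitaryRep.indexIndicator, map_mul, map_smul, UnitaryRep.toFun_coefficient,
    Pi.mul_apply, Pi.smul_apply, UnitaryRep.coeff_quasiRegularVec, smul_eq_mul]
  by_cases hs : s ∈ N
  · simp only [hs, if_true, UnitaryRep.coeff, hξ s hs]
    ring
  · simp [hs]

variable {G : Type u} [Group G] [TopologicalSpace G] [IsTopologicalGroup G]
  [LocallyCompactSpace G] [MeasurableSpace G] [BorelSpace G]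

/-- The projection sends the unit vector of the trivial coset to a constant function on `G/N`. Its
pairing with the all-ones vector `e` is unchanged, namely `1`, so the constant is `1 / [G : N]`,
which the index in `b` cancels. -/
theorem functional_indexIndicator {N : Subgroup G} [Fintype (G ⧸ N)] (hN : IsOpen (N : Set G))
    {p : GroupCStar G} (hp : ∀ (ρ : UnitaryRep G) (ξ : ρ.H), ρ.extend p ξ ∈ ρ.fixed ⊤ ∧
      ∀ ζ ∈ ρ.fixed ⊤, inner ℂ ζ (ρ.extend p ξ) = inner ℂ ζ ξ) :
    functional (UnitaryRep.indexIndicator N hN) p = 1 := by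
  classical
  let σ := UnitaryRep.quasiRegular N hN
  let δ := UnitaryRep.quasiRegularVec N hN
  let E := UnitaryRep.quasiRegularEquiv N hN
  let v := σ.extend p δ
  let e : σ.H := E.symm (WithLp.toLp 2 fun _ => 1)
  have hEe : ∀ x, E e x = 1 := fun x => by simp [e]
  have he : e ∈ σ.fixed ⊤ := fun s _ => by
    apply E.injective
    ext x
    rw [hEe]
    exact (UnitaryRep.quasiRegularEquiv_π N hN s e x).trans (hEe _)
  have hv : ∀ x, E v x = E v ((1 : G) : G ⧸ N) := by
    intro x
    induction x using QuotientGroup.induction_on with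
    | H g =>
      have h1 : σ.π g v = v := (hp σ δ).1 g (Subgroup.mem_top g)
      have h2 : E (σ.π g v) (g : G ⧸ N) = E v (g⁻¹ • (g : G ⧸ N)) :=
        UnitaryRep.quasiRegularEquiv_π N hN g v (g : G ⧸ N)
      rw [h1, MulAction.Quotient.smul_coe] at h2
      simpa using h2
  have h1 : inner ℂ e v = 1 := by
    rw [(hp σ δ).2 e he, ← inner_conj_symm, UnitaryRep.inner_quasiRegularVec N hN e, hEe, map_one]
  have h2 : inner ℂ e v = (Fintype.card (G ⧸ N) : ℂ) * E v ((1 : G) : G ⧸ N) := by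
    rw [← E.inner_map_map, PiLp.inner_apply]
    simp only [hEe, hv]
    simp
  rw [UnitaryRep.indexIndicator, functional_smul, functional_coefficient, ← h1, h2,
    UnitaryRep.inner_quasiRegularVec]

/-- The invariant component `ζ` of `ξ ⊗ x` satisfies `⟨ζ, ζ⟩ = ⟨ζ, ξ ⊗ x⟩`, which is a value of the
slice of `ζ` at `ξ` up to conjugation. That slice vanishes, so `ζ = 0`. -/
theorem functional_coefficient_mul_eq_zero {p : GroupCStar G}
    (hp : ∀ (ρ : UnitaryRep G) (ξ : ρ.H), ρ.extend p ξ ∈ ρ.fixed ⊤ ∧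
      ∀ ζ ∈ ρ.fixed ⊤, inner ℂ ζ (ρ.extend p ξ) = inner ℂ ζ ξ) (ρ : UnitaryRep G) {ξ : ρ.H}
    (hξ : ξ ∈ (ρ.fixed (toUnitaryProduct G).ker)ᗮ) (η : ρ.H) (u : FourierStieltjes G) :
    functional (ρ.coefficient ξ η * u) p = 0 := by
  obtain ⟨σ, x, y, rfl⟩ := exists_coefficient u
  rw [coefficient_mul_coefficient, functional_coefficient]
  set ζ := (ρ.tensor σ).extend p (ρ.tmul σ ξ x) with hζ
  obtain ⟨h1, h2⟩ := hp (ρ.tensor σ) (ρ.tmul σ ξ x)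
  have h3 : inner ℂ ζ ζ = 0 := by
    conv_lhs => rw [hζ, h2 _ h1]
    rw [← inner_conj_symm, ← UnitaryRep.inner_slice, ρ.slice_eq_zero σ h1 hξ]
    simp
  rw [inner_self_eq_zero.1 h3, inner_zero_right]

/-- A weak*-continuous character of `B(G)`, represented by an element of `C*(G)`, that vanishes on
functions in `B(G)` that are `1` on arbitrarily large compact sets. -/
theorem exists_character_at_infinity [T2Space G] [NoncompactSpace G] (hT : HasPropertyT G)
    (hAP : Finite (AlmostPeriodicCompactification G)) :
    ∃ p : GroupCStar G, functional 1 p = 1 ∧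
      (∀ u : FourierStieltjes G, mulOp u p = functional u p • p) ∧
      ∀ K : Set G, IsCompact K → ∃ u : FourierStieltjes G,
        (∀ s ∈ K, toFun u s = 1) ∧ functional u p = 0 := by
  obtain ⟨q, hq⟩ := UnitaryRep.exists_kazhdan_projection hT
  set N := (toUnitaryProduct G).ker with hNdef
  have hN : IsOpen (N : Set G) := isOpen_ker G hAP
  have := finite_quotient_ker G hAP
  let _ : Fintype (G ⧸ N) := Fintype.ofFinite _
  set b := UnitaryRep.indexIndicator N hN with hb
  have hb1 : functional b q = 1 := functional_indexIndicator hN hq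
  have hmul : ∀ u v : FourierStieltjes G,
      functional (b * (u * v)) q = functional (b * u) q * functional (b * v) q := by
    intro u v
    obtain ⟨ρ, ξ, η, rfl⟩ := exists_coefficient u
    -- On `N` the `ξ₀`-coefficient is the constant `⟨ξ₀, η⟩`, and products with the `ξ₁`-coefficient
    -- are annihilated by `q`. Multiplicativity reduces to pulling out a scalar.
    obtain ⟨ξ₀, h₀, ξ₁, h₁, rfl⟩ := (ρ.fixed N).exists_add_mem_mem_orthogonal ξ
    have hadd : ρ.coefficient (ξ₀ + ξ₁) η = ρ.coefficient ξ₀ η + ρ.coefficient ξ₁ η :=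
      toFun_injective (funext fun s => by
        simp [UnitaryRep.toFun_coefficient, UnitaryRep.coeff])
    have hz : ∀ w : FourierStieltjes G, functional (b * (ρ.coefficient ξ₁ η * w)) q = 0 :=
      fun w => by
        rw [mul_left_comm]
        exact functional_coefficient_mul_eq_zero hq ρ h₁ η _
    have hz1 : functional (b * ρ.coefficient ξ₁ η) q = 0 := by simpa using hz 1
    rw [hadd, add_mul, mul_add, mul_add, functional_add, functional_add, hz, hz1, ← mul_assoc,
      indexIndicator_mul_coefficient hN ρ h₀, smul_mul_assoc, functional_smul, functional_smul,
      ← hb, hb1]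
    ring
  refine ⟨mulOp b q, ?_, ?_, ?_⟩
  · rw [functional_mulOp, mul_one, hb1]
  · intro u
    refine ext_functional fun v => ?_
    rw [map_smul, functional_mulOp, functional_mulOp, functional_mulOp, functional_mulOp, hmul,
      smul_eq_mul]
  · intro K hK
    obtain ⟨ξ, η, L, hL, hK1, hη⟩ := UnitaryRep.exists_coeff_regular_eq_one hK
    refine ⟨(UnitaryRep.regular G).coefficient ξ η, hK1, ?_⟩
    rw [functional_mulOp, hb, UnitaryRep.indexIndicator, smul_mul_assoc, functional_smul,
      coefficient_mul_coefficient, functional_coefficient]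
    -- Tensoring with the quasi-regular vector keeps the diagonal coefficient zero off `L`, so the
    -- result is orthogonal to all invariant vectors.
    rw [UnitaryRep.inner_eq_zero_of_mem_fixed _ hL _ (hq _ _).1, mul_zero]
    intro s hs
    rw [UnitaryRep.tensor_π_tmul, UnitaryRep.inner_tmul, hη s hs, mul_zero]

end FourierStieltjes

/-! ### Completely bounded actions on dual operator spaces -/

/-- An action on a dual operator space is completely bounded if its predual action is. -/
theorem isJointlyCompletelyBounded_of_predual {A F : Type*} [AddCommGroup A] [Module ℂ A]
    [MatrixNorms A] [NormedAddCommGroup F] [NormedSpace ℂ F] [OperatorSpace F]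
    (hF : ∀ {ι : Type} [Fintype ι] [DecidableEq ι] (x : Matrix ι ι F), MatrixNorms.matNorm x ≠ ∞)
    (T : A →ₗ[ℂ] StrongDual ℂ F →ₗ[ℂ] StrongDual ℂ F) (S : A → F →L[ℂ] F)
    (hTS : ∀ a φ, T a φ = φ.comp (S a)) (C : ℝ≥0)
    (hC : ∀ (n r : ℕ) (a : Matrix (Fin n) (Fin n) A) (x : Matrix (Fin r) (Fin r) F),
      MatrixNorms.matNorm x ≤ 1 → MatrixNorms.matNorm
        (Matrix.of fun p q : Fin n × Fin r => S (a p.1 q.1) (x p.2 q.2)) ≤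
          C * MatrixNorms.matNorm a) :
    IsJointlyCompletelyBounded T := by
  refine ⟨C, fun n m a φ => iSup_le fun r => iSup₂_le fun x hx => ?_⟩
  let X : Matrix (Fin n × Fin r) (Fin n × Fin r) F :=
    Matrix.of fun p q => S (a p.1 q.1) (x p.2 q.2)
  -- Pairing `T a φ` with `x` is pairing `φ` with `S a x`, up to this shuffle of the indices.
  let e : (Fin n × Fin m) × Fin r ≃ Fin m × (Fin n × Fin r) :=
    ((Equiv.prodComm _ _).prodCongr (Equiv.refl _)).trans (Equiv.prodAssoc _ _ _)
  have h1 : (Matrix.of fun p q : (Fin n × Fin m) × Fin r =>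
      (Matrix.of fun p q : Fin n × Fin m => T (a p.1 q.1) (φ p.2 q.2)) p.1 q.1 (x p.2 q.2)) =
      (Matrix.of fun p q : Fin m × (Fin n × Fin r) => φ p.1 q.1 (X p.2 q.2)).submatrix e e := by
    ext p q
    simp [X, e, hTS]
  rw [h1]
  calc _ ≤ ‖Matrix.of fun p q : Fin m × (Fin n × Fin r) => φ p.1 q.1 (X p.2 q.2)‖ₑ := by
        rw [enorm_le_iff_norm_le]
        exact Matrix.l2_opNorm_submatrix_le _ e
    _ ≤ MatrixNorms.matNorm φ * MatrixNorms.matNorm X :=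
        OperatorSpace.enorm_pairing_le φ X (hF X)
    _ ≤ MatrixNorms.matNorm φ * (C * MatrixNorms.matNorm a) := by
        gcongr
        exact hC n r a x hx
    _ = C * MatrixNorms.matNorm a * MatrixNorms.matNorm φ := by ring

namespace FourierStieltjes

variable {G : Type u} [Group G] [TopologicalSpace G] [IsTopologicalGroup G]
  [LocallyCompactSpace G] [MeasurableSpace G] [BorelSpace G]

theorem matNorm_smul_const_le {ι : Type} [Fintype ι] [DecidableEq ι] (c : Matrix ι ι ℂ)
    (p : GroupCStar G) :
    MatrixNorms.matNorm (Matrix.of fun i j => c i j • p) ≤ ‖c‖ₑ * ‖p‖ₑ := by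
  have h := GroupCStar.matNorm_kronecker_le c (Matrix.of fun _ _ : Fin 1 => p)
  rw [OperatorSpace.matNorm_single] at h
  exact (OperatorSpace.matNorm_submatrix_le (Matrix.of fun i j : ι × Fin 1 =>
    c i.1 j.1 • (Matrix.of fun _ _ : Fin 1 => p) i.2 j.2)
    (Equiv.prodUnique ι (Fin 1)).symm).trans h

theorem enorm_functional_le {ι κ : Type} [Fintype ι] [DecidableEq ι] [Fintype κ] [DecidableEq κ]
    (u : Matrix ι ι (FourierStieltjes G)) (x : Matrix κ κ (GroupCStar G)) :
    ‖(Matrix.of fun i j : ι × κ => functional (u i.1 j.1) (x i.2 j.2))‖ₑ ≤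
      MatrixNorms.matNorm u * MatrixNorms.matNorm x :=
  OperatorSpace.enorm_pairing_le (u.map toDual) x (GroupCStar.matNorm_ne_top x)

theorem enorm_functional_const_le {ι : Type} [Fintype ι] [DecidableEq ι]
    (u : Matrix ι ι (FourierStieltjes G)) (p : GroupCStar G) :
    ‖(Matrix.of fun i j : ι => functional (u i j) p)‖ₑ ≤ MatrixNorms.matNorm u * ‖p‖ₑ := by
  have h := enorm_functional_le u (Matrix.of fun _ _ : Fin 1 => p)
  rw [OperatorSpace.matNorm_single] at h
  refine le_trans ?_ h
  rw [enorm_le_iff_norm_le]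
  exact Matrix.l2_opNorm_submatrix_le (Matrix.of fun i j : ι × Fin 1 =>
    functional (u i.1 j.1) ((Matrix.of fun _ _ : Fin 1 => p) i.2 j.2))
    (Equiv.prodUnique ι (Fin 1)).symm

theorem continuous_functional (x : GroupCStar G) :
    Continuous fun u : FourierStieltjes G => functional u x :=
  (WeakDual.eval_continuous x).comp continuous_induced_dom

/-! ### The bimodule -/

variable (G) in
/-- The kernel of the trivial representation in `C*(G)`. -/
abbrev augmentation : Submodule ℂ (GroupCStar G) :=
  LinearMap.ker (functional (1 : FourierStieltjes G)).toLinearMap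

theorem isClosed_augmentation : IsClosed (augmentation G : Set (GroupCStar G)) :=
  (functional (1 : FourierStieltjes G)).isClosed_ker

instance : CompleteSpace (augmentation G) := isClosed_augmentation.completeSpace_coe

section

variable {p : GroupCStar G} (h1 : functional (1 : FourierStieltjes G) p = 1)

/-- The projection of `C*(G)` onto the kernel of the trivial representation along `p`. -/
def augProj : GroupCStar G →L[ℂ] augmentation G :=
  (ContinuousLinearMap.id ℂ (GroupCStar G) -
    (functional (1 : FourierStieltjes G)).smulRight p).codRestrict _ fun x => by
      change functional 1 (x - functional 1 x • p) = 0
      rw [map_sub, map_smul, h1, smul_eq_mul, mul_one, sub_self]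

theorem coe_augProj (x : GroupCStar G) :
    (augProj h1 x : GroupCStar G) = x - functional 1 x • p := rfl

theorem augProj_self : augProj h1 p = 0 :=
  Subtype.ext (by rw [coe_augProj, h1, one_smul, sub_self]; rfl)

/-- The action of `B(G)` on the kernel of the trivial representation, viewed as the quotient of
`C*(G)` by the line through `p`. -/
def augAct (u : FourierStieltjes G) : augmentation G →L[ℂ] augmentation G :=
  (augProj h1).comp ((mulOp u).comp (augmentation G).subtypeL)

theorem augAct_apply (u : FourierStieltjes G) (x : augmentation G) :
    augAct h1 u x = augProj h1 (mulOp u x) := rfl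

theorem coe_augAct (u : FourierStieltjes G) (x : augmentation G) :
    (augAct h1 u x : GroupCStar G) = mulOp u x - functional u x • p := by
  rw [augAct_apply, coe_augProj, functional_mulOp, mul_one]

theorem augAct_add (u v : FourierStieltjes G) : augAct h1 (u + v) = augAct h1 u + augAct h1 v := by
  ext x
  simp only [add_apply, augAct_apply, mulOp_add, map_add]

theorem augAct_smul (c : ℂ) (u : FourierStieltjes G) : augAct h1 (c • u) = c • augAct h1 u := by
  ext x
  simp only [smul_apply, augAct_apply, mulOp_smul, map_smul]

/-- The line through `p` is invariant under every `mulOp u`, so the correction terms, multiples of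
`p`, are removed by the projection. -/
theorem augAct_mul (hp : ∀ u : FourierStieltjes G, mulOp u p = functional u p • p)
    (u v : FourierStieltjes G) (x : augmentation G) :
    augAct h1 (u * v) x = augAct h1 v (augAct h1 u x) := by
  rw [augAct_apply, augAct_apply, coe_augAct, mulOp_mul, map_sub, map_sub, map_smul, map_smul,
    hp, map_smul, augProj_self, smul_zero, smul_zero, sub_zero]

theorem matNorm_augAct_le (n r : ℕ) (u : Matrix (Fin n) (Fin n) (FourierStieltjes G))
    (x : Matrix (Fin r) (Fin r) (augmentation G)) (hx : MatrixNorms.matNorm x ≤ 1) :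
    MatrixNorms.matNorm (Matrix.of fun i j : Fin n × Fin r =>
      augAct h1 (u i.1 j.1) (x i.2 j.2)) ≤ (1 + ‖p‖₊ : ℝ≥0) * MatrixNorms.matNorm u := by
  let x' := x.map (augmentation G).subtype
  have hx' : MatrixNorms.matNorm x' ≤ 1 := hx
  let c : Matrix (Fin n × Fin r) (Fin n × Fin r) ℂ :=
    Matrix.of fun i j => functional (u i.1 j.1) (x' i.2 j.2)
  have h2 : (Matrix.of fun i j : Fin n × Fin r => augAct h1 (u i.1 j.1) (x i.2 j.2)).map
      (augmentation G).subtype =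
      (Matrix.of fun i j : Fin n × Fin r => mulOp (u i.1 j.1) (x' i.2 j.2)) +
        Matrix.of fun i j => c i j • (-p) := by
    ext i j
    simp only [Matrix.map_apply, Matrix.of_apply, Matrix.add_apply, Submodule.subtype_apply,
      coe_augAct, smul_neg, sub_eq_add_neg, c, x']
  rw [Submodule.matNorm_def, h2]
  refine (OperatorSpace.matNorm_add_le _ _).trans ?_
  have h3 : MatrixNorms.matNorm u * MatrixNorms.matNorm x' ≤ MatrixNorms.matNorm u := by
    calc _ ≤ MatrixNorms.matNorm u * 1 := by gcongr
      _ = _ := mul_one _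
  have h4 := (matNorm_mulOp_le u x').trans h3
  have h5 : ‖c‖ₑ ≤ MatrixNorms.matNorm u := (enorm_functional_le u x').trans h3
  have h6 := matNorm_smul_const_le c (-p)
  calc _ ≤ MatrixNorms.matNorm u + MatrixNorms.matNorm u * ‖p‖ₑ := by
        refine add_le_add h4 (h6.trans ?_)
        rw [enorm_neg]
        gcongr
    _ = _ := by
        rw [ENNReal.coe_add, ENNReal.coe_one, add_mul, one_mul, mul_comm _ ‖p‖ₑ]
        rfl

theorem augmentation_matNorm_ne_top {ι : Type} [Fintype ι] [DecidableEq ι]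
    (x : Matrix ι ι (augmentation G)) : MatrixNorms.matNorm x ≠ ∞ :=
  GroupCStar.matNorm_ne_top _

/-- The dual of the kernel of the trivial representation as a normal dual operator bimodule: the
left action is the transpose of multiplication, the right action is given by the character
represented by `p`. -/
def augBimodule [T2Space G] (hp : ∀ u : FourierStieltjes G, mulOp u p = functional u p • p) :
    NormalDualOperatorBimodule (FourierStieltjes G) (augmentation G) where
  left := LinearMap.mk₂ ℂ (fun u φ => φ.comp (augAct h1 u))
    (fun u v φ => by rw [augAct_add, ContinuousLinearMap.comp_add])
    (fun c u φ => by rw [augAct_smul, ContinuousLinearMap.comp_smul])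
    (fun u φ ψ => ContinuousLinearMap.add_comp _ _ _)
    (fun c u φ => ContinuousLinearMap.smul_comp _ _ _)
  right := LinearMap.mk₂ ℂ (fun u φ => functional u p • φ)
    (fun u v φ => (congrArg (· • φ) (functional_add u v p)).trans (add_smul _ _ φ))
    (fun c u φ => (congrArg (· • φ) (functional_smul c u p)).trans (mul_smul _ _ φ))
    (fun u φ ψ => smul_add _ _ _)
    (fun c u φ => smul_comm _ _ _)
  left_mul u v φ := by
    ext x
    exact congrArg φ (augAct_mul h1 hp u v x)
  right_mul u v φ := by
    change functional (u * v) p • φ = functional v p • functional u p • φ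
    rw [← functional_mulOp, hp, map_smul, smul_smul, smul_eq_mul, mul_comm]
  left_right u v φ := ContinuousLinearMap.smul_comp _ _ _
  left_cb := isJointlyCompletelyBounded_of_predual augmentation_matNorm_ne_top _ (augAct h1)
    (fun _ _ => rfl) (1 + ‖p‖₊) (matNorm_augAct_le h1)
  right_cb := by
    refine isJointlyCompletelyBounded_of_predual augmentation_matNorm_ne_top _
      (fun u => functional u p • ContinuousLinearMap.id ℂ (augmentation G))
      (fun u φ => ?_) ‖p‖₊ (fun n r u x hx => ?_)
    · ext x
      simp
    · let c : Matrix (Fin n) (Fin n) ℂ := Matrix.of fun i j => functional (u i j) p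
      refine (GroupCStar.matNorm_kronecker_le c (x.map (augmentation G).subtype)).trans ?_
      calc _ ≤ (MatrixNorms.matNorm u * ‖p‖ₑ) * 1 :=
            mul_le_mul' (enorm_functional_const_le u p) hx
        _ = _ := by rw [mul_one, mul_comm]; rfl
  left_dual u := WeakDual.continuous_of_continuous_eval fun x =>
    WeakDual.eval_continuous (augAct h1 u x)
  right_dual u := WeakDual.continuous_of_continuous_eval fun x =>
    continuous_const.mul (WeakDual.eval_continuous x)
  -- Normality is the nontrivial topological condition: as a function of `u`, the value at `x` must
  -- be evaluation at some element of `C*(G)`.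
  left_normal φ := WeakDual.continuous_of_continuous_eval fun x => by
    obtain ⟨y, hy⟩ := exists_functional_eq (φ.comp (augProj h1)) (x : GroupCStar G)
    exact (continuous_functional y).congr fun u => (hy u).symm
  right_normal φ := WeakDual.continuous_of_continuous_eval fun x =>
    (continuous_functional p).mul continuous_const

/-! ### A derivation that is not inner -/

/-- The restriction of functionals to the kernel of the trivial representation. -/
def augDerivation : FourierStieltjes G →ₗ[ℂ] StrongDual ℂ (augmentation G) where
  toFun u := (functional u).comp (augmentation G).subtypeL
  map_add' u v := by ext x; exact functional_add u v x
  map_smul' c u := by ext x; exact functional_smul c u x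

theorem isCompletelyBounded_augDerivation :
    IsCompletelyBounded (augDerivation (G := G)) := by
  refine ⟨1, fun n u => iSup_le fun r => iSup₂_le fun x hx => ?_⟩
  refine (enorm_functional_le u (x.map (augmentation G).subtype)).trans ?_
  calc _ ≤ MatrixNorms.matNorm u * 1 := by
        gcongr
        exact hx
    _ = _ := by simp

end

/-- A weak*-continuous character of `B(G)` that vanishes on functions that are `1` on arbitrarily
large compact sets prevents operator Connes-amenability. -/
theorem not_isOperatorConnesAmenable_of_character [T2Space G] {p : GroupCStar G}
    (h1 : functional (1 : FourierStieltjes G) p = 1)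
    (hp : ∀ u : FourierStieltjes G, mulOp u p = functional u p • p)
    (hK : ∀ K : Set G, IsCompact K → ∃ u : FourierStieltjes G,
      (∀ s ∈ K, toFun u s = 1) ∧ functional u p = 0) :
    ¬ IsOperatorConnesAmenable (FourierStieltjes G) := by
  intro hCA
  obtain ⟨φ, hφ⟩ := hCA (augmentation G) (augBimodule h1 hp) augDerivation
    isCompletelyBounded_augDerivation
    (WeakDual.continuous_of_continuous_eval fun x => continuous_functional (x : GroupCStar G))
    (fun u v => by
      ext x
      change functional (u * v) (x : GroupCStar G) = functional v (augAct h1 u x : GroupCStar G) +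
        functional v p * functional u (x : GroupCStar G)
      rw [coe_augAct, map_sub, map_smul, functional_mulOp, smul_eq_mul]
      ring)
  have hφ' : ∀ (u : FourierStieltjes G) (x : augmentation G), functional u (x : GroupCStar G) =
      φ (augAct h1 u x) - functional u p * φ x := fun u x =>
    congrArg (fun ψ : StrongDual ℂ (augmentation G) => ψ x) (hφ u)
  -- Extending `φ` by zero along `p` gives a functional on all of `C*(G)`. When `u` vanishes at `p`,
  -- both the right action and `u · p` vanish, and innerness becomes `ψ(u · y) = ⟨y, u⟩`.
  let ψ : StrongDual ℂ (GroupCStar G) := φ.comp (augProj h1)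
  have hψ : ∀ u : FourierStieltjes G, functional u p = 0 → ∀ y, ψ (mulOp u y) = functional u y := by
    intro u hu y
    have h2 := hφ' u (augProj h1 y)
    rw [hu, zero_mul, sub_zero, augAct_apply, coe_augProj, map_sub, map_sub, map_smul, map_smul,
      hp, hu, zero_smul, smul_zero, smul_zero, sub_zero, sub_zero] at h2
    exact h2.symm
  have hone : ∀ y, ψ y = functional (1 : FourierStieltjes G) y := by
    intro y
    induction y using UniformSpace.Completion.induction_on with
    | hp => exact isClosed_eq (by fun_prop) (by fun_prop)
    | ih f =>
      -- This `u` fixes `f` under multiplication although the character does not see it, so `ψ f` is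
      -- forced to be `∫ f`.
      obtain ⟨u, hu1, hu⟩ := hK _ (PreGroupCStar.toCc G f).hasCompactSupport.isCompact
      have hmul : mulPre u f = f := by
        apply (PreGroupCStar.toCc G).injective
        ext s
        rw [toCc_mulPre]
        by_cases hs : s ∈ tsupport (PreGroupCStar.toCc G f)
        · rw [hu1 s hs, one_mul]
        · rw [image_eq_zero_of_notMem_tsupport hs, mul_zero]
      have h2 := hψ u hu (f : GroupCStar G)
      have h3 := functional_mulOp u 1 (f : GroupCStar G)
      rw [mul_one] at h3
      rw [← h3] at h2
      rwa [mulOp_coe, hmul] at h2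
  have h2 : ψ p = 0 := by
    change φ (augProj h1 p) = 0
    rw [augProj_self, map_zero]
  rw [hone, h1] at h2
  exact one_ne_zero h2

end FourierStieltjes

end

theorem theorem3p2 {G : Type*} [Group G] [TopologicalSpace G] [IsTopologicalGroup G]
    [LocallyCompactSpace G] [T2Space G] [NoncompactSpace G] [MeasurableSpace G] [BorelSpace G]
    (hT : HasPropertyT G) (hAP : Finite (AlmostPeriodicCompactification G)) :
    ¬ IsOperatorConnesAmenable (FourierStieltjes G) := by
  obtain ⟨p, h1, hp, hK⟩ := FourierStieltjes.exists_character_at_infinity hT hAP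
  exact FourierStieltjes.not_isOperatorConnesAmenable_of_character h1 hp hK
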